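/- Let $T$ be a complete first-order theory in a countable single-sorted language $\mathcal L$; structures are non-empty and "definable" means without parameters. Fix a rich sequence $\Phi=(\varphi_n(x_0,\dots,x_{n-1},y))_{n\in\mathbb N}$ of $\mathcal L$-formulas: every formula $\varphi(x_0,\dots,x_{k-1},y)$ occurs, with dummy variables, as $\varphi_n$ for some $n\ge k$. For $M\models T$ let $D_\Phi(M)$ be the set of sequences $a\in M^{\mathbb N}$ such that, for every $n$, if $\exists y\,\varphi_n(a_0,\dots,a_{n-1},y)$ holds in $M$ then $\varphi_n(a_0,\dots,a_{n-1},a_n)$ holds. Let $\mathbf G(T)=\mathbf G_\Phi(T)$ be the set of all types $\operatorname{tp}(a,b)$, where $a,b\in D_\Phi(M)$ both enumerate the same countable model $M\models T$, with the topology of the type space and the operations $\operatorname{tp}(a,b)\operatorname{tp}(b,c)=\operatorname{tp}(a,c)$, $\operatorname{tp}(a,b)^{-1}=\operatorname{tp}(b,a)$. It is a topological groupoid. For a topological groupoid $\mathbf G$ with base $\mathbf B$ (the set of neutral elements), source $s_g=g^{-1}g$ and target $t_g=gg^{-1}$, let $\mathcal H$ be the set of clopen sub-groupoids $\mathbf H\supseteq\mathbf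 B$ of $\mathbf G$. For $k\ge 1$ let $\mathbf G^{[k]}$ be the quotient, with the quotient topology, of $\{(e,g)\in\mathbf B\times\mathbf G^k: e=t_{g_0}=\dots=t_{g_{k-1}}\}$ by the left action of $\mathbf G$; $\mathbf G^k$ acts on it on the right. The language $\mathcal L(\mathbf G)$ has one sort $D_{\mathbf H}$ for each $\mathbf H\in\mathcal H$ and, for all $k\geq 1$ and $\mathbf H_0,\dots,\mathbf H_{k-1}\in\mathcal H$, a predicate $P_X$ on $D_{\mathbf H_0}\times\dots\times D_{\mathbf H_{k-1}}$ for each clopen $X\subseteq\mathbf G^{[k]}$ with $X=X\cdot(\mathbf H_0\times\dots\times\mathbf H_{k-1})$. For $e\in\mathbf B$ let $M_e$ be the $\mathcal L(\mathbf G)$-structure in which $D_{\mathbf H}$ is $e\mathbf G/\mathbf H=\{g\mathbf H:t_g=e\}$ and $P_X$ is $\{(g_i\mathbf H_i)_{i<k}: t_{g_i}=e \text{ for all } i,\ \mathbf G(e,g)\in X\}$. Let $T(\mathbf G)$ be the common theory of all the $M_e$, $e\in\mathbf B$. A bi-interpretation between two theories is a pair of interpretations, of each in the other, such that the models of each theory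 are isomorphic to their twice-interpreted copies, uniformly and definably. An interpretable sort of $T$ is a non-empty definable subset of a definable quotient of a finite power of the home sort. Then, for $\mathbf G=\mathbf G(T)$: 1. There is a bi-interpretation between $T$ and $T(\mathbf G)$ such that, writing $\widehat D_{\mathbf H}$ for the interpretable sort of $T$ that interprets the sort $D_{\mathbf H}$: (a) every interpretable sort of $T$ is in definable bijection with $\widehat D_{\mathbf H}$ for some $\mathbf H\in\mathcal H$; (b) for all $k\ge1$ and $\mathbf H_0,\dots,\mathbf H_{k-1}\in\mathcal H$, every $T$-formula on $\widehat D_{\mathbf H_0}\times\dots\times \widehat D_{\mathbf H_{k-1}}$ is equivalent modulo $T$ to the interpretation of $P_X$ for exactly one clopen $X\subseteq\mathbf G^{[k]}$ invariant under $\mathbf H_0\times\dots\times\mathbf H_{k-1}$. That is, up to a change of language, the sorts of $T(\mathbf G)$ are all the interpretable sorts of $T$, with the full induced structure. 2. If $T'$ is another complete theory in a countable single-sorted language and $\mathbf G(T)\cong\mathbf G(T')$ as topological groupoids (for some choices of rich sequences), then $T$ and $T'$ are bi-interpretable. -/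

import Mathlib

universe u v u' v' w us uf ur us' uf' ur'

namespace Reconstruction

/-! ## Groupoids and topological groupoids (partial composition on a set of arrows) -/

/-- A groupoid, given as a set with a partial composition law and an inversion map. -/
class AlgGroupoid (G : Type u) where
  comp : G → G → Part G
  inv : G → G
  assoc : ∀ f g h : G, ((comp f g).bind fun k => comp k h) = (comp g h).bind fun k => comp f k
  inv_comp_dom : ∀ g : G, (comp (inv g) g).Dom
  comp_inv_dom : ∀ g : G, (comp g (inv g)).Dom
  comp_comp_inv : ∀ f g k : G, k ∈ comp f g → f ∈ comp k (inv g)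
  inv_comp_comp : ∀ f g k : G, k ∈ comp f g → g ∈ comp (inv f) k

/-- A topological groupoid: Hausdorff, with composition (on its domain) and inversion continuous. -/
class TopGroupoid (G : Type u) [TopologicalSpace G] [AlgGroupoid G] : Prop where
  t2 : T2Space G
  continuous_comp : Continuous
    fun p : {p : G × G // (AlgGroupoid.comp p.1 p.2).Dom} => (AlgGroupoid.comp p.1.1 p.1.2).get p.2
  continuous_inv : Continuous (AlgGroupoid.inv : G → G)

section Groupoid

variable {G : Type u} [AlgGroupoid G]

/-- The source `g⁻¹ g`. -/
def src (g : G) : G := (AlgGroupoid.comp (AlgGroupoid.inv g) g).get (AlgGroupoid.inv_comp_dom g)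

/-- The target `g g⁻¹`. -/
def tgt (g : G) : G := (AlgGroupoid.comp g (AlgGroupoid.inv g)).get (AlgGroupoid.comp_inv_dom g)

variable (G) in
/-- The base: the set of neutral elements, `e² = e`. -/
def base : Set G := {e | e ∈ AlgGroupoid.comp e e}

theorem tgt_of_mem_base {e : G} (he : e ∈ base G) : tgt e = e :=
  Part.get_eq_of_mem (AlgGroupoid.comp_comp_inv e e e he) _

/-- The set of all defined products `a b` with `a ∈ A`, `b ∈ B`. -/
def setComp (A B : Set G) : Set G := {k | ∃ a ∈ A, ∃ b ∈ B, k ∈ AlgGroupoid.comp a b}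

/-- The coset `g H`. -/
def coset (g : G) (H : Set G) : Set G := setComp {g} H

variable (G) in
/-- The clopen sub-groupoids containing the base. -/
def ClopenSub [TopologicalSpace G] : Type u :=
  {H : Set G // IsClopen H ∧ H = setComp H (AlgGroupoid.inv '' H) ∧ base G ⊆ H}

variable (G) in
/-- The `k`-fold `t`-fibred power `{(e, g) ∈ B × G^k : e = t(g_i) for all i}`. -/
def FibPow (k : ℕ) : Type u :=
  {p : G × (Fin k → G) // p.1 ∈ base G ∧ ∀ i, p.1 = tgt (p.2 i)}

instance [TopologicalSpace G] (k : ℕ) : TopologicalSpace (FibPow G k) :=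
  inferInstanceAs (TopologicalSpace {p : G × (Fin k → G) // p.1 ∈ base G ∧ ∀ i, p.1 = tgt (p.2 i)})

/-- `q = f · p` for the left action of `G` on the fibred power: `f` has source the base point of
`p`, and `q` has base point the target of `f` and coordinates `f p_i`. -/
def LeftAct {k : ℕ} (f : G) (p q : FibPow G k) : Prop :=
  src f = p.1.1 ∧ tgt f = q.1.1 ∧ ∀ i, q.1.2 i ∈ AlgGroupoid.comp f (p.1.2 i)

variable (G) in
/-- `G^[k]`, the quotient of the fibred power by the left action of `G`. -/
def OrbitPow (k : ℕ) : Type u := Quot fun p q : FibPow G k => ∃ f : G, LeftAct f p q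

instance [TopologicalSpace G] (k : ℕ) : TopologicalSpace (OrbitPow G k) :=
  inferInstanceAs (TopologicalSpace (Quot fun p q : FibPow G k => ∃ f : G, LeftAct f p q))

/-- The orbit `G (e, g)`. -/
def orbit {k : ℕ} (p : FibPow G k) : OrbitPow G k := Quot.mk _ p

/-- `X · (H_0 × ⋯ × H_{k-1})` for the induced right action of `G^k` on `G^[k]`. -/
def rightAct {k : ℕ} (X : Set (OrbitPow G k)) (H : Fin k → Set G) : Set (OrbitPow G k) :=
  {z | ∃ p q : FibPow G k, orbit p ∈ X ∧ orbit q = z ∧ p.1.1 = q.1.1 ∧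
    ∀ i, ∃ h ∈ H i, q.1.2 i ∈ AlgGroupoid.comp (p.1.2 i) h}

end Groupoid

/-- Isomorphisms of topological groupoids. -/
structure GroupoidIso (G : Type u) (G' : Type u') [TopologicalSpace G] [AlgGroupoid G]
    [TopologicalSpace G'] [AlgGroupoid G'] extends G ≃ₜ G' where
  map_comp : ∀ f g : G,
    (AlgGroupoid.comp f g).map toEquiv = AlgGroupoid.comp (toEquiv f) (toEquiv g)

/-! ## Many-sorted first-order logic -/

set_option linter.checkUnivs false in
/-- A many-sorted first-order language. -/
structure MSLanguage where
  Sorts : Type us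
  /-- Function symbols with arguments in the given sorts and value in the given sort. -/
  Functions : ∀ {n : ℕ}, (Fin n → Sorts) → Sorts → Type uf
  /-- Predicate symbols with arguments in the given sorts. -/
  Relations : ∀ {n : ℕ}, (Fin n → Sorts) → Type ur

namespace MSLanguage

/-- Terms with free variables indexed by `α`, the variable `a` being of sort `σ a`. -/
inductive Term (L : MSLanguage.{us, uf, ur}) {α : Type} (σ : α → L.Sorts) :
    L.Sorts → Type (max us uf)
  | var (a : α) : Term L σ (σ a)
  | func {n : ℕ} {d : Fin n → L.Sorts} {s : L.Sorts} (f : L.Functions d s)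
      (ts : ∀ i, Term L σ (d i)) : Term L σ s

/-- First-order formulas with free variables indexed by `α`, the variable `a` being of sort `σ a`.
The quantifier `all s φ` binds the variable `none` of `φ`. -/
inductive Formula (L : MSLanguage.{us, uf, ur}) :
    {α : Type} → (α → L.Sorts) → Type (max 1 us uf ur)
  | falsum {α : Type} {σ : α → L.Sorts} : Formula L σ
  | equal {α : Type} {σ : α → L.Sorts} {s : L.Sorts} (t t' : Term L σ s) : Formula L σ
  | rel {α : Type} {σ : α → L.Sorts} {n : ℕ} {d : Fin n → L.Sorts} (R : L.Relations d)
      (ts : ∀ i, Term L σ (d i)) : Formula L σ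
  | imp {α : Type} {σ : α → L.Sorts} (φ ψ : Formula L σ) : Formula L σ
  | all {α : Type} {σ : α → L.Sorts} (s : L.Sorts)
      (φ : Formula L (fun o : Option α => o.elim s σ)) : Formula L σ

/-- Sentences: formulas without free variables. -/
abbrev Sentence (L : MSLanguage.{us, uf, ur}) : Type (max 1 us uf ur) :=
  L.Formula (fun e : Empty => (e.elim : L.Sorts))

/-- Theories: sets of sentences. -/
abbrev Theory (L : MSLanguage.{us, uf, ur}) : Type (max 1 us uf ur) := Set L.Sentence

/-- Structures; every sort is non-empty. -/
structure Str (L : MSLanguage.{us, uf, ur}) where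
  carrier : L.Sorts → Type w
  nonempty : ∀ s, Nonempty (carrier s)
  funMap : ∀ {n : ℕ} {d : Fin n → L.Sorts} {s : L.Sorts}, L.Functions d s →
    (∀ i, carrier (d i)) → carrier s
  relMap : ∀ {n : ℕ} {d : Fin n → L.Sorts}, L.Relations d → (∀ i, carrier (d i)) → Prop

variable {L : MSLanguage.{us, uf, ur}}

/-- Extend a valuation by a value for the new variable `none`. -/
def optVal {α : Type} {σ : α → L.Sorts} {s : L.Sorts} (M : L.Str) (x : M.carrier s)
    (v : ∀ a, M.carrier (σ a)) : ∀ o : Option α, M.carrier (o.elim s σ)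
  | none => x
  | some a => v a

/-- Combine two valuations. -/
def sumVal {α β : Type} {σ : α → L.Sorts} {τ : β → L.Sorts} (M : L.Str)
    (v : ∀ a, M.carrier (σ a)) (v' : ∀ b, M.carrier (τ b)) :
    ∀ c : α ⊕ β, M.carrier (Sum.elim σ τ c)
  | .inl a => v a
  | .inr b => v' b

/-- The value of a term. -/
def Term.eval {α : Type} {σ : α → L.Sorts} (M : L.Str) (v : ∀ a, M.carrier (σ a)) :
    {s : L.Sorts} → L.Term σ s → M.carrier s
  | _, .var a => v a
  | _, .func f ts => M.funMap f fun i => (ts i).eval M v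

/-- Truth of a formula in a structure under a valuation. -/
def Formula.Realize (M : L.Str) : {α : Type} → {σ : α → L.Sorts} → L.Formula σ →
    (∀ a, M.carrier (σ a)) → Prop
  | _, _, .falsum, _ => False
  | _, _, .equal t t', v => t.eval M v = t'.eval M v
  | _, _, .rel R ts, v => M.relMap R fun i => (ts i).eval M v
  | _, _, .imp φ ψ, v => φ.Realize M v → ψ.Realize M v
  | _, _, .all s φ, v => ∀ x : M.carrier s, φ.Realize M (optVal M x v)

/-- Truth of a sentence. -/
def Str.Sat (M : L.Str) (φ : L.Sentence) : Prop := φ.Realize M fun e => e.elim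

/-- Being a model of a theory. -/
def Str.Models (M : L.Str) (T : L.Theory) : Prop := ∀ φ ∈ T, M.Sat φ

/-- Isomorphisms of structures. -/
structure Str.Iso (M N : L.Str) where
  toEquiv : ∀ s, M.carrier s ≃ N.carrier s
  map_fun : ∀ {n : ℕ} {d : Fin n → L.Sorts} {s : L.Sorts} (f : L.Functions d s)
    (x : ∀ i, M.carrier (d i)),
    toEquiv s (M.funMap f x) = N.funMap f fun i => toEquiv _ (x i)
  map_rel : ∀ {n : ℕ} {d : Fin n → L.Sorts} (R : L.Relations d) (x : ∀ i, M.carrier (d i)),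
    M.relMap R x ↔ N.relMap R fun i => toEquiv _ (x i)

/-! ### Interpretable sorts -/

/-- The data of an interpretable sort: a subset of a finite product of sorts defined by `dom`,
to be divided by the relation defined by `eqv`. -/
structure ISort (L : MSLanguage.{us, uf, ur}) where
  arity : ℕ
  ctx : Fin arity → L.Sorts
  dom : L.Formula ctx
  eqv : L.Formula (Sum.elim ctx ctx)

/-- The tuples of `M` in the domain of `S`. -/
def ISort.Dom (S : L.ISort) (M : L.Str) : Type _ :=
  {x : ∀ i, M.carrier (S.ctx i) // S.dom.Realize M x}

/-- The relation `eqv` on the domain of `S` in `M`. -/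
def ISort.Rel (S : L.ISort) (M : L.Str) (x y : S.Dom M) : Prop :=
  S.eqv.Realize M (sumVal M x.1 y.1)

/-- The elements of `S` in `M`. -/
def ISort.Elts (S : L.ISort) (M : L.Str) : Type _ := Quot (S.Rel M)

/-- `S` is an interpretable sort of the theory `T`: in every model, `eqv` is an equivalence
relation on the (non-empty) domain. -/
def ISort.IsSortOf (S : L.ISort) (T : L.Theory) : Prop :=
  ∀ M : Str.{w} L, M.Models T → Nonempty (S.Dom M) ∧ Equivalence (S.Rel M)

/-- A formula that defines, uniformly in all models of `T`, a bijection between two sorts. -/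
def ISort.DefBij (T : L.Theory) (S S' : L.ISort) : Prop :=
  ∃ β : L.Formula (Sum.elim S.ctx S'.ctx), ∀ M : Str.{w} L, M.Models T →
    ∃ e : S.Elts M ≃ S'.Elts M, ∀ (x : S.Dom M) (y : S'.Dom M),
      e (Quot.mk _ x) = Quot.mk _ y ↔ β.Realize M (sumVal M x.1 y.1)

/-- The variables of a formula on a finite product of interpretable sorts. -/
abbrev prodCtx {n : ℕ} (S : Fin n → L.ISort) : (Σ i, Fin (S i).arity) → L.Sorts :=
  fun p => (S p.1).ctx p.2

/-- The valuation given by a tuple of elements of the domains. -/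
def prodVal {n : ℕ} {S : Fin n → L.ISort} (M : L.Str) (x : ∀ i, (S i).Dom M) :
    ∀ p, M.carrier (prodCtx S p) :=
  fun p => (x p.1).1 p.2

/-- A formula on a product of interpretable sorts that, modulo `T`, respects the equivalence
relations, i.e., a formula in these sorts. -/
def InvariantFormula {n : ℕ} (T : L.Theory) (S : Fin n → L.ISort) (ψ : L.Formula (prodCtx S)) :
    Prop :=
  ∀ M : Str.{w} L, M.Models T → ∀ x y : ∀ i, (S i).Dom M, (∀ i, (S i).Rel M (x i) (y i)) →
    (ψ.Realize M (prodVal M x) ↔ ψ.Realize M (prodVal M y))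

/-! ### Interpretations and bi-interpretations -/

/-- An interpretation scheme of the language `L'` in the language `L`: an interpretable sort for
each sort, a formula for (the graph of) each function symbol and for each relation symbol. -/
structure Scheme (L : MSLanguage.{us, uf, ur}) (L' : MSLanguage.{us', uf', ur'}) where
  sort : L'.Sorts → L.ISort
  func : ∀ {n : ℕ} {d : Fin n → L'.Sorts} {s : L'.Sorts}, L'.Functions d s →
    L.Formula (Sum.elim (prodCtx fun i => sort (d i)) (sort s).ctx)
  rel : ∀ {n : ℕ} {d : Fin n → L'.Sorts}, L'.Relations d → L.Formula (prodCtx fun i => sort (d i))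

variable {L' : MSLanguage.{us', uf', ur'}}

/-- Coordinate maps exhibiting the `L'`-structure `N` as the structure interpreted in the
`L`-structure `M` by the scheme `I`: they identify each sort of `N` with the corresponding
interpretable sort in `M`, and the symbols of `L'` are interpreted as the formulas of `I` say. -/
structure Scheme.Coord (I : Scheme L L') (M : L.Str) (N : L'.Str) where
  map : ∀ s, (I.sort s).Dom M → N.carrier s
  surj : ∀ s, Function.Surjective (map s)
  eqv : ∀ s (x y : (I.sort s).Dom M), map s x = map s y ↔ (I.sort s).Rel M x y
  func : ∀ {n : ℕ} {d : Fin n → L'.Sorts} {s : L'.Sorts} (f : L'.Functions d s)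
    (x : ∀ i, (I.sort (d i)).Dom M) (y : (I.sort s).Dom M),
    N.funMap f (fun i => map _ (x i)) = map s y ↔
      (I.func f).Realize M (sumVal M (prodVal M x) y.1)
  rel : ∀ {n : ℕ} {d : Fin n → L'.Sorts} (R : L'.Relations d) (x : ∀ i, (I.sort (d i)).Dom M),
    N.relMap R (fun i => map _ (x i)) ↔ (I.rel R).Realize M (prodVal M x)

/-- `I` is an interpretation of the theory `T'` in the theory `T`: in each model of `T` it
interprets a model of `T'`. -/
def Scheme.Interprets (I : Scheme L L') (T : L.Theory) (T' : L'.Theory) : Prop :=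
  ∀ M : Str.{w} L, M.Models T → ∃ N : Str.{w} L', N.Models T' ∧ Nonempty (I.Coord M N)

/-- If `I` interprets `N` in `M` and `J` interprets `K` in `N`, so that `K` is a structure in the
language of `M` interpreted in `M`, then there is an isomorphism of `M` with `K` whose graph, pulled
back to tuples of `M` by the coordinate maps, is defined by formulas `θ` that do not depend on the
model `M` of `T`. -/
def Scheme.UniformlyIsoSelf (I : Scheme L L') (J : Scheme L' L) (T : L.Theory) : Prop :=
  ∃ θ : ∀ s : L.Sorts, L.Formula
      (Sum.elim (fun _ : Unit => s) (prodCtx fun i => I.sort ((J.sort s).ctx i))),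
    ∀ (M : Str.{w} L) (N : Str.{w} L') (K : Str.{w} L), M.Models T →
      ∀ (f : I.Coord M N) (g : J.Coord N K), ∃ h : M.Iso K,
        ∀ (s : L.Sorts) (x : M.carrier s) (y : ∀ i, (I.sort ((J.sort s).ctx i)).Dom M)
          (hy : (J.sort s).dom.Realize N fun i => f.map _ (y i)),
          h.toEquiv s x = g.map s ⟨fun i => f.map _ (y i), hy⟩ ↔
            (θ s).Realize M (sumVal M (fun _ => x) (prodVal M y))

/-- A bi-interpretation: a pair of interpretations, of `T'` in `T` and of `T` in `T'`, such that
the models of each theory are uniformly definably isomorphic to their twice interpreted copies. -/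
structure IsBiInterpretation (T : L.Theory) (T' : L'.Theory) (I : Scheme L L') (J : Scheme L' L) :
    Prop where
  left : Scheme.Interprets.{w} I T T'
  right : Scheme.Interprets.{w} J T' T
  left_self : Scheme.UniformlyIsoSelf.{w} I J T
  right_self : Scheme.UniformlyIsoSelf.{w} J I T'

/-- Bi-interpretability of theories. -/
def BiInterpretable (T : L.Theory) (T' : L'.Theory) : Prop :=
  ∃ (I : Scheme L L') (J : Scheme L' L), IsBiInterpretation.{w} T T' I J

end MSLanguage

/-! ## Single-sorted theories as many-sorted ones -/

section SingleSorted

/-- A single-sorted language, seen as a many-sorted one. -/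
def msLang (L : FirstOrder.Language.{u, v}) : MSLanguage.{0, u, v} where
  Sorts := Unit
  Functions {n} _ _ := L.Functions n
  Relations {n} _ := L.Relations n

variable {L : FirstOrder.Language.{u, v}}

/-- Translation of terms, along a renaming of the variables. -/
def msTerm {α : Type} {β : Type} (r : α → β) :
    L.Term α → (msLang L).Term (fun _ : β => ()) ()
  | .var a => .var (L := msLang L) (r a)
  | .func f ts => .func (L := msLang L) (d := fun _ => ()) f fun i => msTerm r (ts i)

/-- Translation of formulas, along a renaming of the free and the quantified variables. -/
def msFormula {α : Type} : {n : ℕ} → {β : Type} → (α ⊕ Fin n → β) →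
    L.BoundedFormula α n → (msLang L).Formula (fun _ : β => ())
  | _, _, _, .falsum => .falsum
  | _, _, r, .equal t t' => .equal (msTerm r t) (msTerm r t')
  | _, _, r, .rel R ts =>
      .rel (L := msLang L) (d := fun _ => ()) R fun i => msTerm r (ts i)
  | _, _, r, .imp φ ψ => .imp (msFormula r φ) (msFormula r ψ)
  | n, β, r, .all φ => .all (L := msLang L) () (msFormula (n := n + 1) (β := Option β)
      (Sum.elim (fun a => some (r (.inl a)))
        (Fin.snoc (α := fun _ => Option β) (fun i => some (r (.inr i))) none)) φ)

/-- Translation of sentences. -/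
def msSentence (φ : L.Sentence) : (msLang L).Sentence :=
  msFormula (β := Empty) (Sum.elim id Fin.elim0) φ

/-- A single-sorted theory, seen as a many-sorted one. -/
def msTheory (T : L.Theory) : (msLang L).Theory := msSentence '' T

end SingleSorted

/-! ## The groupoid of a classical theory -/

/-- A rich sequence: `form n` is a formula `φ_n(x_0, …, x_{n-1}, y)`, and every formula
`φ(x_0, …, x_{k-1}, y)` appears, with dummy variables, as `φ_n` for some `n ≥ k`. -/
structure RichSeq (L : FirstOrder.Language.{u, v}) where
  form : ∀ n : ℕ, L.Formula (Fin n ⊕ Unit)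
  rich : ∀ (k : ℕ) (ψ : L.Formula (Fin k ⊕ Unit)), ∃ (n : ℕ) (h : k ≤ n),
    form n = ψ.relabel (Sum.map (Fin.castLE h) id)

section TheoryGroupoid

variable {L : FirstOrder.Language.{u, v}}

/-- The sequence `a` belongs to `D_Φ` in `M`: whenever `φ_n(a_0, …, a_{n-1}, y)` has a solution in
`M`, then `a_n` is one. -/
def RichSeq.InD (Φ : RichSeq L) {M : Type w} [L.Structure M] (a : ℕ → M) : Prop :=
  ∀ (n : ℕ) (y : M), (Φ.form n).Realize (Sum.elim (fun i : Fin n => a i) fun _ => y) →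
    (Φ.form n).Realize (Sum.elim (fun i : Fin n => a i) fun _ => a n)

/-- `a` is a member of `D_Φ` that enumerates `M`. -/
structure RichSeq.Enumerates (Φ : RichSeq L) (M : Type w) [L.Structure M] (a : ℕ → M) : Prop where
  inD : Φ.InD a
  surj : Function.Surjective a

/-- The groupoid of `T`: all types `tp(a, b)` where `a, b ∈ D_Φ` enumerate the same (countable)
model of `T`, as a subspace of the space of complete types. -/
def ThGroupoid (T : L.Theory) (Φ : RichSeq L) : Type (max u v) :=
  {p : T.CompleteType (ℕ ⊕ ℕ) // ∃ (M : FirstOrder.Language.Theory.ModelType.{u, v, 0} T) (a b : ℕ → M),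
    Φ.Enumerates M a ∧ Φ.Enumerates M b ∧ p = T.typeOf (Sum.elim a b)}

variable {T : L.Theory} {Φ : RichSeq L}

instance : TopologicalSpace (ThGroupoid T Φ) :=
  inferInstanceAs (TopologicalSpace {p : T.CompleteType (ℕ ⊕ ℕ) //
    ∃ (M : FirstOrder.Language.Theory.ModelType.{u, v, 0} T) (a b : ℕ → M),
      Φ.Enumerates M a ∧ Φ.Enumerates M b ∧ p = T.typeOf (Sum.elim a b)})

namespace ThGroupoid

/-- The arrow `tp(a, b)`. -/
def tp (M : FirstOrder.Language.Theory.ModelType.{u, v, 0} T) {a b : ℕ → M} (ha : Φ.Enumerates M a)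
    (hb : Φ.Enumerates M b) : ThGroupoid T Φ :=
  ⟨T.typeOf (Sum.elim a b), M, a, b, ha, hb, rfl⟩

/-- `k` is the composition of `g` and `h`: `g = tp(a, b)`, `h = tp(b, c)` and `k = tp(a, c)`. -/
def IsComp (g h k : ThGroupoid T Φ) : Prop :=
  ∃ (M : FirstOrder.Language.Theory.ModelType.{u, v, 0} T) (a b c : ℕ → M) (ha : Φ.Enumerates M a)
    (hb : Φ.Enumerates M b) (hc : Φ.Enumerates M c),
    g = tp M ha hb ∧ h = tp M hb hc ∧ k = tp M ha hc

/-- `k` is the inverse of `g`: `g = tp(a, b)` and `k = tp(b, a)`. -/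
def IsInv (g k : ThGroupoid T Φ) : Prop :=
  ∃ (M : FirstOrder.Language.Theory.ModelType.{u, v, 0} T) (a b : ℕ → M) (ha : Φ.Enumerates M a)
    (hb : Φ.Enumerates M b), g = tp M ha hb ∧ k = tp M hb ha


/-! ### The groupoid laws -/

theorem tp_eq_iff {M N : FirstOrder.Language.Theory.ModelType.{u, v, 0} T} {a b : ℕ → M}
    {a' b' : ℕ → N} {ha : Φ.Enumerates M a} {hb : Φ.Enumerates M b} {ha' : Φ.Enumerates N a'}
    {hb' : Φ.Enumerates N b'} :
    tp M ha hb = tp N ha' hb' ↔ ∀ ψ : L.Formula (ℕ ⊕ ℕ),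
      ψ.Realize (Sum.elim a b) ↔ ψ.Realize (Sum.elim a' b') := by
  constructor
  · intro h ψ
    have h1 : T.typeOf (Sum.elim a b) = T.typeOf (Sum.elim a' b') := congrArg Subtype.val h
    rw [← FirstOrder.Language.Theory.CompleteType.formula_mem_typeOf (T := T), h1,
      FirstOrder.Language.Theory.CompleteType.formula_mem_typeOf]
  · intro h
    refine Subtype.ext (SetLike.ext fun ψ => ?_)
    show ψ ∈ T.typeOf (Sum.elim a b) ↔ ψ ∈ T.typeOf (Sum.elim a' b')
    rw [FirstOrder.Language.Theory.CompleteType.mem_typeOf,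
      FirstOrder.Language.Theory.CompleteType.mem_typeOf]
    exact h _

/-- Two enumerations with the same type differ by an isomorphism. -/
theorem exists_equiv {α : Type} {M N : Type} [L.Structure M] [L.Structure N] {x : α → M}
    {y : α → N} (hx : Function.Surjective x) (hy : Function.Surjective y)
    (h : ∀ ψ : L.Formula α, ψ.Realize x ↔ ψ.Realize y) : ∃ e : L.Equiv M N, ∀ i, e (x i) = y i := by
  have heq : ∀ i j, x i = x j ↔ y i = y j := by
    intro i j
    have := h (FirstOrder.Language.Term.equal (FirstOrder.Language.Term.var i)
      (FirstOrder.Language.Term.var j))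
    simpa [FirstOrder.Language.Formula.realize_equal] using this
  choose σ hσ using hx
  choose τ hτ using hy
  have key : ∀ i, y (σ (x i)) = y i := fun i => (heq _ _).1 (hσ _)
  have key' : ∀ i, x (τ (y i)) = x i := fun i => (heq _ _).2 (hτ _)
  refine ⟨⟨⟨fun m => y (σ m), fun n => x (τ n), fun m => ?_, fun n => ?_⟩, ?_, ?_⟩, key⟩
  · show x (τ (y (σ m))) = m
    rw [key', hσ]
  · show y (σ (x (τ n))) = n
    rw [key, hτ]
  · intro n f z
    show y (σ (FirstOrder.Language.Structure.funMap f z)) =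
      FirstOrder.Language.Structure.funMap f (fun i => y (σ (z i)))
    have := h (FirstOrder.Language.Term.equal
      (FirstOrder.Language.Term.func f fun i => FirstOrder.Language.Term.var (σ (z i)))
      (FirstOrder.Language.Term.var (σ (FirstOrder.Language.Structure.funMap f z))))
    simp only [FirstOrder.Language.Formula.realize_equal, FirstOrder.Language.Term.realize_func,
      FirstOrder.Language.Term.realize_var, hσ] at this
    exact (this.1 trivial).symm
  · intro n r z
    show FirstOrder.Language.Structure.RelMap r (fun i => y (σ (z i))) ↔ _
    have := h (FirstOrder.Language.Relations.formula r
      fun i => FirstOrder.Language.Term.var (σ (z i)))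
    simp only [FirstOrder.Language.Formula.realize_rel,
      FirstOrder.Language.Term.realize_var, hσ] at this
    exact this.symm

theorem enumerates_equiv {M N : Type} [L.Structure M] [L.Structure N] (e : L.Equiv M N) {a : ℕ → M}
    (ha : Φ.Enumerates M a) : Φ.Enumerates N (e ∘ a) := by
  refine ⟨fun n y hy => ?_, e.surjective.comp ha.surj⟩
  have h1 : ∀ z : M, (Sum.elim (fun i : Fin n => (e ∘ a) i) fun _ : Unit => e z) =
      e ∘ (Sum.elim (fun i : Fin n => a i) fun _ : Unit => z) := by
    intro z
    funext i
    cases i <;> rfl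
  obtain ⟨z, rfl⟩ := e.surjective y
  show (Φ.form n).Realize (Sum.elim (fun i : Fin n => (e ∘ a) i) fun _ : Unit => e (a n))
  rw [h1, FirstOrder.Language.StrongHomClass.realize_formula] at hy ⊢
  exact ha.inD n z hy

theorem tp_equiv {M N : FirstOrder.Language.Theory.ModelType.{u, v, 0} T} (e : L.Equiv M N)
    {a b : ℕ → M} (ha : Φ.Enumerates M a) (hb : Φ.Enumerates M b) :
    tp M ha hb = tp N (enumerates_equiv e ha) (enumerates_equiv e hb) := by
  rw [tp_eq_iff]
  intro ψ
  rw [← FirstOrder.Language.StrongHomClass.realize_formula e, Sum.comp_elim]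

theorem exists_equiv_of_tp_eq {M N : FirstOrder.Language.Theory.ModelType.{u, v, 0} T}
    {a b : ℕ → M} {a' b' : ℕ → N} {ha : Φ.Enumerates M a} {hb : Φ.Enumerates M b}
    {ha' : Φ.Enumerates N a'} {hb' : Φ.Enumerates N b'} (h : tp M ha hb = tp N ha' hb') :
    ∃ e : L.Equiv M N, e ∘ a = a' ∧ e ∘ b = b' := by
  obtain ⟨e, he⟩ := exists_equiv (x := Sum.elim a b) (y := Sum.elim a' b')
    (fun m => (ha.surj m).imp' Sum.inl fun _ h => h)
    (fun m => (ha'.surj m).imp' Sum.inl fun _ h => h) (tp_eq_iff.1 h)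
  exact ⟨e, funext fun i => he (.inl i), funext fun i => he (.inr i)⟩

theorem exists_tp (g : ThGroupoid T Φ) :
    ∃ (M : FirstOrder.Language.Theory.ModelType.{u, v, 0} T) (a b : ℕ → M)
      (ha : Φ.Enumerates M a) (hb : Φ.Enumerates M b), g = tp M ha hb := by
  obtain ⟨p, M, a, b, ha, hb, rfl⟩ := g
  exact ⟨M, a, b, ha, hb, rfl⟩

/-- Compositions may be computed in any given representation of the first factor. -/
theorem isComp_tp_left {M : FirstOrder.Language.Theory.ModelType.{u, v, 0} T} {a b : ℕ → M}
    {ha : Φ.Enumerates M a} {hb : Φ.Enumerates M b} {h k : ThGroupoid T Φ}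
    (H : IsComp (tp M ha hb) h k) :
    ∃ (c : ℕ → M) (hc : Φ.Enumerates M c), h = tp M hb hc ∧ k = tp M ha hc := by
  obtain ⟨N, a', b', c', ha', hb', hc', h1, rfl, rfl⟩ := H
  obtain ⟨e, rfl, rfl⟩ := exists_equiv_of_tp_eq h1.symm
  exact ⟨e ∘ c', enumerates_equiv e hc', tp_equiv e hb' hc', tp_equiv e ha' hc'⟩

theorem isComp_tp {M : FirstOrder.Language.Theory.ModelType.{u, v, 0} T} {a b c : ℕ → M}
    (ha : Φ.Enumerates M a) (hb : Φ.Enumerates M b) (hc : Φ.Enumerates M c) :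
    IsComp (tp M ha hb) (tp M hb hc) (tp M ha hc) :=
  ⟨M, a, b, c, ha, hb, hc, rfl, rfl, rfl⟩

theorem tp_left_cancel {M : FirstOrder.Language.Theory.ModelType.{u, v, 0} T} {a b c : ℕ → M}
    {ha : Φ.Enumerates M a} {hb : Φ.Enumerates M b} {hc : Φ.Enumerates M c}
    (h : tp M ha hb = tp M ha hc) : b = c := by
  obtain ⟨e, h1, h2⟩ := exists_equiv_of_tp_eq h
  have : ∀ m, e m = m := fun m => by
    obtain ⟨i, rfl⟩ := ha.surj m
    exact congrFun h1 i
  rw [← h2]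
  exact funext fun i => (this _).symm

theorem isComp_unique {g h k k' : ThGroupoid T Φ} (H : IsComp g h k) (H' : IsComp g h k') :
    k = k' := by
  obtain ⟨M, a, b, c, ha, hb, hc, rfl, rfl, rfl⟩ := H
  obtain ⟨c', hc', h1, rfl⟩ := isComp_tp_left H'
  obtain rfl := tp_left_cancel h1
  rfl

/-- The composition is defined exactly when `tp(b) = tp(b')`. -/
theorem exists_isComp_iff {M N : FirstOrder.Language.Theory.ModelType.{u, v, 0} T} {a b : ℕ → M}
    {b' c' : ℕ → N} {ha : Φ.Enumerates M a} {hb : Φ.Enumerates M b} {hb' : Φ.Enumerates N b'}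
    {hc' : Φ.Enumerates N c'} :
    (∃ k, IsComp (tp M ha hb) (tp N hb' hc') k) ↔ T.typeOf b = T.typeOf b' := by
  constructor
  · rintro ⟨k, H⟩
    obtain ⟨c, hc, h1, -⟩ := isComp_tp_left H
    obtain ⟨e, -, rfl⟩ := exists_equiv_of_tp_eq h1
    obtain ⟨e, rfl, -⟩ := exists_equiv_of_tp_eq h1
    refine SetLike.ext fun ψ => ?_
    rw [FirstOrder.Language.Theory.CompleteType.mem_typeOf,
      FirstOrder.Language.Theory.CompleteType.mem_typeOf,
      FirstOrder.Language.StrongHomClass.realize_formula]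
  · intro h
    obtain ⟨e, he⟩ := exists_equiv hb'.surj hb.surj fun ψ => by
      rw [← FirstOrder.Language.Theory.CompleteType.formula_mem_typeOf (T := T), ← h,
        FirstOrder.Language.Theory.CompleteType.formula_mem_typeOf]
    obtain rfl : e ∘ b' = b := funext he
    rw [tp_equiv e hb' hc']
    exact ⟨_, isComp_tp ha hb _⟩

open scoped Classical in
/-- The partial composition law. -/
noncomputable def pcomp (g h : ThGroupoid T Φ) : Part (ThGroupoid T Φ) :=
  ⟨∃ k, IsComp g h k, fun H => H.choose⟩

theorem mem_pcomp {g h k : ThGroupoid T Φ} : k ∈ pcomp g h ↔ IsComp g h k := by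
  constructor
  · rintro ⟨H, rfl⟩
    exact H.choose_spec
  · intro H
    exact ⟨⟨k, H⟩, isComp_unique (Exists.choose_spec (⟨k, H⟩ : ∃ k, IsComp g h k)) H⟩

theorem exists_isInv (g : ThGroupoid T Φ) : ∃ k, IsInv g k := by
  obtain ⟨M, a, b, ha, hb, rfl⟩ := exists_tp g
  exact ⟨_, M, a, b, ha, hb, rfl, rfl⟩

/-- The inversion map. -/
noncomputable def pinv (g : ThGroupoid T Φ) : ThGroupoid T Φ := (exists_isInv g).choose

theorem pinv_tp {M : FirstOrder.Language.Theory.ModelType.{u, v, 0} T} {a b : ℕ → M}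
    (ha : Φ.Enumerates M a) (hb : Φ.Enumerates M b) : pinv (tp M ha hb) = tp M hb ha := by
  obtain ⟨N, a', b', ha', hb', h1, h2⟩ := (exists_isInv (tp M ha hb)).choose_spec
  obtain ⟨e, rfl, rfl⟩ := exists_equiv_of_tp_eq h1
  exact h2.trans (tp_equiv e hb ha).symm

noncomputable instance : AlgGroupoid (ThGroupoid T Φ) where
  comp := pcomp
  inv := pinv
  assoc f g h := by
    refine Part.ext fun l => ?_
    simp only [Part.mem_bind_iff, mem_pcomp]
    obtain ⟨M, a, b, ha, hb, rfl⟩ := exists_tp f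
    constructor
    · rintro ⟨k, H1, H2⟩
      obtain ⟨c, hc, rfl, rfl⟩ := isComp_tp_left H1
      obtain ⟨d, hd, rfl, rfl⟩ := isComp_tp_left H2
      exact ⟨_, isComp_tp hb hc hd, isComp_tp ha hb hd⟩
    · rintro ⟨k, H1, H2⟩
      obtain ⟨d, hd, rfl, rfl⟩ := isComp_tp_left H2
      obtain ⟨N, b', c', d', hb', hc', hd', rfl, rfl, h1⟩ := H1
      obtain ⟨e, rfl, rfl⟩ := exists_equiv_of_tp_eq h1.symm
      rw [tp_equiv e hb' hc', tp_equiv e hc' hd']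
      exact ⟨_, isComp_tp ha hb _, isComp_tp ha _ _⟩
  inv_comp_dom g := by
    obtain ⟨M, a, b, ha, hb, rfl⟩ := exists_tp g
    rw [pinv_tp]
    exact ⟨_, isComp_tp hb ha hb⟩
  comp_inv_dom g := by
    obtain ⟨M, a, b, ha, hb, rfl⟩ := exists_tp g
    rw [pinv_tp]
    exact ⟨_, isComp_tp ha hb ha⟩
  comp_comp_inv f g k H := by
    obtain ⟨M, a, b, c, ha, hb, hc, rfl, rfl, rfl⟩ := mem_pcomp.1 H
    rw [pinv_tp]
    exact mem_pcomp.2 (isComp_tp ha hc hb)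
  inv_comp_comp f g k H := by
    obtain ⟨M, a, b, c, ha, hb, hc, rfl, rfl, rfl⟩ := mem_pcomp.1 H
    rw [pinv_tp]
    exact mem_pcomp.2 (isComp_tp hb ha hc)

/-! ### The topology -/

/-- The set `[ψ]` of the arrows `tp(a, b)` such that `ψ(a, b)` holds. -/
def basic (ψ : L.Formula (ℕ ⊕ ℕ)) : Set (ThGroupoid T Φ) :=
  {g | FirstOrder.Language.Formula.equivSentence ψ ∈ g.1}

theorem tp_mem_basic {ψ : L.Formula (ℕ ⊕ ℕ)}
    {M : FirstOrder.Language.Theory.ModelType.{u, v, 0} T} {a b : ℕ → M}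
    {ha : Φ.Enumerates M a} {hb : Φ.Enumerates M b} :
    tp M ha hb ∈ basic ψ ↔ ψ.Realize (Sum.elim a b) :=
  FirstOrder.Language.Theory.CompleteType.formula_mem_typeOf (T := T) (M := M)

theorem isOpen_basic (ψ : L.Formula (ℕ ⊕ ℕ)) : IsOpen (basic ψ : Set (ThGroupoid T Φ)) :=
  (CompleteType.isOpen_typesWith _).preimage continuous_subtype_val

theorem continuous_iff_basic {X : Type*} [TopologicalSpace X] {F : X → ThGroupoid T Φ} :
    Continuous F ↔ ∀ ψ : L.Formula (ℕ ⊕ ℕ), IsOpen (F ⁻¹' basic ψ) := by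
  refine ⟨fun h ψ => (isOpen_basic ψ).preimage h, fun h => ?_⟩
  refine Continuous.subtype_mk (f := fun x => (F x).1) ?_ fun x => (F x).2
  refine continuous_generateFrom_iff.2 ?_
  rintro _ ⟨ψ, rfl⟩
  convert h (FirstOrder.Language.Formula.equivSentence.symm ψ) using 1
  ext x
  simp [basic]

/-- Truth of a formula depends only on finitely many of the free variables. -/
theorem realize_congr {α : Type} [DecidableEq α] (ψ : L.Formula α) {M : Type} [L.Structure M]
    {x y : α → M} (h : ∀ i ∈ FirstOrder.Language.BoundedFormula.freeVarFinset ψ, x i = y i) :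
    ψ.Realize x ↔ ψ.Realize y := by
  have hx := FirstOrder.Language.BoundedFormula.realize_restrictFreeVar' (φ := ψ)
    (s := ↑(FirstOrder.Language.BoundedFormula.freeVarFinset ψ)) Set.Subset.rfl (v := x)
    (xs := default)
  have hy := FirstOrder.Language.BoundedFormula.realize_restrictFreeVar' (φ := ψ)
    (s := ↑(FirstOrder.Language.BoundedFormula.freeVarFinset ψ)) Set.Subset.rfl (v := y)
    (xs := default)
  have : x ∘ ((↑) : (↑(FirstOrder.Language.BoundedFormula.freeVarFinset ψ) : Set α) → α) =
      y ∘ (↑) := funext fun i => h i.1 i.2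
  rw [this] at hx
  exact hx.symm.trans hy

instance : TopGroupoid (ThGroupoid T Φ) where
  t2 := inferInstanceAs (T2Space {p : T.CompleteType (ℕ ⊕ ℕ) //
    ∃ (M : FirstOrder.Language.Theory.ModelType.{u, v, 0} T) (a b : ℕ → M),
      Φ.Enumerates M a ∧ Φ.Enumerates M b ∧ p = T.typeOf (Sum.elim a b)})
  continuous_inv := by
    rw [continuous_iff_basic]
    intro ψ
    convert isOpen_basic (T := T) (Φ := Φ) (ψ.relabel Sum.swap) using 1
    ext g
    obtain ⟨M, a, b, ha, hb, rfl⟩ := exists_tp g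
    show pinv (tp M ha hb) ∈ basic ψ ↔ _
    rw [pinv_tp, tp_mem_basic, tp_mem_basic, FirstOrder.Language.Formula.realize_relabel]
    have : Sum.elim a b ∘ Sum.swap = Sum.elim b a := by
      funext i
      cases i <;> rfl
    rw [this]
  continuous_comp := by
    rw [continuous_iff_basic]
    intro ψ
    rw [isOpen_iff_forall_mem_open]
    rintro ⟨⟨g, h⟩, H⟩ hψ
    obtain ⟨M, a, b, c, ha, hb, hc, hg, hh, hk⟩ := mem_pcomp.1 (Part.get_mem H)
    change g = tp M ha hb at hg
    change h = tp M hb hc at hh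
    change (AlgGroupoid.comp g h).get H = tp M ha hc at hk
    change (AlgGroupoid.comp g h).get H ∈ basic ψ at hψ
    rw [hk, tp_mem_basic] at hψ
    subst hg
    subst hh
    choose σ hσ using fun j => hb.surj (c j)
    set J := (FirstOrder.Language.BoundedFormula.freeVarFinset ψ).toRight with hJ
    refine ⟨{p | p.1.1 ∈ basic (ψ.relabel (Sum.elim Sum.inl fun j => Sum.inr (σ j))) ∧
      ∀ j ∈ J, p.1.2 ∈ basic (FirstOrder.Language.Term.equal
        (FirstOrder.Language.Term.var (Sum.inl (σ j)))
        (FirstOrder.Language.Term.var (Sum.inr j)))}, ?_, ?_, ?_, ?_⟩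
    · rintro ⟨⟨g', h'⟩, H'⟩ ⟨h1, h2⟩
      obtain ⟨M', a', b', c', ha', hb', hc', rfl, rfl, hk'⟩ := mem_pcomp.1 (Part.get_mem H')
      show (AlgGroupoid.comp (tp M' ha' hb') (tp M' hb' hc')).get H' ∈ basic ψ
      dsimp only at hk' h1 h2
      rw [hk', tp_mem_basic]
      rw [tp_mem_basic, FirstOrder.Language.Formula.realize_relabel] at h1
      refine (realize_congr ψ ?_).1 h1
      rintro (i | j) hi
      · rfl
      · have := h2 j (by simpa [hJ] using hi)
        rw [tp_mem_basic, FirstOrder.Language.Formula.realize_equal] at this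
        simpa using this
    · refine ((isOpen_basic _).preimage (continuous_fst.comp continuous_subtype_val)).inter ?_
      show IsOpen {p : {p : ThGroupoid T Φ × ThGroupoid T Φ // (AlgGroupoid.comp p.1 p.2).Dom} |
        ∀ j ∈ J, p.1.2 ∈ basic _}
      have : ∀ (s : Finset ℕ) (ψ' : ℕ → L.Formula (ℕ ⊕ ℕ)),
          IsOpen {p : {p : ThGroupoid T Φ × ThGroupoid T Φ // (AlgGroupoid.comp p.1 p.2).Dom} |
            ∀ j ∈ s, p.1.2 ∈ basic (ψ' j)} := by
        intro s ψ'
        have h3 := isOpen_biInter_finset (s := s) (f := fun j =>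
          {p : {p : ThGroupoid T Φ × ThGroupoid T Φ // (AlgGroupoid.comp p.1 p.2).Dom} |
            p.1.2 ∈ basic (ψ' j)}) fun j _ =>
              (isOpen_basic (ψ' j)).preimage (continuous_snd.comp continuous_subtype_val)
        convert h3 using 1
        ext p
        simp
      exact this J _
    · show tp M ha hb ∈ basic _
      rw [tp_mem_basic, FirstOrder.Language.Formula.realize_relabel]
      refine (realize_congr ψ ?_).1 hψ
      rintro (i | j) _
      · rfl
      · exact (hσ j).symm
    · intro j _
      show tp M hb hc ∈ basic _
      rw [tp_mem_basic, FirstOrder.Language.Formula.realize_equal]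
      exact hσ j

end ThGroupoid
end TheoryGroupoid

/-! ## The theory of a groupoid -/

section Reconstructed

variable (G : Type u) [TopologicalSpace G] [AlgGroupoid G] [TopGroupoid G]

/-- The language of `G`: a sort for each clopen sub-groupoid containing the base, and, for `k ≥ 1`,
a `k`-ary predicate symbol for each clopen subset of `G^[k]` that is invariant under the product of
the corresponding sub-groupoids. -/
def gLang : MSLanguage.{u, 0, u} where
  Sorts := ClopenSub G
  Functions _ _ := Empty
  Relations {k} H := {X : Set (OrbitPow G k) // 1 ≤ k ∧ IsClopen X ∧ X = rightAct X fun i => (H i).1}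

variable {G}

/-- The structure `M_e`: the sort of `H` is the set `e G / H` of cosets `g H` with `t(g) = e`. -/
def gStr (e : G) (he : e ∈ base G) : (gLang G).Str where
  carrier H := {C : Set G // ∃ g, tgt g = e ∧ C = coset g H.1}
  nonempty H := ⟨⟨coset e H.1, e, tgt_of_mem_base he, rfl⟩⟩
  funMap f := f.elim
  relMap {k H} X C := ∃ p : FibPow G k, p.1.1 = e ∧ (∀ i, (C i).1 = coset (p.1.2 i) (H i).1) ∧
    orbit p ∈ X.1

variable (G) in
/-- The theory of the family of structures `M_e`. -/
def gTheory : (gLang G).Theory := {φ | ∀ (e : G) (he : e ∈ base G), (gStr e he).Sat φ}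

end Reconstructed

end Reconstruction

/-!
The groupoid `G = G(T)` sees the models of `T` through their enumerations. A neutral element is the
type `tp(a, a)` of an enumeration `a ∈ D_Φ` of a countable model, and once `a` is fixed, an arrow
with target `tp(a, a)` is the same thing as another enumeration `b ∈ D_Φ` of this model (`arr a b`).
So a family of arrows with a common target is a family of enumerations, and passing to orbits in
`G^[k]` amounts to forgetting `a`.

The key fact is that topology is definability. Call a predicate of families of enumerations clopen
if it and its negation are unions of conditions given by formulas (`ClopenPred`). Because `Φ` is
rich, a tuple is an initial segment of a member of `D_Φ` precisely when it satisfies a certain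
formula, so projections of first-order conditions on enumerations are first-order
(`exists_projection_formula`). Compactness of the type spaces then shows that a clopen predicate
that depends only on finitely many entries is given by a formula in these entries
(`ClopenPred.exists_formula`), and that a clopen equivalence relation depends only on initial
segments of some fixed length (`ClopenPred.exists_eqv_formula`). Hence, for a clopen sub-groupoid
`H`, the cosets `arr a b H` form an interpretable sort: initial segments of enumerations, modulo a
definable relation. Clopen subsets of `G^[k]` are the same as clopen predicates of `k` enumerations
(`ThGroupoid.clopenPred_orbit`, `ThGroupoid.ClopenPred.exists_orbit`), so the predicates `P_X` are
the formulas in these sorts. In the other direction, richness provides, for every non-empty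
definable set, places at which the members of `D_Φ` have an arbitrary tuple of this set
(`exists_henkin`). Applied to the universe, this yields a place `p` such that the sort of the
sub-groupoid `{tp(b, c) : b_p = c_p}` is the universe of the model; applied to the domain of an
interpretable sort, it identifies this sort with the sort of a clopen sub-groupoid.

Syntax enters through a general criterion, `Scheme.isBiInterpretation_of_generic`. Suppose a family
of structures is generic for a theory, in the sense that a sentence true in all of them holds in all
models. To see that two interpretation schemes form a bi-interpretation, it is enough to exhibit the
coordinate maps and the definability of the isomorphisms on generic families for the two theories,
since all conditions can be expressed by sentences. For a complete theory every non-empty family of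
models is generic; for `T(G)`, the family of the `M_e` is. This also takes care of models of any
size and in any universe.

For the second part, an isomorphism `F : G(T) → G(T')` matches pairs `(M, a)` and `(M', a')` with
`F (tp(a, a)) = tp(a', a')`, and then the enumerations `b` of `M` with the enumerations `b'` of `M'`
by `F (tp(a, b)) = tp(a', b')` (`Correspondence`). Since `F` is a homeomorphism, clopen predicates
of the `b'` are clopen predicates of the `b` (`Correspondence.clopenPred`). So `M'`, as a quotient
of the set of its enumerations by the equality of the entries at some place, is interpreted in `M`,
and conversely.
-/

namespace Reconstruction

/-! ### Substitution and finite quantification in many-sorted logic -/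

namespace MSLanguage

section Substitution

variable {L : MSLanguage.{us, uf, ur}}

/-- Simultaneous substitution of terms for the variables of a term. -/
def Term.subst {α β : Type} {σ : α → L.Sorts} {τ : β → L.Sorts} (ts : ∀ a, L.Term τ (σ a)) :
    {s : L.Sorts} → L.Term σ s → L.Term τ s
  | _, .var a => ts a
  | _, .func f us => .func f fun i => (us i).subst ts

/-- A substitution extended under a quantifier. -/
def substOpt {α β : Type} {σ : α → L.Sorts} {τ : β → L.Sorts} (s : L.Sorts)
    (ts : ∀ a, L.Term τ (σ a)) :
    ∀ o : Option α, L.Term (fun o : Option β => o.elim s τ) (o.elim s σ)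
  | none => .var (σ := fun o : Option β => o.elim s τ) none
  | some a => (ts a).subst fun b => .var (σ := fun o : Option β => o.elim s τ) (some b)

/-- Simultaneous substitution of terms for the free variables of a formula. -/
def Formula.subst : {α : Type} → {σ : α → L.Sorts} → L.Formula σ → {β : Type} →
    {τ : β → L.Sorts} → (∀ a, L.Term τ (σ a)) → L.Formula τ
  | _, _, .falsum, _, _, _ => .falsum
  | _, _, .equal t t', _, _, ts => .equal (t.subst ts) (t'.subst ts)
  | _, _, .rel R us, _, _, ts => .rel R fun i => (us i).subst ts
  | _, _, .imp φ ψ, _, _, ts => .imp (φ.subst ts) (ψ.subst ts)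
  | _, _, .all s φ, _, _, ts => .all s (φ.subst (substOpt s ts))

theorem Term.eval_subst {α β : Type} {σ : α → L.Sorts} {τ : β → L.Sorts}
    (ts : ∀ a, L.Term τ (σ a)) (M : Str.{w} L) (v : ∀ b, M.carrier (τ b)) {s : L.Sorts}
    (t : L.Term σ s) : (t.subst ts).eval M v = t.eval M fun a => (ts a).eval M v := by
  induction t with
  | var a => rfl
  | func f us ih =>
    simp only [Term.subst, Term.eval]
    exact congrArg _ (funext fun i => ih i)

@[simp]
theorem Formula.realize_subst {α β : Type} {σ : α → L.Sorts} {τ : β → L.Sorts}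
    (φ : L.Formula σ) (ts : ∀ a, L.Term τ (σ a)) (M : Str.{w} L) (v : ∀ b, M.carrier (τ b)) :
    (φ.subst ts).Realize M v ↔ φ.Realize M fun a => (ts a).eval M v := by
  induction φ generalizing β with
  | falsum => rfl
  | equal t t' => simp only [Formula.subst, Formula.Realize, Term.eval_subst]
  | rel R us => simp only [Formula.subst, Formula.Realize, Term.eval_subst]
  | imp φ ψ ih ih' => simp only [Formula.subst, Formula.Realize, ih, ih']
  | all s φ ih =>
    simp only [Formula.subst, Formula.Realize, ih]
    refine forall_congr' fun x => iff_of_eq (congrArg _ (funext fun o => ?_))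
    cases o with
    | none => rfl
    | some a =>
      exact Term.eval_subst (τ := fun o : Option _ => o.elim s _) _ M (optVal M x v) (ts a)

namespace Formula

variable {α β : Type} {σ : α → L.Sorts} {τ : β → L.Sorts}

/-- Negation. -/
def neg (φ : L.Formula σ) : L.Formula σ := .imp φ .falsum

/-- Truth. -/
def top : L.Formula σ := .imp .falsum .falsum

/-- Conjunction. -/
def and (φ ψ : L.Formula σ) : L.Formula σ := neg (.imp φ (neg ψ))

/-- Equivalence. -/
def iff (φ ψ : L.Formula σ) : L.Formula σ := and (.imp φ ψ) (.imp ψ φ)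

/-- Conjunction of a finite family. -/
noncomputable def conj [Finite β] (φ : β → L.Formula σ) : L.Formula σ :=
  let _ := Fintype.ofFinite β
  ((Finset.univ : Finset β).toList.map φ).foldr and top

/-- Universal quantification over the variables `Sum.inr i`, when they are indexed by `Fin n`. -/
def allFin : (n : ℕ) → {α : Type} → {σ : α → L.Sorts} → {τ : Fin n → L.Sorts} →
    L.Formula (Sum.elim σ τ) → L.Formula σ
  | 0, _, _, _, φ => φ.subst fun
    | .inl a => .var a
    | .inr i => i.elim0
  | n + 1, α, σ, τ, φ => .all (τ 0) (allFin n (τ := fun i => τ i.succ) (φ.subst fun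
    | .inl a => .var (σ := Sum.elim (fun o : Option α => o.elim (τ 0) σ) fun i : Fin n => τ i.succ)
        (.inl (some a))
    | .inr i => Fin.cases (motive := fun i => L.Term
          (Sum.elim (fun o : Option α => o.elim (τ 0) σ) fun i : Fin n => τ i.succ) (τ i))
        (.var (σ := Sum.elim (fun o : Option α => o.elim (τ 0) σ) fun i : Fin n => τ i.succ)
          (.inl none))
        (fun j => .var
          (σ := Sum.elim (fun o : Option α => o.elim (τ 0) σ) fun i : Fin n => τ i.succ) (.inr j))
        i))

/-- A variable of given sort, under an equation between indices. -/
def varAt {γ : Type} {ρ : γ → L.Sorts} (g : β → γ) (hg : ∀ b, ρ (g b) = τ b) (b : β) :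
    L.Term ρ (τ b) := hg b ▸ .var (g b)

/-- Universal quantification over finitely many variables at once. -/
noncomputable def alls [Finite β] (φ : L.Formula (Sum.elim σ τ)) : L.Formula σ :=
  allFin (Nat.card β) (τ := fun i => τ ((Finite.equivFin β).symm i)) (φ.subst fun
    | .inl a => .var (σ := Sum.elim σ fun i => τ ((Finite.equivFin β).symm i)) (.inl a)
    | .inr b => varAt (ρ := Sum.elim σ fun i => τ ((Finite.equivFin β).symm i))
        (fun b => .inr (Finite.equivFin β b)) (fun b => by simp) b)

/-- Existential quantification over finitely many variables at once. -/
noncomputable def exs [Finite β] (φ : L.Formula (Sum.elim σ τ)) : L.Formula σ := neg (alls (neg φ))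

/-- The universal closure of a formula with finitely many free variables. -/
noncomputable def closure [Finite β] (φ : L.Formula τ) : L.Sentence :=
  alls (φ.subst fun b => .var (σ := Sum.elim (fun e : Empty => (e.elim : L.Sorts)) τ) (.inr b))

variable (M : Str.{w} L) (v : ∀ a, M.carrier (σ a))

@[simp] theorem realize_imp (φ ψ : L.Formula σ) :
    (imp φ ψ).Realize M v ↔ (φ.Realize M v → ψ.Realize M v) := Iff.rfl

@[simp] theorem realize_neg (φ : L.Formula σ) : (neg φ).Realize M v ↔ ¬ φ.Realize M v := Iff.rfl

@[simp] theorem realize_top : (top : L.Formula σ).Realize M v := id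

@[simp] theorem realize_and (φ ψ : L.Formula σ) :
    (and φ ψ).Realize M v ↔ φ.Realize M v ∧ ψ.Realize M v := by
  simp [and]

@[simp] theorem realize_iff (φ ψ : L.Formula σ) :
    (iff φ ψ).Realize M v ↔ (φ.Realize M v ↔ ψ.Realize M v) := by
  simp [iff, iff_def]

@[simp] theorem realize_conj [Finite β] (φ : β → L.Formula σ) :
    (conj φ).Realize M v ↔ ∀ b, (φ b).Realize M v := by
  have key : ∀ l : List (L.Formula σ), (l.foldr and top).Realize M v ↔
      ∀ φ ∈ l, φ.Realize M v := by
    intro l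
    induction l with
    | nil => simp
    | cons a l ih => simp [ih]
  simp [conj, key]

theorem realize_allFin (n : ℕ) {α : Type} {σ : α → L.Sorts} (v : ∀ a, M.carrier (σ a))
    {τ : Fin n → L.Sorts} (φ : L.Formula (Sum.elim σ τ)) :
    (allFin n φ).Realize M v ↔ ∀ x : ∀ i, M.carrier (τ i), φ.Realize M (sumVal M v x) := by
  induction n generalizing α with
  | zero =>
    simp only [allFin, realize_subst]
    have : ∀ x : ∀ i, M.carrier (τ i), sumVal M v x = fun c => Term.eval M v (match c with
        | .inl a => Term.var a
        | .inr i => i.elim0 : L.Term σ (Sum.elim σ τ c)) := fun x => by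
      funext c
      rcases c with a | i
      · rfl
      · exact i.elim0
    exact ⟨fun h x => by rw [this x]; exact h, fun h => by
      have h' := h fun i => i.elim0
      rwa [this] at h'⟩
  | succ n ih =>
    simp only [allFin, Formula.Realize, ih, realize_subst]
    have : ∀ (x : M.carrier (τ 0)) (y : ∀ i : Fin n, M.carrier (τ i.succ)),
        sumVal M v (Fin.cons (α := fun i => M.carrier (τ i)) x y) = _ := fun x y => rfl
    constructor
    · intro h x
      refine (iff_of_eq (congrArg _ (funext fun c => ?_))).1 (h (x 0) fun i => x i.succ)
      rcases c with a | i
      · rfl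
      · refine Fin.cases ?_ (fun j => ?_) i <;> rfl
    · intro h x y
      refine (iff_of_eq (congrArg _ (funext fun c => ?_))).1
        (h (Fin.cons (α := fun i => M.carrier (τ i)) x y))
      rcases c with a | i
      · rfl
      · refine Fin.cases ?_ (fun j => ?_) i <;> rfl

theorem eval_varAt {γ : Type} {ρ : γ → L.Sorts} (g : β → γ) (hg : ∀ b, ρ (g b) = τ b) (b : β)
    (x : ∀ c, M.carrier (ρ c)) : HEq ((varAt g hg b : L.Term ρ (τ b)).eval M x) (x (g b)) := by
  unfold varAt
  generalize hg b = h
  generalize τ b = t at h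
  subst h
  rfl

@[simp] theorem realize_alls [Finite β] (φ : L.Formula (Sum.elim σ τ)) :
    (alls φ).Realize M v ↔ ∀ x : ∀ b, M.carrier (τ b), φ.Realize M (sumVal M v x) := by
  simp only [alls, realize_allFin, realize_subst]
  constructor
  · intro h x
    refine (iff_of_eq (congrArg _ (funext fun c => ?_))).1
      (h fun i => x ((Finite.equivFin β).symm i))
    rcases c with a | b
    · rfl
    · refine eq_of_heq ((eval_varAt M _ _ b _).trans ?_)
      show HEq (x ((Finite.equivFin β).symm (Finite.equivFin β b))) (x b)
      rw [Equiv.symm_apply_apply]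
  · intro h x
    let y : ∀ b, M.carrier (τ b) := fun b =>
      (varAt (ρ := fun i => τ ((Finite.equivFin β).symm i)) (Finite.equivFin β)
        (fun b => by simp) b).eval M x
    refine (iff_of_eq (congrArg _ (funext fun c => ?_))).1 (h y)
    rcases c with a | b
    · rfl
    · exact eq_of_heq ((eval_varAt (τ := τ) (ρ := fun i => τ ((Finite.equivFin β).symm i)) M
        (Finite.equivFin β) (fun b => by simp) b x).trans
        (eval_varAt (τ := τ) (ρ := Sum.elim σ fun i => τ ((Finite.equivFin β).symm i)) M
          (fun b => .inr (Finite.equivFin β b)) (fun b => by simp) b (sumVal M v x)).symm)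

@[simp] theorem realize_exs [Finite β] (φ : L.Formula (Sum.elim σ τ)) :
    (exs φ).Realize M v ↔ ∃ x : ∀ b, M.carrier (τ b), φ.Realize M (sumVal M v x) := by
  simp [exs]

theorem sat_closure [Finite β] (φ : L.Formula τ) :
    M.Sat φ.closure ↔ ∀ x : ∀ b, M.carrier (τ b), φ.Realize M x := by
  simp only [Str.Sat, closure, realize_alls]
  exact forall_congr' fun x => realize_subst _ _ _ _

variable {M v}

theorem realize_subst_of {φ : L.Formula τ} {ts : ∀ b, L.Term σ (τ b)}
    {x : ∀ b, M.carrier (τ b)} (h : ∀ b, (ts b).eval M v = x b) :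
    (φ.subst ts).Realize M v ↔ φ.Realize M x := by
  rw [realize_subst, funext h]

theorem realize_imp_of {φ ψ : L.Formula σ} {A B : Prop} (h : φ.Realize M v ↔ A)
    (h' : ψ.Realize M v ↔ B) : (imp φ ψ).Realize M v ↔ (A → B) :=
  imp_congr h h'

theorem realize_and_of {φ ψ : L.Formula σ} {A B : Prop} (h : φ.Realize M v ↔ A)
    (h' : ψ.Realize M v ↔ B) : (and φ ψ).Realize M v ↔ A ∧ B :=
  (realize_and M v φ ψ).trans (and_congr h h')

theorem realize_iff_of {φ ψ : L.Formula σ} {A B : Prop} (h : φ.Realize M v ↔ A)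
    (h' : ψ.Realize M v ↔ B) : (iff φ ψ).Realize M v ↔ (A ↔ B) :=
  (realize_iff M v φ ψ).trans (iff_congr h h')

theorem realize_conj_of [Finite β] {φ : β → L.Formula σ} {A : β → Prop}
    (h : ∀ b, (φ b).Realize M v ↔ A b) : (conj φ).Realize M v ↔ ∀ b, A b :=
  (realize_conj M v φ).trans (forall_congr' h)

end Formula

end Substitution

/-! ### Quantification over interpretable sorts -/

section Domains

variable {L : MSLanguage.{us, uf, ur}} {α κ : Type}

/-- The variables of a formula about a family of interpretable sorts. -/
abbrev famCtx (S : κ → L.ISort) : (Σ i, Fin (S i).arity) → L.Sorts := fun p => (S p.1).ctx p.2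

/-- The valuation given by a family of elements of domains. -/
def famVal {S : κ → L.ISort} {M : Str.{w} L} (x : ∀ i, (S i).Dom M) :
    ∀ p, M.carrier (famCtx S p) :=
  fun p => (x p.1).1 p.2

/-- The formula saying that every tuple of a family belongs to the domain of its sort. -/
noncomputable def domAll [Finite κ] (S : κ → L.ISort) : L.Formula (famCtx S) :=
  .conj fun i => (S i).dom.subst fun j => .var (σ := famCtx S) ⟨i, j⟩

theorem realize_domAll [Finite κ] (S : κ → L.ISort) (M : Str.{w} L)
    (v : ∀ p, M.carrier (famCtx S p)) :
    (domAll S).Realize M v ↔ ∀ i, (S i).dom.Realize M fun j => v ⟨i, j⟩ :=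
  Formula.realize_conj_of fun _ => Formula.realize_subst_of fun _ => rfl

/-- Universal quantification over elements of interpretable sorts. -/
noncomputable def allsDom [Finite κ] {σ : α → L.Sorts} (S : κ → L.ISort)
    (φ : L.Formula (Sum.elim σ (famCtx S))) : L.Formula σ :=
  .alls (.imp ((domAll S).subst fun p => .var (σ := Sum.elim σ (famCtx S)) (.inr p)) φ)

/-- Existential quantification over elements of interpretable sorts. -/
noncomputable def exsDom [Finite κ] {σ : α → L.Sorts} (S : κ → L.ISort)
    (φ : L.Formula (Sum.elim σ (famCtx S))) : L.Formula σ :=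
  .neg (allsDom S (.neg φ))

theorem realize_allsDom [Finite κ] {σ : α → L.Sorts} {S : κ → L.ISort}
    {φ : L.Formula (Sum.elim σ (famCtx S))} {M : Str.{w} L} {v : ∀ a, M.carrier (σ a)}
    {A : (∀ i, (S i).Dom M) → Prop} (h : ∀ x, φ.Realize M (sumVal M v (famVal x)) ↔ A x) :
    (allsDom S φ).Realize M v ↔ ∀ x : ∀ i, (S i).Dom M, A x := by
  refine (Formula.realize_alls M v _).trans ?_
  constructor
  · intro H x
    refine (h x).1 (H (famVal x) ?_)
    exact (Formula.realize_subst_of fun _ => rfl).2 ((realize_domAll S M _).2 fun i => (x i).2)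
  · intro H x hx
    have hx' := (realize_domAll S M _).1 ((Formula.realize_subst_of (x := x) fun _ => rfl).1 hx)
    exact (h fun i => ⟨fun j => x ⟨i, j⟩, hx' i⟩).2 (H _)

theorem realize_exsDom [Finite κ] {σ : α → L.Sorts} {S : κ → L.ISort}
    {φ : L.Formula (Sum.elim σ (famCtx S))} {M : Str.{w} L} {v : ∀ a, M.carrier (σ a)}
    {A : (∀ i, (S i).Dom M) → Prop} (h : ∀ x, φ.Realize M (sumVal M v (famVal x)) ↔ A x) :
    (exsDom S φ).Realize M v ↔ ∃ x : ∀ i, (S i).Dom M, A x := by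
  refine (not_congr (realize_allsDom (φ := .neg φ) (A := fun x => ¬ A x)
    fun x => not_congr (h x))).trans ?_
  simp

end Domains

/-! ### Translation of formulas along an interpretation -/

section Translation

variable {L : MSLanguage.{us, uf, ur}} {L' : MSLanguage.{us', uf', ur'}}

namespace Scheme

variable (I : Scheme L L')

/-- The context of the translation of a formula with context `σ`. -/
abbrev trCtx {α : Type} (σ : α → L'.Sorts) : (Σ a, Fin (I.sort (σ a)).arity) → L.Sorts :=
  famCtx fun a => I.sort (σ a)

/-- The translation of the graph of a term. -/
noncomputable def trTerm {α : Type} {σ : α → L'.Sorts} :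
    {s : L'.Sorts} → L'.Term σ s → L.Formula (Sum.elim (I.trCtx σ) (I.sort s).ctx)
  | _, .var a => (I.sort (σ a)).eqv.subst fun
    | .inl i => .var (σ := Sum.elim (I.trCtx σ) (I.sort (σ a)).ctx) (.inl ⟨a, i⟩)
    | .inr j => .var (σ := Sum.elim (I.trCtx σ) (I.sort (σ a)).ctx) (.inr j)
  | s, .func (d := d) f ts => exsDom (fun i => I.sort (d i)) (.and
      (.conj fun i => (trTerm (ts i)).subst fun
        | .inl p => .var (σ := Sum.elim (Sum.elim (I.trCtx σ) (I.sort s).ctx)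
            (famCtx fun i => I.sort (d i))) (.inl (.inl p))
        | .inr j => .var (σ := Sum.elim (Sum.elim (I.trCtx σ) (I.sort s).ctx)
            (famCtx fun i => I.sort (d i))) (.inr ⟨i, j⟩))
      ((I.func f).subst fun
        | .inl p => .var (σ := Sum.elim (Sum.elim (I.trCtx σ) (I.sort s).ctx)
            (famCtx fun i => I.sort (d i))) (.inr p)
        | .inr j => .var (σ := Sum.elim (Sum.elim (I.trCtx σ) (I.sort s).ctx)
            (famCtx fun i => I.sort (d i))) (.inl (.inr j))))

/-- The translation of a formula. -/
noncomputable def tr : {α : Type} → {σ : α → L'.Sorts} → L'.Formula σ → L.Formula (I.trCtx σ)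
  | _, _, .falsum => .falsum
  | _, σ, .equal (s := s) t t' => exsDom (fun _ : Unit => I.sort s) (.and
      ((I.trTerm t).subst fun
        | .inl p => .var (σ := Sum.elim (I.trCtx σ) (famCtx fun _ : Unit => I.sort s)) (.inl p)
        | .inr j => .var (σ := Sum.elim (I.trCtx σ) (famCtx fun _ : Unit => I.sort s))
            (.inr ⟨(), j⟩))
      ((I.trTerm t').subst fun
        | .inl p => .var (σ := Sum.elim (I.trCtx σ) (famCtx fun _ : Unit => I.sort s)) (.inl p)
        | .inr j => .var (σ := Sum.elim (I.trCtx σ) (famCtx fun _ : Unit => I.sort s))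
            (.inr ⟨(), j⟩)))
  | _, σ, .rel (d := d) R ts => exsDom (fun i => I.sort (d i)) (.and
      (.conj fun i => (I.trTerm (ts i)).subst fun
        | .inl p => .var (σ := Sum.elim (I.trCtx σ) (famCtx fun i => I.sort (d i))) (.inl p)
        | .inr j => .var (σ := Sum.elim (I.trCtx σ) (famCtx fun i => I.sort (d i)))
            (.inr ⟨i, j⟩))
      ((I.rel R).subst fun p =>
        .var (σ := Sum.elim (I.trCtx σ) (famCtx fun i => I.sort (d i))) (.inr p)))
  | _, _, .imp φ ψ => .imp (tr φ) (tr ψ)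
  | _, σ, .all s φ => allsDom (fun _ : Unit => I.sort s) ((tr φ).subst fun
      | ⟨none, j⟩ => .var (σ := Sum.elim (I.trCtx σ) (famCtx fun _ : Unit => I.sort s))
          (.inr ⟨(), j⟩)
      | ⟨some a, j⟩ => .var (σ := Sum.elim (I.trCtx σ) (famCtx fun _ : Unit => I.sort s))
          (.inl ⟨a, j⟩))

variable {I} {M : Str.{w} L} {N : Str.{v} L'} (f : I.Coord M N)
include f

theorem realize_trTerm {α : Type} {σ : α → L'.Sorts} {s : L'.Sorts} (t : L'.Term σ s)
    (x : ∀ a, (I.sort (σ a)).Dom M) (y : (I.sort s).Dom M) :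
    (I.trTerm t).Realize M (sumVal M (famVal x) y.1) ↔
      t.eval N (fun a => f.map _ (x a)) = f.map s y := by
  induction t with
  | var a =>
    refine (Formula.realize_subst_of (x := sumVal M (x a).1 y.1) ?_).trans (f.eqv _ _ _).symm
    rintro (i | j) <;> rfl
  | func F ts ih =>
    refine (realize_exsDom fun z => Formula.realize_and_of
      (Formula.realize_conj_of fun i => ((Formula.realize_subst_of
        (x := sumVal M (famVal x) (z i).1) (by rintro (i | j) <;> rfl)).trans (ih i (z i))))
      ((Formula.realize_subst_of (x := sumVal M (prodVal M z) y.1)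
        (by rintro (i | j) <;> rfl)).trans (f.func F z y).symm)).trans ?_
    show _ ↔ N.funMap F _ = _
    constructor
    · rintro ⟨z, h, h'⟩
      rw [← h']
      exact congrArg _ (funext h)
    · intro h
      choose z hz using fun i => f.surj _ ((ts i).eval N fun a => f.map _ (x a))
      refine ⟨z, fun i => (hz i).symm, ?_⟩
      rw [← h]
      exact congrArg _ (funext hz)

theorem realize_tr {α : Type} {σ : α → L'.Sorts} (φ : L'.Formula σ)
    (x : ∀ a, (I.sort (σ a)).Dom M) :
    (I.tr φ).Realize M (famVal x) ↔ φ.Realize N fun a => f.map _ (x a) := by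
  induction φ with
  | falsum => rfl
  | equal t t' =>
    refine (realize_exsDom fun z => Formula.realize_and_of
      ((Formula.realize_subst_of (x := sumVal M (famVal x) (z ()).1)
        (by rintro (i | j) <;> rfl)).trans (realize_trTerm f t x (z ())))
      ((Formula.realize_subst_of (x := sumVal M (famVal x) (z ()).1)
        (by rintro (i | j) <;> rfl)).trans (realize_trTerm f t' x (z ())))).trans ?_
    show _ ↔ Term.eval N _ t = Term.eval N _ t'
    constructor
    · rintro ⟨z, h, h'⟩
      rw [h, h']
    · intro h
      obtain ⟨z, hz⟩ := f.surj _ (t.eval N fun a => f.map _ (x a))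
      exact ⟨fun _ => z, hz.symm, h ▸ hz.symm⟩
  | rel R ts =>
    refine (realize_exsDom fun z => Formula.realize_and_of
      (Formula.realize_conj_of fun i => ((Formula.realize_subst_of
        (x := sumVal M (famVal x) (z i).1) (by rintro (i | j) <;> rfl)).trans
          (realize_trTerm f (ts i) x (z i))))
      ((Formula.realize_subst_of (x := prodVal M z) fun _ => rfl).trans
        (f.rel R z).symm)).trans ?_
    show _ ↔ N.relMap R _
    constructor
    · rintro ⟨z, h, h'⟩
      rwa [funext h]
    · intro h
      choose z hz using fun i => f.surj _ ((ts i).eval N fun a => f.map _ (x a))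
      exact ⟨z, fun i => (hz i).symm, by rwa [funext hz]⟩
  | imp φ ψ ih ih' => exact imp_congr (ih x) (ih' x)
  | all s φ ih =>
    let opt : (Unit → (I.sort s).Dom M) → ∀ o : Option _, (I.sort (o.elim s _)).Dom M := fun z o =>
      match o with
      | none => z ()
      | some a => x a
    refine (realize_allsDom fun z => (Formula.realize_subst_of (x := famVal (opt z))
        (by rintro ⟨_ | a, j⟩ <;> rfl)).trans (ih (opt z))).trans ?_
    show _ ↔ ∀ y : N.carrier s, _
    have key : ∀ z : Unit → (I.sort s).Dom M, (fun o => f.map _ (opt z o)) =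
        optVal N (f.map s (z ())) fun a => f.map _ (x a) := fun z => by
      funext o
      cases o <;> rfl
    constructor
    · intro h y
      obtain ⟨z, rfl⟩ := f.surj _ y
      exact (iff_of_eq (congrArg _ (key fun _ => z))).1 (h fun _ => z)
    · intro h z
      exact (iff_of_eq (congrArg _ (key z))).2 (h _)

end Scheme

end Translation

/-! ### Transfer of first-order properties from a generic family of models -/

section Abstract

variable {L : MSLanguage.{us, uf, ur}} {L' : MSLanguage.{us', uf', ur'}}

/-- Every sentence true in all members of the family `M` holds in all models of `T`. -/
def Generic {ι : Type*} (T : L.Theory) (M : ι → Str.{u} L) : Prop :=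
  ∀ φ : L.Sentence, (∀ i, (M i).Sat φ) → ∀ K : Str.{w} L, K.Models T → K.Sat φ

/-- First-order statements about elements of sorts of the structure and of interpretable sorts carry
over from a generic family to all models. -/
theorem Generic.transfer {ι : Type*} {T : L.Theory} {M : ι → Str.{u} L} (hT : Generic.{u, w} T M)
    {β κ : Type} [Finite β] [Finite κ] {τ : β → L.Sorts} {S : κ → L.ISort}
    {φ : L.Formula (Sum.elim τ (famCtx S))}
    (h : ∀ i (x : ∀ b, (M i).carrier (τ b)) (z : ∀ k, (S k).Dom (M i)),
      φ.Realize (M i) (sumVal (M i) x (famVal z)))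
    {K : Str.{w} L} (hK : K.Models T) (x : ∀ b, K.carrier (τ b)) (z : ∀ k, (S k).Dom K) :
    φ.Realize K (sumVal K x (famVal z)) := by
  have := hT (allsDom S φ).closure (fun i => (Formula.sat_closure _ _).2 fun x =>
    (realize_allsDom fun z => Iff.rfl).2 (h i x)) K hK
  exact (realize_allsDom fun z => Iff.rfl).1 ((Formula.sat_closure _ _).1 this x) z

theorem Generic.transferDom {ι : Type*} {T : L.Theory} {M : ι → Str.{u} L}
    (hT : Generic.{u, w} T M) {κ : Type} [Finite κ] {S : κ → L.ISort} {φ : L.Formula (famCtx S)}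
    (h : ∀ i (z : ∀ k, (S k).Dom (M i)), φ.Realize (M i) (famVal z))
    {K : Str.{w} L} (hK : K.Models T) (z : ∀ k, (S k).Dom K) :
    φ.Realize K (famVal z) := by
  have := hT.transfer (τ := fun e : Empty => (e.elim : L.Sorts))
    (φ := φ.subst fun p => .var
      (σ := Sum.elim (fun e : Empty => (e.elim : L.Sorts)) (famCtx S)) (.inr p))
    (fun i x z => (Formula.realize_subst_of fun _ => rfl).2 (h i z)) hK (fun e => e.elim) z
  exact (Formula.realize_subst_of fun _ => rfl).1 this

theorem Scheme.Coord.equivalence {I : Scheme L L'} {M : Str.{u} L} {N : Str.{v} L'}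
    (f : I.Coord M N) (s : L'.Sorts) : Equivalence ((I.sort s).Rel M) :=
  ⟨fun _ => (f.eqv s _ _).1 rfl, fun h => (f.eqv s _ _).1 ((f.eqv s _ _).2 h).symm,
    fun h h' => (f.eqv s _ _).1 (((f.eqv s _ _).2 h).trans ((f.eqv s _ _).2 h'))⟩

/-- The relation of an interpretable sort, between two tuples of terms. -/
def ISort.eqvOf (U : L.ISort) {α : Type} {σ : α → L.Sorts} (t t' : ∀ j, L.Term σ (U.ctx j)) :
    L.Formula σ :=
  U.eqv.subst fun
    | .inl j => t j
    | .inr j => t' j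

theorem ISort.realize_eqvOf {U : L.ISort} {α : Type} {σ : α → L.Sorts}
    {t t' : ∀ j, L.Term σ (U.ctx j)} {M : Str.{w} L} {v : ∀ a, M.carrier (σ a)} (x y : U.Dom M)
    (h : ∀ j, (t j).eval M v = x.1 j) (h' : ∀ j, (t' j).eval M v = y.1 j) :
    (U.eqvOf t t').Realize M v ↔ U.Rel M x y :=
  Formula.realize_subst_of (x := sumVal M x.1 y.1) (by
    rintro (j | j)
    · exact h j
    · exact h' j)

variable {ι : Type*} {T : L.Theory} {I : Scheme L L'} {M : ι → Str.{u} L} {N : ι → Str.{v} L'}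

theorem Generic.nonempty_dom (hT : Generic.{u, w} T M) {U : L.ISort}
    (h : ∀ i, Nonempty (U.Dom (M i))) {K : Str.{w} L} (hK : K.Models T) : Nonempty (U.Dom K) := by
  have := hT.transferDom (S := fun e : Empty => (e.elim : L.ISort))
    (φ := exsDom (fun _ : Unit => U) .top) (fun i z =>
      (realize_exsDom (A := fun _ => True) fun x => iff_true_intro id).2
        (let ⟨x⟩ := h i; ⟨fun _ => x, trivial⟩)) hK (fun e => e.elim)
  obtain ⟨x, -⟩ := (realize_exsDom (A := fun _ => True) fun x => iff_true_intro id).1 this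
  exact ⟨x ()⟩

theorem Scheme.nonempty_dom (hT : Generic.{u, w} T M) (f : ∀ i, I.Coord (M i) (N i))
    {K : Str.{w} L} (hK : K.Models T) (s : L'.Sorts) : Nonempty ((I.sort s).Dom K) :=
  hT.nonempty_dom (fun i => let ⟨y⟩ := (N i).nonempty s; let ⟨x, _⟩ := (f i).surj s y; ⟨x⟩) hK

/-- The formula expressing the axioms of equivalence relations for three elements. -/
def ISort.equivFormula (U : L.ISort) : L.Formula (famCtx fun _ : Fin 3 => U) :=
  let e : Fin 3 → Fin 3 → L.Formula (famCtx fun _ : Fin 3 => U) := fun a b =>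
    U.eqvOf (fun j => .var (σ := famCtx fun _ : Fin 3 => U) ⟨a, j⟩)
      fun j => .var (σ := famCtx fun _ : Fin 3 => U) ⟨b, j⟩
  .and (e 0 0) (.and (.imp (e 0 1) (e 1 0)) (.imp (e 0 1) (.imp (e 1 2) (e 0 2))))

theorem ISort.realize_equivFormula (U : L.ISort) (K : Str.{w} L) (z : Fin 3 → U.Dom K) :
    U.equivFormula.Realize K (famVal z) ↔ U.Rel K (z 0) (z 0) ∧
      (U.Rel K (z 0) (z 1) → U.Rel K (z 1) (z 0)) ∧
      (U.Rel K (z 0) (z 1) → U.Rel K (z 1) (z 2) → U.Rel K (z 0) (z 2)) := by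
  have h : ∀ a b : Fin 3, (U.eqvOf (fun j => .var (σ := famCtx fun _ : Fin 3 => U) ⟨a, j⟩)
      fun j => .var (σ := famCtx fun _ : Fin 3 => U) ⟨b, j⟩).Realize K (famVal z) ↔
      U.Rel K (z a) (z b) := fun a b =>
    ISort.realize_eqvOf _ _ (fun _ => rfl) fun _ => rfl
  exact Formula.realize_and_of (h _ _) (Formula.realize_and_of
    (Formula.realize_imp_of (h _ _) (h _ _)) (Formula.realize_imp_of (h _ _)
      (Formula.realize_imp_of (h _ _) (h _ _))))

theorem Generic.equivalence_rel (hT : Generic.{u, w} T M) {U : L.ISort}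
    (h : ∀ i, Equivalence (U.Rel (M i))) {K : Str.{w} L} (hK : K.Models T) :
    Equivalence (U.Rel K) := by
  have key : ∀ z : Fin 3 → U.Dom K, _ := fun z =>
    (U.realize_equivFormula K z).1 (hT.transferDom (fun i z => (U.realize_equivFormula _ z).2
      ⟨(h i).refl _, (h i).symm, (h i).trans⟩) hK z)
  exact ⟨fun x => (key fun _ => x).1, fun {x y} => (key ![x, y, y]).2.1,
    fun {x y z} => (key ![x, y, z]).2.2⟩

/-- The formula saying that `ψ` respects the equivalence relations of the sorts. -/
noncomputable def invFormula {n : ℕ} (S : Fin n → L.ISort) (ψ : L.Formula (prodCtx S)) :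
    L.Formula (famCtx fun p : Fin n × Bool => S p.1) :=
  let σ := famCtx fun p : Fin n × Bool => S p.1
  .imp (.conj fun i => (S i).eqvOf (fun j => .var (σ := σ) ⟨(i, false), j⟩)
      fun j => .var (σ := σ) ⟨(i, true), j⟩)
    (.iff (ψ.subst fun p => .var (σ := σ) ⟨(p.1, false), p.2⟩)
      (ψ.subst fun p => .var (σ := σ) ⟨(p.1, true), p.2⟩))

theorem realize_invFormula {n : ℕ} (S : Fin n → L.ISort) (ψ : L.Formula (prodCtx S))
    (K : Str.{w} L) (z : ∀ p : Fin n × Bool, (S p.1).Dom K) :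
    (invFormula S ψ).Realize K (famVal z) ↔
      ((∀ i, (S i).Rel K (z (i, false)) (z (i, true))) →
        (ψ.Realize K (prodVal K fun i => z (i, false)) ↔
          ψ.Realize K (prodVal K fun i => z (i, true)))) :=
  Formula.realize_imp_of (Formula.realize_conj_of fun _ =>
      ISort.realize_eqvOf _ _ (fun _ => rfl) fun _ => rfl)
    (Formula.realize_iff_of (Formula.realize_subst_of fun _ => rfl)
      (Formula.realize_subst_of fun _ => rfl))

theorem Generic.invariant (hT : Generic.{u, w} T M) {n : ℕ} {S : Fin n → L.ISort}
    {ψ : L.Formula (prodCtx S)} (h : ∀ i (x y : ∀ j, (S j).Dom (M i)),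
      (∀ j, (S j).Rel (M i) (x j) (y j)) →
        (ψ.Realize (M i) (prodVal (M i) x) ↔ ψ.Realize (M i) (prodVal (M i) y))) :
    InvariantFormula.{w} T S ψ := by
  intro K hK x y hxy
  let z : ∀ p : Fin n × Bool, (S p.1).Dom K
    | (i, false) => x i
    | (i, true) => y i
  exact (realize_invFormula S ψ K z).1
    (hT.transferDom (fun i z => (realize_invFormula S ψ _ z).2 (h i _ _)) hK z) hxy

section DefBij

variable {S S' : L.ISort} (β : L.Formula (Sum.elim S.ctx S'.ctx))

/-- Every element of `S` is related to some element of `S'`. -/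
noncomputable def bijTotal : L.Formula (famCtx fun _ : Unit => S) :=
  let σ := Sum.elim (famCtx fun _ : Unit => S) (famCtx fun _ : Unit => S')
  exsDom (fun _ : Unit => S') (β.subst fun
    | .inl i => .var (σ := σ) (.inl ⟨(), i⟩)
    | .inr j => .var (σ := σ) (.inr ⟨(), j⟩))

/-- Every element of `S'` is related to some element of `S`. -/
noncomputable def bijSurj : L.Formula (famCtx fun _ : Unit => S') :=
  let σ := Sum.elim (famCtx fun _ : Unit => S') (famCtx fun _ : Unit => S)
  exsDom (fun _ : Unit => S) (β.subst fun
    | .inl i => .var (σ := σ) (.inr ⟨(), i⟩)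
    | .inr j => .var (σ := σ) (.inl ⟨(), j⟩))

/-- `β` respects and reflects the equivalence relations. -/
noncomputable def bijCongr :
    L.Formula (famCtx (Sum.elim (fun _ : Bool => S) fun _ : Bool => S')) :=
  let σ := famCtx (Sum.elim (fun _ : Bool => S) fun _ : Bool => S')
  let b : Bool → L.Formula σ := fun t => β.subst fun
    | .inl i => .var (σ := σ) ⟨.inl t, i⟩
    | .inr j => .var (σ := σ) ⟨.inr t, j⟩
  let e : L.Formula σ := S.eqvOf (fun j => .var (σ := σ) ⟨.inl false, j⟩)
    fun j => .var (σ := σ) ⟨.inl true, j⟩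
  let e' : L.Formula σ := S'.eqvOf (fun j => .var (σ := σ) ⟨.inr false, j⟩)
    fun j => .var (σ := σ) ⟨.inr true, j⟩
  .imp (b false) (.and (.imp (b true) (.iff e e')) (.imp e (.imp e' (b true))))

theorem realize_bijTotal (K : Str.{w} L) (x : Unit → S.Dom K) :
    (bijTotal β).Realize K (famVal x) ↔
      ∃ y : Unit → S'.Dom K, β.Realize K (sumVal K (x ()).1 (y ()).1) :=
  realize_exsDom fun y => Formula.realize_subst_of (by rintro (i | j) <;> rfl)

theorem realize_bijSurj (K : Str.{w} L) (y : Unit → S'.Dom K) :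
    (bijSurj β).Realize K (famVal y) ↔
      ∃ x : Unit → S.Dom K, β.Realize K (sumVal K (x ()).1 (y ()).1) :=
  realize_exsDom fun x => Formula.realize_subst_of (by rintro (i | j) <;> rfl)

theorem realize_bijCongr (K : Str.{w} L)
    (z : ∀ t, (Sum.elim (fun _ : Bool => S) (fun _ : Bool => S') t).Dom K) :
    (bijCongr β).Realize K (famVal z) ↔
      (β.Realize K (sumVal K (z (.inl false)).1 (z (.inr false)).1) →
        (β.Realize K (sumVal K (z (.inl true)).1 (z (.inr true)).1) →
          (S.Rel K (z (.inl false)) (z (.inl true)) ↔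
            S'.Rel K (z (.inr false)) (z (.inr true)))) ∧
        (S.Rel K (z (.inl false)) (z (.inl true)) → S'.Rel K (z (.inr false)) (z (.inr true)) →
          β.Realize K (sumVal K (z (.inl true)).1 (z (.inr true)).1))) :=
  Formula.realize_imp_of (Formula.realize_subst_of (by rintro (i | j) <;> rfl))
    (Formula.realize_and_of
      (Formula.realize_imp_of (Formula.realize_subst_of (by rintro (i | j) <;> rfl))
        (Formula.realize_iff_of
          (ISort.realize_eqvOf (U := S) (z (.inl false)) (z (.inl true)) (fun _ => rfl)
            fun _ => rfl)
          (ISort.realize_eqvOf (U := S') (z (.inr false)) (z (.inr true)) (fun _ => rfl)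
            fun _ => rfl)))
      (Formula.realize_imp_of
        (ISort.realize_eqvOf (U := S) (z (.inl false)) (z (.inl true)) (fun _ => rfl)
          fun _ => rfl)
        (Formula.realize_imp_of
          (ISort.realize_eqvOf (U := S') (z (.inr false)) (z (.inr true)) (fun _ => rfl)
            fun _ => rfl)
          (Formula.realize_subst_of (by rintro (i | j) <;> rfl)))))

/-- A formula that defines a bijection in every member of a generic family does so in all
models. -/
theorem Generic.defBij (hT : Generic.{u, w} T M)
    (hS : ∀ i, Equivalence (S.Rel (M i))) (hS' : ∀ i, Equivalence (S'.Rel (M i)))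
    (h1 : ∀ i (x : S.Dom (M i)), ∃ y : S'.Dom (M i), β.Realize (M i) (sumVal (M i) x.1 y.1))
    (h2 : ∀ i (y : S'.Dom (M i)), ∃ x : S.Dom (M i), β.Realize (M i) (sumVal (M i) x.1 y.1))
    (h3 : ∀ i (x x' : S.Dom (M i)) (y y' : S'.Dom (M i)),
      β.Realize (M i) (sumVal (M i) x.1 y.1) →
      (β.Realize (M i) (sumVal (M i) x'.1 y'.1) → (S.Rel (M i) x x' ↔ S'.Rel (M i) y y')) ∧
      (S.Rel (M i) x x' → S'.Rel (M i) y y' → β.Realize (M i) (sumVal (M i) x'.1 y'.1))) :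
    ISort.DefBij.{w} T S S' := by
  refine ⟨β, fun K hK => ?_⟩
  have hE := hT.equivalence_rel hS hK
  have hE' := hT.equivalence_rel hS' hK
  have hq : ∀ x y : S.Dom K, Quot.mk (S.Rel K) x = Quot.mk _ y ↔ S.Rel K x y := fun x y =>
    ⟨fun h => hE.eqvGen_iff.1 (Quot.eqvGen_exact h), fun h => Quot.sound h⟩
  have hq' : ∀ x y : S'.Dom K, Quot.mk (S'.Rel K) x = Quot.mk _ y ↔ S'.Rel K x y := fun x y =>
    ⟨fun h => hE'.eqvGen_iff.1 (Quot.eqvGen_exact h), fun h => Quot.sound h⟩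
  have k1 : ∀ x : S.Dom K, ∃ y : S'.Dom K, β.Realize K (sumVal K x.1 y.1) := fun x =>
    let ⟨y, hy⟩ := (realize_bijTotal β K fun _ => x).1 (hT.transferDom (fun i x =>
      (realize_bijTotal β _ x).2 (let ⟨y, hy⟩ := h1 i (x ()); ⟨fun _ => y, hy⟩)) hK _)
    ⟨y (), hy⟩
  have k2 : ∀ y : S'.Dom K, ∃ x : S.Dom K, β.Realize K (sumVal K x.1 y.1) := fun y =>
    let ⟨x, hx⟩ := (realize_bijSurj β K fun _ => y).1 (hT.transferDom (fun i y =>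
      (realize_bijSurj β _ y).2 (let ⟨x, hx⟩ := h2 i (y ()); ⟨fun _ => x, hx⟩)) hK _)
    ⟨x (), hx⟩
  have k3 : ∀ (x x' : S.Dom K) (y y' : S'.Dom K), β.Realize K (sumVal K x.1 y.1) →
      (β.Realize K (sumVal K x'.1 y'.1) → (S.Rel K x x' ↔ S'.Rel K y y')) ∧
      (S.Rel K x x' → S'.Rel K y y' → β.Realize K (sumVal K x'.1 y'.1)) := by
    intro x x' y y'
    let z : ∀ t, (Sum.elim (fun _ : Bool => S) (fun _ : Bool => S') t).Dom K
      | .inl false => x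
      | .inl true => x'
      | .inr false => y
      | .inr true => y'
    exact (realize_bijCongr β K z).1
      (hT.transferDom (fun i z => (realize_bijCongr β _ z).2 (h3 i _ _ _ _)) hK z)
  choose F hF using k1
  let G : S.Elts K → S'.Elts K := Quot.lift (fun x => Quot.mk _ (F x)) fun x x' h =>
    (hq' _ _).2 (((k3 x x' _ _ (hF x)).1 (hF x')).1 h)
  refine ⟨Equiv.ofBijective G ⟨?_, ?_⟩, fun x y => ?_⟩
  · rintro ⟨x⟩ ⟨x'⟩ h
    exact (hq _ _).2 (((k3 x x' _ _ (hF x)).1 (hF x')).2 ((hq' _ _).1 h))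
  · rintro ⟨y⟩
    obtain ⟨x, hx⟩ := k2 y
    exact ⟨Quot.mk _ x, (hq' _ _).2 (((k3 x x _ _ (hF x)).1 hx).1 (hE.refl x))⟩
  · refine (hq' _ _).trans ⟨fun h => (k3 x x _ _ (hF x)).2 (hE.refl x) h, fun h => ?_⟩
    exact ((k3 x x _ _ (hF x)).1 h).1 (hE.refl x)

end DefBij

namespace Scheme

variable (I) in
/-- The formula saying that the interpretation of a function symbol has a value. -/
noncomputable def totalFormula {n : ℕ} {d : Fin n → L'.Sorts} {s : L'.Sorts}
    (F : L'.Functions d s) : L.Formula (famCtx fun i => I.sort (d i)) :=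
  exsDom (fun _ : Unit => I.sort s) ((I.func F).subst fun
    | .inl p => .var (σ := Sum.elim (famCtx fun i => I.sort (d i))
        (famCtx fun _ : Unit => I.sort s)) (.inl p)
    | .inr j => .var (σ := Sum.elim (famCtx fun i => I.sort (d i))
        (famCtx fun _ : Unit => I.sort s)) (.inr ⟨(), j⟩))

theorem realize_totalFormula {n : ℕ} {d : Fin n → L'.Sorts} {s : L'.Sorts}
    (F : L'.Functions d s) (K : Str.{w} L) (x : ∀ i, (I.sort (d i)).Dom K) :
    (I.totalFormula F).Realize K (famVal x) ↔
      ∃ y : Unit → (I.sort s).Dom K, (I.func F).Realize K (sumVal K (prodVal K x) (y ()).1) :=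
  realize_exsDom fun y => Formula.realize_subst_of (by rintro (i | j) <;> rfl)

variable (I) in
/-- The formula saying that the interpretation of a function symbol respects the equivalence
relations and has unique values. -/
noncomputable def congrFunFormula {n : ℕ} {d : Fin n → L'.Sorts} {s : L'.Sorts}
    (F : L'.Functions d s) :
    L.Formula (famCtx fun p : Option (Fin n) × Bool => I.sort (p.1.elim s d)) :=
  let σ := famCtx fun p : Option (Fin n) × Bool => I.sort (p.1.elim s d)
  .imp (.conj fun i => (I.sort (d i)).eqvOf (fun j => .var (σ := σ) ⟨(some i, false), j⟩)
      fun j => .var (σ := σ) ⟨(some i, true), j⟩)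
    (.imp ((I.func F).subst fun
      | .inl p => .var (σ := σ) ⟨(some p.1, false), p.2⟩
      | .inr j => .var (σ := σ) ⟨(none, false), j⟩)
      (.iff ((I.func F).subst fun
        | .inl p => .var (σ := σ) ⟨(some p.1, true), p.2⟩
        | .inr j => .var (σ := σ) ⟨(none, true), j⟩)
        ((I.sort s).eqvOf (fun j => .var (σ := σ) ⟨(none, false), j⟩)
          fun j => .var (σ := σ) ⟨(none, true), j⟩)))

theorem realize_congrFunFormula {n : ℕ} {d : Fin n → L'.Sorts} {s : L'.Sorts}
    (F : L'.Functions d s) (K : Str.{w} L)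
    (z : ∀ p : Option (Fin n) × Bool, (I.sort (p.1.elim s d)).Dom K) :
    (I.congrFunFormula F).Realize K (famVal z) ↔
      ((∀ i, (I.sort (d i)).Rel K (z (some i, false)) (z (some i, true))) →
        (I.func F).Realize K
          (sumVal K (prodVal K fun i => z (some i, false)) (z (none, false)).1) →
        ((I.func F).Realize K
          (sumVal K (prodVal K fun i => z (some i, true)) (z (none, true)).1) ↔
          (I.sort s).Rel K (z (none, false)) (z (none, true)))) :=
  Formula.realize_imp_of (Formula.realize_conj_of fun _ =>
      ISort.realize_eqvOf _ _ (fun _ => rfl) fun _ => rfl)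
    (Formula.realize_imp_of (Formula.realize_subst_of (by rintro (i | j) <;> rfl))
      (Formula.realize_iff_of (Formula.realize_subst_of (by rintro (i | j) <;> rfl))
        (ISort.realize_eqvOf _ _ (fun _ => rfl) fun _ => rfl)))

variable (hT : Generic.{u, w} T M) (f : ∀ i, I.Coord (M i) (N i))
include hT f

theorem exists_value {n : ℕ} {d : Fin n → L'.Sorts} {s : L'.Sorts} (F : L'.Functions d s)
    {K : Str.{w} L} (hK : K.Models T) (x : ∀ i, (I.sort (d i)).Dom K) :
    ∃ y : (I.sort s).Dom K, (I.func F).Realize K (sumVal K (prodVal K x) y.1) := by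
  obtain ⟨y, hy⟩ := (realize_totalFormula F K x).1 (hT.transferDom (fun i x => by
    refine (realize_totalFormula F _ x).2 ?_
    obtain ⟨y, hy⟩ := (f i).surj s ((N i).funMap F fun j => (f i).map _ (x j))
    exact ⟨fun _ => y, ((f i).func F x y).1 hy.symm⟩) hK x)
  exact ⟨y (), hy⟩

theorem value_congr {n : ℕ} {d : Fin n → L'.Sorts} {s : L'.Sorts} (F : L'.Functions d s)
    {K : Str.{w} L} (hK : K.Models T) {x x' : ∀ i, (I.sort (d i)).Dom K}
    {y y' : (I.sort s).Dom K} (h : ∀ i, (I.sort (d i)).Rel K (x i) (x' i))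
    (hy : (I.func F).Realize K (sumVal K (prodVal K x) y.1)) :
    (I.func F).Realize K (sumVal K (prodVal K x') y'.1) ↔ (I.sort s).Rel K y y' := by
  let z : ∀ p : Option (Fin n) × Bool, (I.sort (p.1.elim s d)).Dom K
    | (none, false) => y
    | (none, true) => y'
    | (some i, false) => x i
    | (some i, true) => x' i
  refine (realize_congrFunFormula F K z).1 (hT.transferDom (fun i z => ?_) hK z) h hy
  refine (realize_congrFunFormula F _ z).2 fun h1 h2 => ?_
  have h2' := ((f i).func F (fun j => z (some j, false)) (z (none, false))).2 h2
  have h3 : (fun j => (f i).map _ (z (some j, false))) = fun j => (f i).map (d j)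
      (z (some j, true)) := funext fun j => ((f i).eqv _ _ _).2 (h1 j)
  refine ((f i).func F _ _).symm.trans (Iff.trans ?_ ((f i).eqv s _ _))
  exact ⟨fun h => h2'.symm.trans ((congrArg _ h3).trans h),
    fun h => (congrArg _ h3).symm.trans (h2'.trans h)⟩

theorem rel_congr {n : ℕ} {d : Fin n → L'.Sorts} (R : L'.Relations d)
    {K : Str.{w} L} (hK : K.Models T) {x x' : ∀ i, (I.sort (d i)).Dom K}
    (h : ∀ i, (I.sort (d i)).Rel K (x i) (x' i)) :
    (I.rel R).Realize K (prodVal K x) ↔ (I.rel R).Realize K (prodVal K x') := by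
  refine hT.invariant (fun i x y h => ?_) K hK x x' h
  refine ((f i).rel R _).symm.trans (Iff.trans ?_ ((f i).rel R _))
  have h3 : (fun j => (f i).map _ (x j)) = fun j => (f i).map (d j) (y j) :=
    funext fun j => ((f i).eqv _ _ _).2 (h j)
  exact iff_of_eq (congrArg _ h3)

/-- The structure interpreted in a model of `T`: its sorts are the quotients of the domains. -/
theorem exists_coord {K : Str.{w} L} (hK : K.Models T) :
    ∃ N' : Str.{w} L', Nonempty (I.Coord K N') := by
  have hE : ∀ s, Equivalence ((I.sort s).Rel K) := fun s =>
    hT.equivalence_rel (fun i => (f i).equivalence s) hK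
  have hq : ∀ s (x y : (I.sort s).Dom K), Quot.mk ((I.sort s).Rel K) x = Quot.mk _ y ↔
      (I.sort s).Rel K x y := fun s x y =>
    ⟨fun h => (hE s).eqvGen_iff.1 (Quot.eqvGen_exact h), fun h => Quot.sound h⟩
  have hout : ∀ s (x : (I.sort s).Dom K),
      (I.sort s).Rel K (Quot.mk ((I.sort s).Rel K) x).out x := fun s x =>
    (hq s _ _).1 (Quot.out_eq _)
  refine ⟨{ carrier := fun s => Quot ((I.sort s).Rel K)
            nonempty := fun s => (nonempty_dom hT f hK s).map (Quot.mk _)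
            funMap := fun F q => Quot.mk _ (exists_value hT f F hK fun i => (q i).out).choose
            relMap := fun R q => (I.rel R).Realize K (prodVal K fun i => (q i).out) },
    ⟨{ map := fun s => Quot.mk _
       surj := fun s => Quot.mk_surjective
       eqv := hq
       func := fun {n d s} F x y => ?_
       rel := fun R x => ?_ }⟩⟩
  · refine (hq s _ _).trans (value_congr hT f F hK (fun i => hout _ _) ?_).symm
    exact (exists_value hT f F hK fun i => (Quot.mk ((I.sort (d i)).Rel K) (x i)).out).choose_spec
  · exact rel_congr hT f R hK fun i => hout _ _

/-- A scheme that interprets models of `T'` in all members of a generic family interprets `T'`. -/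
theorem interprets_of_generic {T' : L'.Theory} (hN : ∀ i, (N i).Models T') :
    Scheme.Interprets.{w} I T T' := by
  intro K hK
  obtain ⟨N', ⟨g⟩⟩ := exists_coord hT f hK
  refine ⟨N', fun φ hφ => ?_, ⟨g⟩⟩
  have key : ∀ (A : Str.{w} L) (B : Str.{w} L') (k : I.Coord A B)
      (x : ∀ e : Empty, (I.sort e.elim).Dom A), (I.tr φ).Realize A (famVal x) ↔ B.Sat φ :=
    fun A B k x => (realize_tr k φ x).trans
      (iff_of_eq (congrArg _ (funext fun e => e.elim)))
  refine (key K N' g fun e => e.elim).1 (hT.transferDom (fun i z => ?_) hK _)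
  refine (realize_tr (f i) φ z).2 ?_
  have := hN i φ hφ
  rwa [Str.Sat, show (fun e : Empty => (e.elim : (N i).carrier e.elim)) = _ from
    funext fun e => e.elim] at this

end Scheme

end Abstract

/-! ### Uniformly definable isomorphisms with twice interpreted structures -/

section Twice

variable {L : MSLanguage.{us, uf, ur}} {L' : MSLanguage.{us', uf', ur'}}

theorem Generic.transferBase {ι : Type*} {T : L.Theory} {M : ι → Str.{u} L}
    (hT : Generic.{u, w} T M) {β : Type} [Finite β] {τ : β → L.Sorts} {φ : L.Formula τ}
    (h : ∀ i (x : ∀ b, (M i).carrier (τ b)), φ.Realize (M i) x)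
    {K : Str.{w} L} (hK : K.Models T) (x : ∀ b, K.carrier (τ b)) : φ.Realize K x :=
  (Formula.sat_closure _ _).1 (hT φ.closure (fun i => (Formula.sat_closure _ _).2 (h i)) K hK) x

namespace Scheme

variable (I : Scheme L L') (J : Scheme L' L)

/-- The formulas that may define an isomorphism between a structure and its twice interpreted
copy. -/
abbrev TwiceFormula (s : L.Sorts) : Type _ :=
  L.Formula (Sum.elim (fun _ : Unit => s) (prodCtx fun i => I.sort ((J.sort s).ctx i)))

variable {I J}

/-- `y` represents an element of the twice interpreted structure, which `θ` relates to `x`. -/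
def Linked (θ : ∀ s, TwiceFormula I J s) {M : Str.{w} L} {N : Str.{v} L'} (f : I.Coord M N)
    (s : L.Sorts) (x : M.carrier s) (y : ∀ i, (I.sort ((J.sort s).ctx i)).Dom M) : Prop :=
  (θ s).Realize M (sumVal M (fun _ => x) (prodVal M y)) ∧
    (J.sort s).dom.Realize N fun i => f.map _ (y i)

variable (θ : ∀ s, TwiceFormula I J s)

/-- The formula expressing `Linked`. -/
noncomputable def linkFormula (s : L.Sorts) : TwiceFormula I J s :=
  .and (θ s) ((I.tr (J.sort s).dom).subst fun p =>
    .var (σ := Sum.elim (fun _ : Unit => s) (prodCtx fun i => I.sort ((J.sort s).ctx i))) (.inr p))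

variable {θ}

theorem realize_linkFormula {M : Str.{w} L} {N : Str.{v} L'} (f : I.Coord M N) {s : L.Sorts}
    (x : M.carrier s) (y : ∀ i, (I.sort ((J.sort s).ctx i)).Dom M) :
    (linkFormula θ s).Realize M (sumVal M (fun _ => x) (famVal y)) ↔ Linked θ f s x y :=
  Formula.realize_and_of Iff.rfl
    ((Formula.realize_subst_of fun _ => rfl).trans (realize_tr f _ y))

theorem realize_linkFormula_of {M : Str.{w} L} {N : Str.{v} L'} (f : I.Coord M N) {s : L.Sorts}
    (x : M.carrier s) (y : ∀ i, (I.sort ((J.sort s).ctx i)).Dom M) {β : Type} {τ : β → L.Sorts}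
    {ts : ∀ a, L.Term τ (Sum.elim (fun _ : Unit => s)
      (prodCtx fun i => I.sort ((J.sort s).ctx i)) a)} {v : ∀ b, M.carrier (τ b)}
    (h : ∀ a, (ts a).eval M v = sumVal M (fun _ => x) (famVal y) a) :
    ((linkFormula θ s).subst ts).Realize M v ↔ Linked θ f s x y :=
  (Formula.realize_subst_of h).trans (realize_linkFormula f x y)

variable (θ)

/-- Every element is linked to some tuple. -/
noncomputable def linkTotal (s : L.Sorts) : L.Formula (fun _ : Unit => s) :=
  exsDom (fun i => I.sort ((J.sort s).ctx i)) (linkFormula θ s)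

/-- Every tuple in the domain is linked to some element. -/
noncomputable def linkSurj (s : L.Sorts) : L.Formula (I.trCtx (J.sort s).ctx) :=
  .imp (I.tr (J.sort s).dom) (.exs (τ := fun _ : Unit => s) ((linkFormula θ s).subst fun
    | .inl u => .var (σ := Sum.elim (I.trCtx (J.sort s).ctx) fun _ : Unit => s) (.inr u)
    | .inr p => .var (σ := Sum.elim (I.trCtx (J.sort s).ctx) fun _ : Unit => s) (.inl p)))

/-- Elements are equal if and only if the tuples linked to them are equivalent. -/
noncomputable def linkEqv (s : L.Sorts) : L.Formula (Sum.elim (fun _ : Bool => s)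
    (I.trCtx (Sum.elim (J.sort s).ctx (J.sort s).ctx))) :=
  let ρ := Sum.elim (fun _ : Bool => s) (I.trCtx (Sum.elim (J.sort s).ctx (J.sort s).ctx))
  .imp ((linkFormula θ s).subst fun
    | .inl _ => .var (σ := ρ) (.inl false)
    | .inr p => .var (σ := ρ) (.inr ⟨.inl p.1, p.2⟩))
  (.imp ((linkFormula θ s).subst fun
    | .inl _ => .var (σ := ρ) (.inl true)
    | .inr p => .var (σ := ρ) (.inr ⟨.inr p.1, p.2⟩))
  (.iff (.equal (s := s) (.var (σ := ρ) (.inl false)) (.var (σ := ρ) (.inl true)))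
    ((I.tr (J.sort s).eqv).subst fun p => .var (σ := ρ) (.inr p))))

/-- The links respect a function symbol. -/
noncomputable def linkFun {n : ℕ} {d : Fin n → L.Sorts} {s : L.Sorts} (F : L.Functions d s) :
    L.Formula (Sum.elim (fun o : Option (Fin n) => o.elim s d)
      (I.trCtx (Sum.elim (prodCtx fun i => J.sort (d i)) (J.sort s).ctx))) :=
  let ρ := Sum.elim (fun o : Option (Fin n) => o.elim s d)
      (I.trCtx (Sum.elim (prodCtx fun i => J.sort (d i)) (J.sort s).ctx))
  .imp (.conj fun i => (linkFormula θ (d i)).subst fun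
    | .inl _ => .var (σ := ρ) (.inl (some i))
    | .inr p => .var (σ := ρ) (.inr ⟨.inl ⟨i, p.1⟩, p.2⟩))
  (.imp ((linkFormula θ s).subst fun
    | .inl _ => .var (σ := ρ) (.inl none)
    | .inr p => .var (σ := ρ) (.inr ⟨.inr p.1, p.2⟩))
  (.iff (.equal (s := s) (.func F fun i => .var (σ := ρ) (.inl (some i)))
      (.var (σ := ρ) (.inl none)))
    ((I.tr (J.func F)).subst fun p => .var (σ := ρ) (.inr p))))

/-- The links respect a relation symbol. -/
noncomputable def linkRel {n : ℕ} {d : Fin n → L.Sorts} (R : L.Relations d) :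
    L.Formula (Sum.elim d (I.trCtx (prodCtx fun i => J.sort (d i)))) :=
  let ρ := Sum.elim d (I.trCtx (prodCtx fun i => J.sort (d i)))
  .imp (.conj fun i => (linkFormula θ (d i)).subst fun
    | .inl _ => .var (σ := ρ) (.inl i)
    | .inr p => .var (σ := ρ) (.inr ⟨⟨i, p.1⟩, p.2⟩))
  (.iff (.rel R fun i => .var (σ := ρ) (.inl i))
    ((I.tr (J.rel R)).subst fun p => .var (σ := ρ) (.inr p)))

variable {θ}

section

variable {M : Str.{w} L} {N : Str.{v} L'} (f : I.Coord M N)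

theorem realize_linkTotal {s : L.Sorts} (x : M.carrier s) :
    (linkTotal θ s).Realize M (fun _ => x) ↔ ∃ y, Linked θ f s x y :=
  realize_exsDom fun y => realize_linkFormula f x y

theorem realize_linkSurj {s : L.Sorts} (y : ∀ i, (I.sort ((J.sort s).ctx i)).Dom M) :
    (linkSurj θ s).Realize M (famVal y) ↔
      (((J.sort s).dom.Realize N fun i => f.map _ (y i)) →
        ∃ x : Unit → M.carrier s, Linked θ f s (x ()) y) :=
  Formula.realize_imp_of (realize_tr f _ y) ((Formula.realize_exs _ _ _).trans
    (exists_congr fun x => realize_linkFormula_of f (x ()) y (by rintro (i | j) <;> rfl)))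

theorem realize_linkEqv {s : L.Sorts} (x : Bool → M.carrier s)
    (y : ∀ a, (I.sort (Sum.elim (J.sort s).ctx (J.sort s).ctx a)).Dom M) :
    (linkEqv θ s).Realize M (sumVal M x (famVal y)) ↔
      (Linked θ f s (x false) (fun i => y (.inl i)) → Linked θ f s (x true) (fun i => y (.inr i)) →
        (x false = x true ↔ (J.sort s).eqv.Realize N fun a => f.map _ (y a))) :=
  Formula.realize_imp_of (realize_linkFormula_of f _ _ (by rintro (i | j) <;> rfl))
    (Formula.realize_imp_of (realize_linkFormula_of f _ _ (by rintro (i | j) <;> rfl))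
      (Formula.realize_iff_of Iff.rfl
        ((Formula.realize_subst_of fun _ => rfl).trans (realize_tr f _ y))))

theorem realize_linkFun {n : ℕ} {d : Fin n → L.Sorts} {s : L.Sorts} (F : L.Functions d s)
    (x : ∀ o : Option (Fin n), M.carrier (o.elim s d))
    (y : ∀ a, (I.sort (Sum.elim (prodCtx fun i => J.sort (d i)) (J.sort s).ctx a)).Dom M) :
    (linkFun θ F).Realize M (sumVal M x (famVal y)) ↔
      ((∀ i, Linked θ f (d i) (x (some i)) fun j => y (.inl ⟨i, j⟩)) →
        Linked θ f s (x none) (fun j => y (.inr j)) →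
        (M.funMap F (fun i => x (some i)) = x none ↔
          (J.func F).Realize N fun a => f.map _ (y a))) :=
  Formula.realize_imp_of (Formula.realize_conj_of fun i =>
      realize_linkFormula_of f _ _ (by rintro (i | j) <;> rfl))
    (Formula.realize_imp_of (realize_linkFormula_of f _ _ (by rintro (i | j) <;> rfl))
      (Formula.realize_iff_of Iff.rfl
        ((Formula.realize_subst_of fun _ => rfl).trans (realize_tr f _ y))))

theorem realize_linkRel {n : ℕ} {d : Fin n → L.Sorts} (R : L.Relations d)
    (x : ∀ i, M.carrier (d i))
    (y : ∀ a, (I.sort (prodCtx (fun i => J.sort (d i)) a)).Dom M) :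
    (linkRel θ R).Realize M (sumVal M x (famVal y)) ↔
      ((∀ i, Linked θ f (d i) (x i) fun j => y ⟨i, j⟩) →
        (M.relMap R x ↔ (J.rel R).Realize N fun a => f.map _ (y a))) :=
  Formula.realize_imp_of (Formula.realize_conj_of fun i =>
      realize_linkFormula_of f _ _ (by rintro (i | j) <;> rfl))
    (Formula.realize_iff_of Iff.rfl
      ((Formula.realize_subst_of fun _ => rfl).trans (realize_tr f _ y)))

end

variable {ι : Type*} {T : L.Theory} {M : ι → Str.{u} L} {N : ι → Str.{v} L'}

/-- If the formulas `θ` define the identity in all pairs of a generic family, then they define an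
isomorphism with the twice interpreted copy in all models. -/
theorem uniformlyIsoSelf_of_generic (hT : Generic.{u, w} T M) (f : ∀ i, I.Coord (M i) (N i))
    (g : ∀ i, J.Coord (N i) (M i))
    (hθ : ∀ i s (x : (M i).carrier s) (y : ∀ j, (I.sort ((J.sort s).ctx j)).Dom (M i))
      (hy : (J.sort s).dom.Realize (N i) fun j => (f i).map _ (y j)),
      x = (g i).map s ⟨fun j => (f i).map _ (y j), hy⟩ ↔
        (θ s).Realize (M i) (sumVal (M i) (fun _ => x) (prodVal (M i) y))) :
    Scheme.UniformlyIsoSelf.{w} I J T := by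
  have hl : ∀ i s x y, Linked θ (f i) s x y → ∃ hy, x = (g i).map s
      ⟨fun j => (f i).map _ (y j), hy⟩ := fun i s x y h => ⟨h.2, (hθ i s x y h.2).2 h.1⟩
  refine ⟨θ, fun A B K hA k l => ?_⟩
  have total : ∀ s x, ∃ y, Linked θ k s x y := fun s x =>
    (realize_linkTotal k x).1 (hT.transferBase (fun i x => by
      refine (realize_linkTotal (f i) (x ())).2 ?_
      obtain ⟨⟨z, hz⟩, hzx⟩ := (g i).surj s (x ())
      choose y hy using fun j => (f i).surj _ (z j)
      obtain rfl : (fun j => (f i).map _ (y j)) = z := funext hy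
      exact ⟨y, (hθ i s _ y hz).1 hzx.symm, hz⟩) hA fun _ => x)
  have surj : ∀ s (y : ∀ i, (I.sort ((J.sort s).ctx i)).Dom A),
      ((J.sort s).dom.Realize B fun i => k.map _ (y i)) → ∃ x, Linked θ k s x y := fun s y hy =>
    let ⟨x, hx⟩ := (realize_linkSurj k y).1 (hT.transferDom (fun i y => by
      refine (realize_linkSurj (f i) y).2 fun hy => ?_
      exact ⟨fun _ => (g i).map s ⟨_, hy⟩, (hθ i s _ y hy).1 rfl, hy⟩) hA y) hy
    ⟨x (), hx⟩
  have eqv : ∀ s x x' y y' (h : Linked θ k s x y) (h' : Linked θ k s x' y'),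
      x = x' ↔ l.map s ⟨_, h.2⟩ = l.map s ⟨_, h'.2⟩ := fun s x x' y y' h h' => by
    let z : ∀ a, (I.sort (Sum.elim (J.sort s).ctx (J.sort s).ctx a)).Dom A
      | .inl j => y j
      | .inr j => y' j
    refine ((realize_linkEqv k (fun b => cond b x' x) z).1 (hT.transfer (fun i x y => by
      refine (realize_linkEqv (f i) x y).2 fun h h' => ?_
      obtain ⟨hy, hx⟩ := hl _ _ _ _ h
      obtain ⟨hy', hx'⟩ := hl _ _ _ _ h'
      rw [hx, hx']
      refine ((g i).eqv s _ _).trans ?_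
      refine iff_of_eq (congrArg _ (funext fun a => ?_))
      rcases a with a | a <;> rfl) hA _ z) h h').trans (Iff.trans ?_ (l.eqv _ _ _).symm)
    refine iff_of_eq (congrArg _ (funext fun a => ?_))
    rcases a with a | a <;> rfl
  choose y hy using total
  have hto : ∀ s x z (h : Linked θ k s x z), l.map s ⟨_, (hy s x).2⟩ = l.map s ⟨_, h.2⟩ :=
    fun s x z h => (eqv s x x _ _ (hy s x) h).1 rfl
  refine ⟨⟨fun s => Equiv.ofBijective (fun x => l.map s ⟨_, (hy s x).2⟩)
    ⟨fun x x' h => (eqv s x x' _ _ (hy s x) (hy s x')).2 h, fun c => ?_⟩,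
    fun {n d s} F x => ?_, fun {n d} R x => ?_⟩, fun s x z hz => ?_⟩
  · obtain ⟨⟨z, hz⟩, rfl⟩ := l.surj s c
    choose z' hz' using fun j => k.surj _ (z j)
    obtain rfl : (fun j => k.map _ (z' j)) = z := funext hz'
    obtain ⟨x, hx⟩ := surj s z' hz
    exact ⟨x, hto s x z' hx⟩
  · let x' : ∀ o : Option (Fin n), A.carrier (o.elim s d)
      | none => A.funMap F x
      | some i => x i
    let z : ∀ a, (I.sort (Sum.elim (prodCtx fun i => J.sort (d i)) (J.sort s).ctx a)).Dom A
      | .inl p => y (d p.1) (x p.1) p.2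
      | .inr j => y s (A.funMap F x) j
    refine Eq.symm ((l.func F (fun i => ⟨_, (hy (d i) (x i)).2⟩)
      ⟨_, (hy s (A.funMap F x)).2⟩).2 ?_)
    have key := ((realize_linkFun k F x' z).1 (hT.transfer (fun i x y => by
      refine (realize_linkFun (f i) F x y).2 fun h h' => ?_
      choose hy hx using fun j => hl _ _ _ _ (h j)
      obtain ⟨hy', hx'⟩ := hl _ _ _ _ h'
      rw [hx', funext hx]
      refine ((g i).func F _ _).trans ?_
      refine iff_of_eq (congrArg _ (funext fun a => ?_))
      rcases a with a | a <;> rfl) hA x' z) (fun i => hy _ _) (hy _ _)).1 rfl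
    refine (iff_of_eq (congrArg _ (funext fun a => ?_))).1 key
    rcases a with a | a <;> rfl
  · let z : ∀ a, (I.sort (prodCtx (fun i => J.sort (d i)) a)).Dom A :=
      fun p => y (d p.1) (x p.1) p.2
    refine ((realize_linkRel k R x z).1 (hT.transfer (fun i x y => by
      refine (realize_linkRel (f i) R x y).2 fun h => ?_
      choose hy hx using fun j => hl _ _ _ _ (h j)
      rw [funext hx]
      exact (g i).rel R _) hA x z) fun i => hy _ _).trans ?_
    exact (l.rel R fun i => ⟨_, (hy (d i) (x i)).2⟩).symm
  · show l.map s _ = _ ↔ _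
    constructor
    · intro h
      obtain ⟨x', hx'⟩ := surj s z hz
      rw [(eqv s x x' _ _ (hy s x) hx').2 h]
      exact hx'.1
    · intro h
      exact hto s x z ⟨h, hz⟩

/-- The criterion for bi-interpretability: it suffices to consider a family of pairs of structures
that is generic for both theories. -/
theorem isBiInterpretation_of_generic {T' : L'.Theory} (hT : Generic.{u, w} T M)
    (hT' : Generic.{v, w} T' N) (hM : ∀ i, (M i).Models T) (hN : ∀ i, (N i).Models T')
    (f : ∀ i, I.Coord (M i) (N i)) (g : ∀ i, J.Coord (N i) (M i))
    (hθ : ∀ s, ∃ θ : TwiceFormula I J s, ∀ i (x : (M i).carrier s)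
      (y : ∀ j, (I.sort ((J.sort s).ctx j)).Dom (M i))
      (hy : (J.sort s).dom.Realize (N i) fun j => (f i).map _ (y j)),
      x = (g i).map s ⟨fun j => (f i).map _ (y j), hy⟩ ↔
        θ.Realize (M i) (sumVal (M i) (fun _ => x) (prodVal (M i) y)))
    (hθ' : ∀ s, ∃ θ : TwiceFormula J I s, ∀ i (x : (N i).carrier s)
      (y : ∀ j, (J.sort ((I.sort s).ctx j)).Dom (N i))
      (hy : (I.sort s).dom.Realize (M i) fun j => (g i).map _ (y j)),
      x = (f i).map s ⟨fun j => (g i).map _ (y j), hy⟩ ↔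
        θ.Realize (N i) (sumVal (N i) (fun _ => x) (prodVal (N i) y))) :
    IsBiInterpretation.{w} T T' I J := by
  choose θ hθ using hθ
  choose θ' hθ' using hθ'
  exact ⟨interprets_of_generic hT f hN, interprets_of_generic hT' g hM,
    uniformlyIsoSelf_of_generic hT f g fun i s => hθ s i,
    uniformlyIsoSelf_of_generic hT' g f fun i s => hθ' s i⟩

end Scheme

end Twice

end MSLanguage

open FirstOrder Language

/-! ### Single-sorted structures as many-sorted ones -/

section SingleSorted

variable {L : FirstOrder.Language.{u, v}}

/-- A non-empty single-sorted structure, seen as a many-sorted one. -/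
def msStr (M : Type w) [L.Structure M] [Nonempty M] : (msLang L).Str where
  carrier _ := M
  nonempty _ := inferInstance
  funMap {_ _ _} f x := FirstOrder.Language.Structure.funMap (L := L) f x
  relMap {_ _} R x := FirstOrder.Language.Structure.RelMap (L := L) R x

theorem exists_eq_msStr (K : MSLanguage.Str.{w} (msLang L)) :
    ∃ (M : Type w) (_ : L.Structure M) (_ : Nonempty M), K = msStr M :=
  ⟨K.carrier (), ⟨fun {_} f x => K.funMap (d := fun _ => ()) (s := ()) f x,
    fun {_} R x => K.relMap (d := fun _ => ()) R x⟩, K.nonempty (), rfl⟩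

section

variable {M : Type w} [L.Structure M] [Nonempty M]

theorem eval_msTerm {α β : Type} (r : α → β) (t : L.Term α) (x : β → M) :
    t.realize (x ∘ r) = (msTerm r t).eval (msStr (L := L) M) x := by
  induction t with
  | var a => rfl
  | func f ts ih => exact congrArg (FirstOrder.Language.Structure.funMap f) (funext ih)

theorem realize_msFormula {α : Type} {n : ℕ} {β : Type} (r : α ⊕ Fin n → β)
    (φ : L.BoundedFormula α n) (x : β → M) :
    (msFormula r φ).Realize (msStr (L := L) M) x ↔
      φ.Realize (fun a => x (r (.inl a))) fun i => x (r (.inr i)) := by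
  have hs : ∀ {n : ℕ} (r : α ⊕ Fin n → β), x ∘ r =
      Sum.elim (fun a => x (r (.inl a))) fun i => x (r (.inr i)) := fun r => by
    funext c
    cases c <;> rfl
  induction φ generalizing β with
  | falsum => rfl
  | equal t t' =>
    refine (iff_of_eq (congrArg₂ (Eq (α := M)) (eval_msTerm (M := M) r t x).symm
      (eval_msTerm (M := M) r t' x).symm)).trans ?_
    rw [hs]
    rfl
  | rel R ts =>
    refine (iff_of_eq (congrArg (FirstOrder.Language.Structure.RelMap (M := M) R)
      (funext fun i => (eval_msTerm (M := M) r (ts i) x).symm))).trans ?_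
    rw [hs]
    rfl
  | imp φ ψ ih ih' => exact imp_congr (ih r x (hs ·)) (ih' r x (hs ·))
  | all φ ih =>
    show (∀ y : M, MSLanguage.Formula.Realize (msStr M) (msFormula _ φ) _) ↔ _
    refine forall_congr' fun y => ?_
    refine (ih (β := Option β) _ (MSLanguage.optVal (L := msLang L) (σ := fun _ : β => ())
      (msStr (L := L) M) (s := ()) y x) ?_).trans ?_
    · intro n r
      funext c
      cases c <;> rfl
    · have hx : ∀ o : Option β, MSLanguage.optVal (L := msLang L) (σ := fun _ : β => ())
          (msStr (L := L) M) (s := ()) y x o = o.elim y x := fun o => by cases o <;> rfl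
      refine iff_of_eq (congrArg _ (funext fun i => ?_))
      refine (hx _).trans ?_
      show Option.elim (Fin.snoc (α := fun _ => Option β) (fun i => some (r (.inr i))) none i) y x
        = _
      refine Fin.lastCases ?_ (fun i => ?_) i
      · rw [Fin.snoc_last, Fin.snoc_last, Option.elim_none]
      · rw [Fin.snoc_castSucc, Fin.snoc_castSucc, Option.elim_some]

/-- A single-sorted formula, as a many-sorted one. -/
def ofL {α : Type} {σ : α → (msLang L).Sorts} (φ : L.Formula α) : (msLang L).Formula σ :=
  msFormula (β := α) (Sum.elim id Fin.elim0) φ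

theorem realize_ofL {α : Type} {σ : α → (msLang L).Sorts} (φ : L.Formula α) (x : α → M) :
    (ofL (σ := σ) φ).Realize (msStr (L := L) M) x ↔ φ.Realize x := by
  refine (realize_msFormula (β := α) _ φ x).trans ?_
  rw [Formula.Realize, Subsingleton.elim (fun i : Fin 0 => x (Sum.elim id Fin.elim0 (.inr i)))
    default]
  rfl

/-- A many-sorted term in a single-sorted language, as a single-sorted one. -/
def toLTerm {α : Type} {σ : α → (msLang L).Sorts} : {s : (msLang L).Sorts} →
    (msLang L).Term σ s → L.Term α
  | _, .var a => .var a
  | _, .func f ts => .func (L := L) f fun i => toLTerm (ts i)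

/-- A many-sorted formula in a single-sorted language, as a single-sorted one. -/
noncomputable def toL : {α : Type} → {σ : α → (msLang L).Sorts} → (msLang L).Formula σ →
    L.Formula α
  | _, _, .falsum => ⊥
  | _, _, .equal t t' => (toLTerm t).equal (toLTerm t')
  | _, _, .rel R ts => FirstOrder.Language.Relations.formula (L := L) R fun i => toLTerm (ts i)
  | _, _, .imp φ ψ => (toL φ).imp (toL ψ)
  | _, _, .all _ φ => ((toL φ).relabel fun o => o.elim (.inr ()) .inl).iAlls Unit

theorem realize_toLTerm {α : Type} {σ : α → (msLang L).Sorts} {s : (msLang L).Sorts}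
    (t : (msLang L).Term σ s) (x : α → M) :
    (toLTerm t).realize x = t.eval (msStr (L := L) M) x := by
  induction t with
  | var a => rfl
  | func f ts ih => exact congrArg (FirstOrder.Language.Structure.funMap (L := L) f) (funext ih)

theorem realize_toL {α : Type} {σ : α → (msLang L).Sorts} (φ : (msLang L).Formula σ) (x : α → M) :
    (toL φ).Realize x ↔ φ.Realize (msStr (L := L) M) x := by
  induction φ with
  | falsum => rfl
  | equal t t' =>
    rw [toL, Formula.realize_equal, realize_toLTerm, realize_toLTerm]
    rfl
  | rel R ts =>
    refine Formula.realize_rel.trans ?_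
    exact iff_of_eq (congrArg (FirstOrder.Language.Structure.RelMap (L := L) R)
      (funext fun i => realize_toLTerm (ts i) x))
  | imp φ ψ ih ih' =>
    rw [toL, Formula.realize_imp]
    exact imp_congr (ih x) (ih' x)
  | all s φ ih =>
    rw [toL, Formula.realize_iAlls]
    show _ ↔ ∀ y : M, _
    have key : ∀ y : Unit → M, ((toL φ).relabel fun o => o.elim (.inr ()) .inl).Realize
        (fun a => Sum.elim x y a) ↔ φ.Realize (msStr M) (MSLanguage.optVal (msStr M) (y ()) x) := by
      intro y
      rw [Formula.realize_relabel]
      refine Iff.trans ?_ (ih _)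
      refine iff_of_eq (congrArg _ (funext fun o => ?_))
      cases o <;> rfl
    exact ⟨fun h y => (key fun _ => y).1 (h fun _ => y), fun h y => (key y).2 (h (y ()))⟩

theorem msStr_models_iff {T : L.Theory} : (msStr (L := L) M).Models (msTheory T) ↔ M ⊨ T := by
  have key : ∀ φ : L.Sentence, (msStr (L := L) M).Sat (msSentence φ) ↔ M ⊨ φ := fun φ => by
    refine (realize_msFormula (β := Empty) _ φ _).trans ?_
    rw [Sentence.Realize, Formula.Realize]
    refine iff_of_eq (congr (congrArg _ (funext fun e => e.elim)) (Subsingleton.elim _ _))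
  rw [Theory.model_iff]
  exact ⟨fun h φ hφ => (key φ).1 (h _ ⟨φ, hφ, rfl⟩), by
    rintro h _ ⟨φ, hφ, rfl⟩
    exact (key φ).2 (h φ hφ)⟩

end

/-- A complete theory decides every many-sorted sentence. -/
theorem sat_iff_of_isComplete {T : L.Theory} (hT : T.IsComplete)
    {K : MSLanguage.Str.{w} (msLang L)} {K' : MSLanguage.Str.{u'} (msLang L)}
    (hK : K.Models (msTheory T)) (hK' : K'.Models (msTheory T)) (φ : (msLang L).Sentence) :
    K.Sat φ ↔ K'.Sat φ := by
  obtain ⟨M, _, _, rfl⟩ := exists_eq_msStr K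
  obtain ⟨M', _, _, rfl⟩ := exists_eq_msStr K'
  have := msStr_models_iff.1 hK
  have := msStr_models_iff.1 hK'
  let ψ : L.Sentence := toL φ
  have key : ∀ {M : Type w} [L.Structure M] [Nonempty M], (msStr (L := L) M).Sat φ ↔ M ⊨ ψ := by
    intro M _ _
    rw [Sentence.Realize, Subsingleton.elim default (fun e : Empty => (e.elim : M))]
    exact (realize_toL φ _).symm
  have key' : ∀ {M : Type u'} [L.Structure M] [Nonempty M], (msStr (L := L) M).Sat φ ↔ M ⊨ ψ := by
    intro M _ _
    rw [Sentence.Realize, Subsingleton.elim default (fun e : Empty => (e.elim : M))]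
    exact (realize_toL φ _).symm
  rw [key, key', hT.realize_sentence_iff, hT.realize_sentence_iff]

end SingleSorted

/-! ### Sequences in `D_Φ` -/

section Sequences

/-- The sequence defined by course-of-values recursion. -/
noncomputable def recSeq {M : Type w} (g : ∀ n : ℕ, (Fin n → M) → M) : ℕ → M
  | n => g n fun i => recSeq g i
decreasing_by exact i.2

theorem exists_seq {M : Type w} {P : ∀ n : ℕ, (Fin n → M) → M → Prop} (h : ∀ n u, ∃ x, P n u x) :
    ∃ a : ℕ → M, ∀ n, P n (fun i => a i) (a n) := by
  choose g hg using h
  refine ⟨recSeq g, fun n => ?_⟩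
  have h : recSeq g n = g n fun i => recSeq g i := by rw [recSeq]
  rw [h]
  exact hg n _

variable {L : FirstOrder.Language.{u, v}} (Φ : RichSeq L)

namespace RichSeq

/-- The condition defining `D_Φ`, for tuples of length `n`. -/
def InDFin {M : Type w} [L.Structure M] {n : ℕ} (x : Fin n → M) : Prop :=
  ∀ (i : Fin n) (y : M),
    (Φ.form i).Realize (Sum.elim (fun j : Fin i => x (Fin.castLE i.2.le j)) fun _ => y) →
    (Φ.form i).Realize (Sum.elim (fun j : Fin i => x (Fin.castLE i.2.le j)) fun _ => x i)

/-- The formula defining the initial segments of length `n` of the members of `D_Φ`. -/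
noncomputable def domForm (n : ℕ) : L.Formula (Fin n) :=
  Formula.iInf fun i : Fin n => Formula.iAlls Unit (Formula.imp
    ((Φ.form i).relabel (Sum.map (Fin.castLE i.2.le) id))
    ((Φ.form i).relabel (Sum.elim (fun j => .inl (Fin.castLE i.2.le j)) fun _ => .inl i)))

theorem realize_domForm {M : Type w} [L.Structure M] {n : ℕ} (x : Fin n → M) :
    (Φ.domForm n).Realize x ↔ Φ.InDFin x := by
  rw [domForm, Formula.realize_iInf]
  refine forall_congr' fun i => ?_
  rw [Formula.realize_iAlls]
  simp only [Formula.realize_imp, Formula.realize_relabel]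
  have h1 : ∀ y : Unit → M, (fun a => Sum.elim x y a) ∘ Sum.map (Fin.castLE i.2.le) id =
      Sum.elim (fun j : Fin i => x (Fin.castLE i.2.le j)) fun _ => y () := fun y => by
    funext c
    cases c <;> rfl
  have h2 : ∀ y : Unit → M, ((fun a => Sum.elim x y a) ∘
      Sum.elim (fun j : Fin i => Sum.inl (Fin.castLE i.2.le j)) fun _ : Unit => Sum.inl i) =
      Sum.elim (fun j : Fin i => x (Fin.castLE i.2.le j)) fun _ => x i := fun y => by
    funext c
    cases c <;> rfl
  simp only [h1, h2]
  exact ⟨fun h y => h fun _ => y, fun h y => h (y ())⟩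

variable {Φ}

theorem InD.inDFin {M : Type w} [L.Structure M] {a : ℕ → M} (ha : Φ.InD a) (n : ℕ) :
    Φ.InDFin fun i : Fin n => a i := fun i y h => ha i y h

theorem inD_iff {M : Type w} [L.Structure M] {a : ℕ → M} :
    Φ.InD a ↔ ∀ n, Φ.InDFin fun i : Fin n => a i :=
  ⟨fun h n => h.inDFin n, fun h n => h (n + 1) (Fin.last n)⟩

/-- A tuple satisfying the first conditions of `D_Φ` extends to a member of `D_Φ` whose range
contains a given countable set. -/
theorem InDFin.exists_extension {M : Type w} [L.Structure M] {m : ℕ} {x : Fin m → M}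
    (hx : Φ.InDFin x) (c : ℕ → M) :
    ∃ a : ℕ → M, Φ.InD a ∧ (∀ i : Fin m, a i = x i) ∧ ∀ j, ∃ i, a i = c j := by
  classical
  -- At the places `n` where the formula is valid, any entry is allowed; since the sequence is rich,
  -- there are infinitely many of them, and `c` is listed there.
  let p : ℕ → Prop := fun n => m ≤ n ∧ ∀ v : Fin n ⊕ Unit → M, (Φ.form n).Realize v
  have hp : (Set.ofPred p).Infinite := Set.infinite_of_not_bddAbove fun ⟨b, hb⟩ => by
    obtain ⟨n, hn, h⟩ := Φ.rich (max m (b + 1)) ⊤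
    have : n ≤ b := hb ⟨(le_max_left _ _).trans hn, fun v => by
      rw [h, Formula.realize_relabel]
      exact Formula.realize_top.2 trivial⟩
    omega
  obtain ⟨a, ha⟩ := exists_seq (M := M) (P := fun n u y => (∀ h : n < m, y = x ⟨n, h⟩) ∧ (m ≤ n →
      ((∃ z, (Φ.form n).Realize (Sum.elim u fun _ => z)) →
        (Φ.form n).Realize (Sum.elim u fun _ => y)) ∧ (p n → y = c (Nat.count p n)))) (by
    intro n u
    by_cases h : n < m
    · exact ⟨x ⟨n, h⟩, fun _ => rfl, fun h' => absurd h h'.not_gt⟩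
    · by_cases hn : p n
      · exact ⟨c (Nat.count p n), fun h' => absurd h' h, fun _ => ⟨fun _ => hn.2 _, fun _ => rfl⟩⟩
      · by_cases hz : ∃ z, (Φ.form n).Realize (Sum.elim u fun _ => z)
        · exact ⟨hz.choose, fun h' => absurd h' h, fun _ => ⟨fun _ => hz.choose_spec,
            fun h' => absurd h' hn⟩⟩
        · exact ⟨c 0, fun h' => absurd h' h, fun _ => ⟨fun h' => absurd h' hz,
            fun h' => absurd h' hn⟩⟩)
  refine ⟨a, fun n y hy => ?_, fun i => (ha i).1 i.2, fun j => ⟨Nat.nth p j, ?_⟩⟩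
  · rcases lt_or_ge n m with h | h
    · have h1 : (fun i : Fin n => a i) = fun j : Fin n => x (Fin.castLE h.le j) :=
        funext fun i => (ha i).1 (i.2.trans h)
      rw [(ha n).1 h]
      rw [h1] at hy ⊢
      exact hx ⟨n, h⟩ y hy
    · exact ((ha n).2 h).1 ⟨y, hy⟩
  · have h := Nat.nth_mem_of_infinite hp j
    rw [((ha _).2 h.1).2 h, Nat.count_nth_of_infinite hp]

/-- In a countable structure, a tuple satisfying the first conditions of `D_Φ` extends to an
enumeration. -/
theorem InDFin.exists_enumerates {M : Type w} [L.Structure M] [Nonempty M] [Countable M] {m : ℕ}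
    {x : Fin m → M} (hx : Φ.InDFin x) :
    ∃ a : ℕ → M, Φ.Enumerates M a ∧ ∀ i : Fin m, a i = x i := by
  obtain ⟨c, hc⟩ := exists_surjective_nat M
  obtain ⟨a, ha, hax, hac⟩ := hx.exists_extension c
  exact ⟨a, ⟨ha, fun y => let ⟨j, hj⟩ := hc y; hj ▸ hac j⟩, hax⟩

theorem Enumerates.countable {M : Type w} [L.Structure M] {a : ℕ → M} (ha : Φ.Enumerates M a) :
    Countable M := ha.surj.countable

end RichSeq

end Sequences

/-! ### Countable models and compactness -/

section Compactness

variable {L : FirstOrder.Language.{u, v}}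

/-- The truth of a formula depends only on the values of finitely many variables, so only on the
variables of index below some bound, for any way of indexing them. -/
theorem exists_bound {α : Type} (f : α → ℕ) (ψ : L.Formula α) :
    ∃ m, ∀ (M : Type w) [L.Structure M] (x y : α → M), (∀ a, f a < m → x a = y a) →
      (ψ.Realize x ↔ ψ.Realize y) := by
  classical
  refine ⟨(BoundedFormula.freeVarFinset ψ).sup f + 1, fun M _ x y h => ?_⟩
  have hx := BoundedFormula.realize_restrictFreeVar' (φ := ψ)
    (s := ↑(BoundedFormula.freeVarFinset ψ)) Set.Subset.rfl (v := x) (xs := default)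
  have hy := BoundedFormula.realize_restrictFreeVar' (φ := ψ)
    (s := ↑(BoundedFormula.freeVarFinset ψ)) Set.Subset.rfl (v := y) (xs := default)
  have : x ∘ ((↑) : (↑(BoundedFormula.freeVarFinset ψ) : Set α) → α) = y ∘ (↑) :=
    funext fun a => h a.1 (Nat.lt_succ_of_le (Finset.le_sup (f := f) a.2))
  rw [this] at hx
  exact hx.symm.trans hy

namespace RichSeq

variable {Φ : RichSeq L}

theorem InD.exists_solution {M : Type w} [L.Structure M] {a : ℕ → M} (ha : Φ.InD a)
    (φ : L.Formula (ℕ ⊕ Unit)) {y : M} (hy : φ.Realize (Sum.elim a fun _ => y)) :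
    ∃ n, φ.Realize (Sum.elim a fun _ => a n) := by
  obtain ⟨k, hk⟩ := exists_bound.{u, v, w} (Sum.elim id fun _ => 0) φ
  obtain ⟨n, hn, h⟩ := Φ.rich (k + 1) (φ.relabel
    (Sum.map (fun i => if h : i < k + 1 then ⟨i, h⟩ else 0) id))
  have key : ∀ y : M, (Φ.form n).Realize (Sum.elim (fun i : Fin n => a i) fun _ => y) ↔
      φ.Realize (Sum.elim a fun _ => y) := by
    intro y
    rw [h, Formula.realize_relabel, Formula.realize_relabel]
    refine hk M _ _ ?_
    rintro (i | i) hi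
    · have hi' : i < k + 1 := Nat.lt_succ_of_lt hi
      simp only [Function.comp_apply, Sum.map_inl, dif_pos hi', Sum.elim_inl, Fin.val_castLE]
    · rfl
  exact ⟨n, (key _).1 (ha n y ((key y).2 hy))⟩

/-- The range of a member of `D_Φ` is an elementary substructure. -/
theorem InD.exists_elementary {M : Type w} [L.Structure M] {a : ℕ → M} (ha : Φ.InD a) :
    ∃ S : L.ElementarySubstructure M, (S : Set M) = Set.range a := by
  let S : L.Substructure M := ⟨Set.range a, fun {n} f x hx => by
    choose σ hσ using hx
    obtain ⟨j, hj⟩ := ha.exists_solution (Term.equal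
      (Term.func f fun i => Term.var (Sum.inl (σ i))) (Term.var (Sum.inr ())))
      (y := Structure.funMap f x) (by simp [Formula.realize_equal, hσ])
    refine ⟨j, ?_⟩
    simpa [Formula.realize_equal, hσ] using hj.symm⟩
  refine ⟨⟨S, S.isElementary_of_exists fun n φ x y hy => ?_⟩, rfl⟩
  choose σ hσ using fun i => (x i).2
  have key : ∀ y : M, Formula.Realize (φ.toFormula.relabel
      (Sum.elim (fun e : Empty => e.elim) (Fin.snoc (α := fun _ => ℕ ⊕ Unit)
        (fun i => Sum.inl (σ i)) (Sum.inr ())))) (Sum.elim a fun _ => y) ↔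
      φ.Realize default (Fin.snoc ((↑) ∘ x) y : _ → M) := by
    intro y
    rw [Formula.realize_relabel, BoundedFormula.realize_toFormula]
    refine iff_of_eq (congr (congrArg _ (Subsingleton.elim _ _)) (funext fun i => ?_))
    refine Fin.lastCases ?_ (fun i => ?_) i
    · simp
    · simp [hσ]
  obtain ⟨j, hj⟩ := ha.exists_solution _ ((key y).2 hy)
  exact ⟨⟨a j, j, rfl⟩, (key _).1 hj⟩

/-- A member of `D_Φ` in any model enumerates a countable model. -/
theorem InD.exists_countable_model {T : L.Theory} {M : Type w} [L.Structure M] [Nonempty M]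
    [M ⊨ T] {a : ℕ → M} (ha : Φ.InD a) :
    ∃ (N : Theory.ModelType.{u, v, 0} T) (b : ℕ → N), Φ.Enumerates N b ∧
      ∀ ψ : L.Formula ℕ, ψ.Realize b ↔ ψ.Realize a := by
  obtain ⟨S, hS⟩ := ha.exists_elementary
  have hmem : ∀ i, a i ∈ S := fun i => by
    rw [← SetLike.mem_coe, hS]
    exact ⟨i, rfl⟩
  have hsurj : Function.Surjective fun i => (⟨a i, hmem i⟩ : S) := fun x => by
    have hx : (x : M) ∈ (S : Set M) := x.2
    rw [hS] at hx
    obtain ⟨i, hi⟩ := hx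
    exact ⟨i, Subtype.ext hi⟩
  have : Countable S := hsurj.countable
  have : Nonempty S := ⟨⟨a 0, hmem 0⟩⟩
  -- The range of `a` lives in the universe of `M`, so it is replaced by a copy in `Type`.
  let e := equivShrink.{0} S
  let := e.inducedStructure (L := L)
  let e' : L.Equiv S (Shrink.{0} S) := e.inducedStructureEquiv
  have hT : Shrink.{0} S ⊨ T := StrongHomClass.theory_model e'
  have : Nonempty (Shrink.{0} S) := e.symm.nonempty
  have key : ∀ ψ : L.Formula ℕ, ψ.Realize (fun i => e' ⟨a i, hmem i⟩) ↔ ψ.Realize a := fun ψ =>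
    (StrongHomClass.realize_formula e' ψ (v := fun i => (⟨a i, hmem i⟩ : S))).trans
      (S.subtype.map_formula ψ fun i => ⟨a i, hmem i⟩).symm
  have hs : Function.Surjective (fun i => e' ⟨a i, hmem i⟩) := e'.surjective.comp hsurj
  refine ⟨Theory.ModelType.of T (Shrink.{0} S), fun i => e' ⟨a i, hmem i⟩, ⟨fun n y hy => ?_, hs⟩,
    key⟩
  obtain ⟨j, rfl⟩ := hs y
  have key' : ∀ j, (Φ.form n).Realize (Sum.elim (fun i : Fin n => e' ⟨a i, hmem i⟩)
      fun _ => e' ⟨a j, hmem j⟩) ↔ (Φ.form n).Realize (Sum.elim (fun i : Fin n => a i)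
      fun _ => a j) := by
    intro j
    have := key ((Φ.form n).relabel (Sum.elim (fun i : Fin n => (i : ℕ)) fun _ => j))
    rw [Formula.realize_relabel, Formula.realize_relabel] at this
    convert this using 2 <;> (funext c; cases c <;> rfl)
  exact (key' n).2 (ha n _ ((key' j).1 hy))

end RichSeq

variable (Φ : RichSeq L) {T : L.Theory}
include Φ

theorem exists_enumerated_model (hT : T.IsSatisfiable) :
    ∃ (N : Theory.ModelType.{u, v, 0} T) (b : ℕ → N), Φ.Enumerates N b := by
  obtain ⟨M⟩ := hT
  obtain ⟨x⟩ : Nonempty M := inferInstance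
  obtain ⟨a, ha, -, -⟩ := RichSeq.InDFin.exists_extension (Φ := Φ) (m := 0)
    (x := Fin.elim0 (α := M))
    (fun i => i.elim0) fun _ => x
  obtain ⟨N, b, hb, -⟩ := ha.exists_countable_model (T := T)
  exact ⟨N, b, hb⟩

/-- Compactness: if in every countable model every valuation satisfies a formula of a given family,
then finitely many of these formulas suffice. -/
theorem exists_finset_cover {α : Type} [Countable α] {J : Type*} (γ : J → L.Formula α)
    (h : ∀ (N : Theory.ModelType.{u, v, 0} T) (x : α → N), Countable N → ∃ j, (γ j).Realize x) :
    ∃ F : Finset J, ∀ (N : Theory.ModelType.{u, v, 0} T) (x : α → N), ∃ j ∈ F, (γ j).Realize x := by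
  obtain ⟨F, hF⟩ := isCompact_univ.elim_finite_subcover
    (fun j => T.typesWith (α := α) (Formula.equivSentence (γ j)))
    (fun j => CompleteType.isOpen_typesWith _) (fun p _ => by
      obtain ⟨M, x, rfl⟩ := Theory.exists_modelType_is_realized_in T p
      obtain ⟨c, hc⟩ : ∃ c : ℕ → M, ∀ i, ∃ j, c j = x i := by
        rcases isEmpty_or_nonempty α with hα | hα
        · exact ⟨fun _ => Classical.arbitrary M, fun i => hα.elim i⟩
        · obtain ⟨f, hf⟩ := exists_surjective_nat α
          exact ⟨x ∘ f, fun i => let ⟨j, hj⟩ := hf i; ⟨j, congrArg x hj⟩⟩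
      obtain ⟨a, ha, -, hac⟩ := RichSeq.InDFin.exists_extension (Φ := Φ) (m := 0)
        (x := Fin.elim0 (α := M)) (fun i => i.elim0) c
      choose σ hσ using fun i => (let ⟨j, hj⟩ := hc i; hj ▸ hac j : ∃ k, a k = x i)
      obtain ⟨N, b, hb, hba⟩ := ha.exists_countable_model (T := T)
      obtain ⟨j, hj⟩ := h N (b ∘ σ) hb.countable
      refine Set.mem_iUnion.2 ⟨j, ?_⟩
      rw [Theory.CompleteType.mem_typesWith_iff, Theory.CompleteType.formula_mem_typeOf]
      have := hba ((γ j).relabel σ)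
      rw [Formula.realize_relabel, Formula.realize_relabel] at this
      rw [← funext hσ]
      exact this.1 hj)
  refine ⟨F, fun N x => ?_⟩
  obtain ⟨j, hj, hx⟩ := Set.mem_iUnion₂.1 (hF (Set.mem_univ (T.typeOf x)))
  rw [Theory.CompleteType.mem_typesWith_iff, Theory.CompleteType.formula_mem_typeOf] at hx
  exact ⟨j, hj, hx⟩

end Compactness

section Generic

variable {L : FirstOrder.Language.{u, v}} {T : L.Theory}

theorem msStr_models (M : Theory.ModelType.{u, v, 0} T) :
    (msStr (L := L) M).Models (msTheory T) := msStr_models_iff.2 M.is_model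

/-- A non-empty family of models of a complete theory is generic. -/
theorem generic_of_isComplete (hT : T.IsComplete) {ι : Type*} [Nonempty ι]
    (mod : ι → Theory.ModelType.{u, v, 0} T) :
    MSLanguage.Generic.{0, w} (msTheory T) fun i => msStr (L := L) (mod i) := by
  obtain ⟨i⟩ := ‹Nonempty ι›
  intro φ h K hK
  exact (sat_iff_of_isComplete hT hK (msStr_models (mod i)) φ).2 (h i)

end Generic

/-! ### Clopen predicates of enumerations and formulas -/

section Predicates

variable {L : FirstOrder.Language.{u, v}}

/-- The enumerations of `M` that belong to `D_Φ`. -/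
abbrev Enum (Φ : RichSeq L) (M : Type) [L.Structure M] : Type := {b : ℕ → M // Φ.Enumerates M b}

/-- The valuation of the variables `(k, j)` given by a family of enumerations. -/
def enumVal {κ : Type} {Φ : RichSeq L} {M : Type} [L.Structure M] (b : κ → Enum Φ M) (p : κ × ℕ) :
    M :=
  (b p.1).1 p.2

variable {Φ : RichSeq L}

/-- Projections of first-order conditions on families of enumerations are first-order. -/
theorem exists_projection_formula {κ A : Type} [Finite κ] [Finite A] (r : A → κ × ℕ)
    (ψ : L.Formula (κ × ℕ)) :
    ∃ ψ' : L.Formula A, ∀ (M : Type) [L.Structure M] [Nonempty M] [Countable M] (x : A → M),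
      ψ'.Realize x ↔ ∃ b : κ → Enum Φ M, enumVal b ∘ r = x ∧ ψ.Realize (enumVal b) := by
  obtain ⟨m₀, hm₀⟩ := exists_bound.{u, v, 0} Prod.snd ψ
  obtain ⟨m₁, hm₁⟩ := (Set.finite_range fun x => (r x).2).bddAbove
  let m := max m₀ m₁ + 1
  have hr : ∀ x, (r x).2 < m := fun x =>
    Nat.lt_succ_of_le (le_max_of_le_right (hm₁ ⟨x, rfl⟩))
  let t : κ × ℕ → A ⊕ κ × Fin m := fun p =>
    .inr (p.1, if h : p.2 < m then ⟨p.2, h⟩ else ⟨0, Nat.succ_pos _⟩)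
  refine ⟨Formula.iExs (κ × Fin m) (Formula.iInf (fun k => (Φ.domForm m).relabel
    fun j => .inr (k, j)) ⊓ (Formula.iInf (fun x => Term.equal
      (Term.var (.inr ((r x).1, ⟨(r x).2, hr x⟩))) (Term.var (.inl x))) ⊓ ψ.relabel t)),
    fun M _ _ _ x => ?_⟩
  have hψ : ∀ (y : κ × Fin m → M) (z : κ × ℕ → M), (∀ k (j : Fin m), z (k, j) = y (k, j)) →
      (ψ.Realize (Sum.elim x y ∘ t) ↔ ψ.Realize z) := fun y z h => by
    refine hm₀ M _ _ fun p hp => ?_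
    have hp' : p.2 < m := Nat.lt_succ_of_le (le_max_of_le_left hp.le)
    simp only [t, Function.comp_apply, dif_pos hp', Sum.elim_inr]
    exact (h p.1 ⟨p.2, hp'⟩).symm
  simp only [Formula.realize_iExs, Formula.realize_inf, Formula.realize_iInf,
    Formula.realize_relabel, RichSeq.realize_domForm, Formula.realize_equal, Term.realize_var,
    Sum.elim_inr, Sum.elim_inl]
  constructor
  · rintro ⟨y, h1, h2, h3⟩
    choose b hb hby using fun k => (h1 k).exists_enumerates
    refine ⟨fun k => ⟨b k, hb k⟩, funext fun a => ?_, (hψ y _ hby).1 h3⟩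
    rw [← h2 a]
    exact hby _ ⟨_, hr a⟩
  · rintro ⟨b, rfl, h⟩
    exact ⟨fun p => enumVal b (p.1, p.2), fun k => (b k).2.inD.inDFin m, fun a => rfl,
      (hψ _ _ fun _ _ => rfl).2 h⟩

variable {T : L.Theory} {ι : Type*}

/-- A family of models in which every countable model (with carrier in `Type`) occurs. -/
structure IsCover (mod : ι → Theory.ModelType.{u, v, 0} T) : Prop where
  countable : ∀ i, Countable (mod i)
  exhausts : ∀ M : Theory.ModelType.{u, v, 0} T, Countable M → ∃ i, mod i = M

variable {mod : ι → Theory.ModelType.{u, v, 0} T} {κ : Type}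

/-- A predicate of families of enumerations that, whenever it is true, follows from a formula. -/
def OpenPred (P : ∀ i, (κ → Enum Φ (mod i)) → Prop) : Prop :=
  ∀ i b, P i b → ∃ ψ : L.Formula (κ × ℕ), ψ.Realize (enumVal b) ∧
    ∀ i' b', ψ.Realize (enumVal b') → P i' b'

/-- A predicate that is open, as well as its negation. -/
structure ClopenPred (P : ∀ i, (κ → Enum Φ (mod i)) → Prop) : Prop where
  isOpen : OpenPred P
  isOpen_not : OpenPred fun i b => ¬ P i b

theorem clopenPred_of_formula {P : ∀ i, (κ → Enum Φ (mod i)) → Prop} (ψ : L.Formula (κ × ℕ))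
    (h : ∀ i b, P i b ↔ ψ.Realize (enumVal b)) : ClopenPred P :=
  ⟨fun i b hb => ⟨ψ, (h i b).1 hb, fun i' b' => (h i' b').2⟩,
    fun i b hb => ⟨ψ.not, fun h' => hb ((h i b).2 h'), fun i' b' h' hb' => h' ((h i' b').1 hb')⟩⟩

/-- A clopen predicate that depends only on finitely many coordinates of the enumerations is given
by a formula in these coordinates. -/
theorem ClopenPred.exists_formula [Finite κ] (hmod : IsCover mod)
    {P : ∀ i, (κ → Enum Φ (mod i)) → Prop}
    (hP : ClopenPred P) {A : Type} [Finite A] (r : A → κ × ℕ)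
    (hr : ∀ i b b', enumVal b ∘ r = enumVal b' ∘ r → P i b → P i b') :
    ∃ χ : L.Formula A, ∀ i b, P i b ↔ χ.Realize (enumVal b ∘ r) := by
  -- By compactness, finitely many of the following conditions on `x : A → M` cover all cases: `x`
  -- belongs to the projection of a formula implying `P`, or of one implying `¬ P`, or `x` is not
  -- part of a family of enumerations.
  choose pr hpr using fun ψ : L.Formula (κ × ℕ) => exists_projection_formula (Φ := Φ) r ψ
  let J₁ := {ψ : L.Formula (κ × ℕ) // ∀ i b, ψ.Realize (enumVal b) → P i b}
  let J₂ := {ψ : L.Formula (κ × ℕ) // ∀ i b, ψ.Realize (enumVal b) → ¬ P i b}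
  let γ : J₁ ⊕ (J₂ ⊕ Unit) → L.Formula A :=
    Sum.elim (fun ψ => pr ψ.1) (Sum.elim (fun ψ => pr ψ.1) fun _ => (pr ⊤).not)
  obtain ⟨F, hF⟩ := exists_finset_cover Φ (T := T) γ (by
    intro N x hN
    obtain ⟨i, rfl⟩ := hmod.exhausts N hN
    by_cases hx : (pr ⊤).Realize x
    · obtain ⟨b, rfl, -⟩ := (hpr _ _ _).1 hx
      by_cases hb : P i b
      · obtain ⟨ψ, h1, h2⟩ := hP.isOpen i b hb
        exact ⟨.inl ⟨ψ, h2⟩, (hpr _ _ _).2 ⟨b, rfl, h1⟩⟩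
      · obtain ⟨ψ, h1, h2⟩ := hP.isOpen_not i b hb
        exact ⟨.inr (.inl ⟨ψ, h2⟩), (hpr _ _ _).2 ⟨b, rfl, h1⟩⟩
    · exact ⟨.inr (.inr ()), hx⟩)
  let F₁ := {ψ : J₁ // Sum.inl ψ ∈ F}
  have : Finite F₁ := Finite.of_injective (β := F) (fun ψ => ⟨.inl ψ.1, ψ.2⟩) fun ψ ψ' h =>
    Subtype.ext (Sum.inl_injective (congrArg Subtype.val h))
  refine ⟨Formula.iSup fun ψ : F₁ => pr ψ.1.1, fun i b => ?_⟩
  have := hmod.countable i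
  rw [Formula.realize_iSup]
  constructor
  · intro hb
    obtain ⟨j, hj, h⟩ := hF (mod i) (enumVal b ∘ r)
    rcases j with ψ | ψ | _
    · exact ⟨⟨ψ, hj⟩, h⟩
    · obtain ⟨b', hb', h'⟩ := (hpr _ _ _).1 h
      exact absurd (hr i b b' hb'.symm hb) (ψ.2 i b' h')
    · exact absurd ((hpr _ _ _).2 ⟨b, rfl, Formula.realize_top.2 trivial⟩) h
  · rintro ⟨ψ, h⟩
    obtain ⟨b', hb', h'⟩ := (hpr _ _ _).1 h
    exact hr i b' b hb' (ψ.1.2 i b' h')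

/-- A pair, as a family. -/
def pairFam {X : Type} (x y : X) : Bool → X := fun t => cond t y x

/-- A reflexive open relation contains all pairs of enumerations that agree up to some fixed
index. -/
theorem OpenPred.exists_agree (hmod : IsCover mod) {E : ∀ i, Enum Φ (mod i) → Enum Φ (mod i) → Prop}
    (hE : OpenPred fun i (p : Bool → Enum Φ (mod i)) => E i (p false) (p true))
    (hrefl : ∀ i b, E i b b) :
    ∃ n, ∀ i b c, (∀ j < n, b.1 j = c.1 j) → E i b c := by
  -- The diagonal is covered by the formulas `ψ(x, x)` with `ψ` contained in `E`, and the complement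
  -- of `D_Φ` by the negations of its defining conditions; finitely many suffice by compactness.
  let J := {ψ : L.Formula (Bool × ℕ) // ∀ i (p : Bool → Enum Φ (mod i)),
    ψ.Realize (enumVal p) → E i (p false) (p true)}
  let γ : J ⊕ ℕ → L.Formula ℕ := Sum.elim (fun ψ => ψ.1.relabel Prod.snd)
    fun m => ((Φ.domForm m).relabel fun j : Fin m => (j : ℕ)).not
  obtain ⟨F, hF⟩ := exists_finset_cover Φ (T := T) γ (by
    intro N x hN
    by_cases hx : Φ.InD x
    · obtain ⟨N', b, hb, hbx⟩ := hx.exists_countable_model (T := T)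
      obtain ⟨i, rfl⟩ := hmod.exhausts N' hb.countable
      obtain ⟨ψ, h1, h2⟩ := hE i (fun _ => ⟨b, hb⟩) (hrefl i ⟨b, hb⟩)
      exact ⟨.inl ⟨ψ, h2⟩, (hbx _).1 (Formula.realize_relabel.2 h1)⟩
    · rw [RichSeq.inD_iff, not_forall] at hx
      obtain ⟨m, hm⟩ := hx
      refine ⟨.inr m, fun h => hm ?_⟩
      exact (Φ.realize_domForm _).1 (Formula.realize_relabel.1 h))
  choose bd hbd using fun ψ : L.Formula (Bool × ℕ) => exists_bound.{u, v, 0} Prod.snd ψ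
  refine ⟨F.sup (Sum.elim (fun ψ : J => bd ψ.1) id), fun i b c h => ?_⟩
  obtain ⟨j, hj, h'⟩ := hF (mod i) b.1
  rcases j with ψ | m
  · refine ψ.2 i (pairFam b c) ((hbd ψ.1 (mod i) _ _ ?_).1 (Formula.realize_relabel.1 h'))
    rintro ⟨t, j⟩ hj'
    cases t
    · rfl
    · exact h j (lt_of_lt_of_le hj' (Finset.le_sup (f := Sum.elim (fun ψ : J => bd ψ.1) id) hj))
  · exact absurd (Formula.realize_relabel.2 ((Φ.realize_domForm _).2 (b.2.inD.inDFin m))) h'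

/-- A clopen equivalence relation is given by a formula in initial segments of fixed length. -/
theorem ClopenPred.exists_eqv_formula (hmod : IsCover mod)
    {E : ∀ i, Enum Φ (mod i) → Enum Φ (mod i) → Prop}
    (hE : ClopenPred fun i (p : Bool → Enum Φ (mod i)) => E i (p false) (p true))
    (heq : ∀ i, Equivalence (E i)) :
    ∃ (n : ℕ) (ε : L.Formula (Fin n ⊕ Fin n)), ∀ i b c,
      E i b c ↔ ε.Realize (Sum.elim (fun j => b.1 j) fun j => c.1 j) := by
  obtain ⟨n, hn⟩ := hE.isOpen.exists_agree hmod fun i => (heq i).refl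
  obtain ⟨ε, hε⟩ := hE.exists_formula hmod (A := Fin n ⊕ Fin n)
    (Sum.elim (fun j => (false, j)) fun j => (true, j)) (fun i p q hpq h =>
      (heq i).trans (hn i (q false) (p false) fun j hj => (congrFun hpq (.inl ⟨j, hj⟩)).symm)
        ((heq i).trans h (hn i (p true) (q true) fun j hj => congrFun hpq (.inr ⟨j, hj⟩))))
  refine ⟨n, ε, fun i b c => (hε i (pairFam b c)).trans (iff_of_eq (congrArg _ ?_))⟩
  funext a
  cases a <;> rfl

theorem nonempty_enum (Φ : RichSeq L) (M : Type) [L.Structure M] [Nonempty M] [Countable M] :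
    Nonempty (Enum Φ M) :=
  let ⟨a, ha, _⟩ := RichSeq.InDFin.exists_enumerates (Φ := Φ) (m := 0) (x := Fin.elim0 (α := M))
    fun i => i.elim0
  ⟨⟨a, ha⟩⟩

/-- Every tuple in a non-empty definable set can be found at fixed places of enumerations, and at
these places every member of `D_Φ` has a tuple of this set. -/
theorem exists_henkin (Φ : RichSeq L) {m : ℕ} (δ : L.Formula (Fin m))
    (hδ : ∀ M : Theory.ModelType.{u, v, 0} T, Countable M → ∃ x : Fin m → M, δ.Realize x) :
    ∃ r : Fin m → ℕ, ∀ M : Theory.ModelType.{u, v, 0} T, Countable M →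
      (∀ b : Enum Φ M, δ.Realize fun i => b.1 (r i)) ∧
      ∀ x : Fin m → M, δ.Realize x → ∃ b : Enum Φ M, ∀ i, b.1 (r i) = x i := by
  induction m with
  | zero =>
    refine ⟨Fin.elim0, fun M hM => ⟨fun b => ?_, fun x _ => ?_⟩⟩
    · obtain ⟨x, hx⟩ := hδ M hM
      rwa [Subsingleton.elim x] at hx
    · obtain ⟨a⟩ := nonempty_enum Φ M
      exact ⟨a, fun i => i.elim0⟩
  | succ m ih =>
    let t : Fin (m + 1) → Fin m ⊕ Unit :=
      Fin.snoc (α := fun _ => Fin m ⊕ Unit) (fun i => .inl i) (.inr ())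
    have ht : ∀ {M : Type} (x : Fin m → M) (y : M),
        Sum.elim x (fun _ => y) ∘ t = Fin.snoc (α := fun _ => M) x y := fun x y => by
      funext i
      refine Fin.lastCases ?_ (fun i => ?_) i
      · simp [t]
      · simp [t]
    have hex : ∀ (M : Type) [L.Structure M] (x : Fin m → M),
        (Formula.iExs Unit (δ.relabel t)).Realize x ↔
        ∃ y, δ.Realize (Fin.snoc (α := fun _ => M) x y) := fun M _ x => by
      rw [Formula.realize_iExs]
      simp only [Formula.realize_relabel]
      exact ⟨fun ⟨y, hy⟩ => ⟨y (), by rw [← ht]; exact hy⟩,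
        fun ⟨y, hy⟩ => ⟨fun _ => y, by rw [← ht] at hy; exact hy⟩⟩
    obtain ⟨r, hr⟩ := ih (Formula.iExs Unit (δ.relabel t)) fun M hM => by
      obtain ⟨x, hx⟩ := hδ M hM
      refine ⟨fun i => x i.castSucc, (hex _ _).2 ⟨x (Fin.last m), ?_⟩⟩
      convert hx
      exact Fin.snoc_init_self x
    -- The last entry is put at a place whose formula says that it completes the entries at `r`.
    obtain ⟨K, hK⟩ := (Set.finite_range r).bddAbove
    have hK' : ∀ i, r i < K + 1 := fun i => Nat.lt_succ_of_le (hK ⟨i, rfl⟩)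
    obtain ⟨n, hn, hform⟩ := Φ.rich (K + 1)
      ((δ.relabel t).relabel (Sum.map (fun i => ⟨r i, hK' i⟩) id))
    have key : ∀ {M : Type} [L.Structure M] (a : ℕ → M) (y : M),
        (Φ.form n).Realize (Sum.elim (fun i : Fin n => a i) fun _ => y) ↔
        δ.Realize (Fin.snoc (α := fun _ => M) (fun i => a (r i)) y) := by
      intro M _ a y
      rw [hform, Formula.realize_relabel, Formula.realize_relabel, Formula.realize_relabel, ← ht]
      refine iff_of_eq (congrArg _ (congrArg (· ∘ t) (funext fun c => ?_)))
      cases c <;> rfl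
    have hs : ∀ {M : Type} (a : ℕ → M), (fun i => a (Fin.snoc (α := fun _ => ℕ) r n i)) =
        Fin.snoc (α := fun _ => M) (fun i => a (r i)) (a n) := fun a => by
      funext i
      refine Fin.lastCases ?_ (fun i => ?_) i
      · simp
      · simp
    refine ⟨Fin.snoc (α := fun _ => ℕ) r n, fun M hM => ⟨fun b => ?_, fun x hx => ?_⟩⟩
    · obtain ⟨y, hy⟩ := (hex _ _).1 ((hr M hM).1 b)
      rw [hs]
      exact (key _ _).1 (b.2.inD n y ((key _ _).2 hy))
    · have hx' : δ.Realize (Fin.snoc (α := fun _ => M)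
          (fun i => x i.castSucc) (x (Fin.last m))) := by
        convert hx
        exact Fin.snoc_init_self x
      obtain ⟨b, hb⟩ := (hr M hM).2 (fun i => x i.castSucc) ((hex _ _).2 ⟨_, hx'⟩)
      have hin : Φ.InDFin (Fin.snoc (α := fun _ => M) (fun i : Fin n => b.1 i)
          (x (Fin.last m))) := by
        have hcast : ∀ (k : ℕ) (hk : k ≤ n) (j : Fin k), Fin.snoc (α := fun _ => M)
            (fun i : Fin n => b.1 i) (x (Fin.last m)) (Fin.castLE (hk.trans n.le_succ) j) =
            b.1 j := fun k hk j => Fin.snoc_castSucc (α := fun _ => M) _ _ (Fin.castLE hk j)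
        refine Fin.lastCases (fun y hy => ?_) (fun i y hy => ?_)
        · rw [Fin.snoc_last]
          have h1 := (key b.1 (x (Fin.last m))).2 (by
            rw [funext hb]
            exact hx')
          have h2 : (fun j : Fin n => Fin.snoc (α := fun _ => M) (fun i : Fin n => b.1 i)
              (x (Fin.last m)) (Fin.castLE (Fin.last n).2.le j)) = fun j : Fin n => b.1 j :=
            funext fun j => hcast n le_rfl j
          exact (iff_of_eq (congrArg (fun z => (Φ.form n).Realize
            (Sum.elim z fun _ => x (Fin.last m))) h2)).2 h1
        · rw [Fin.snoc_castSucc]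
          have h1 : (fun j : Fin i => Fin.snoc (α := fun _ => M) (fun i : Fin n => b.1 i)
              (x (Fin.last m)) (Fin.castLE i.castSucc.2.le j)) = fun j : Fin i => b.1 j :=
            funext fun j => hcast i i.2.le j
          refine (iff_of_eq (congrArg (fun z => (Φ.form i).Realize
            (Sum.elim z fun _ => b.1 i)) h1)).2 (b.2.inD i y ?_)
          exact (iff_of_eq (congrArg (fun z => (Φ.form i).Realize
            (Sum.elim z fun _ => y)) h1)).1 hy
      obtain ⟨a, ha, hax⟩ := hin.exists_enumerates
      refine ⟨⟨a, ha⟩, Fin.lastCases ?_ fun i => ?_⟩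
      · rw [Fin.snoc_last]
        exact (hax (Fin.last n)).trans (Fin.snoc_last (α := fun _ => M) _ _)
      · rw [Fin.snoc_castSucc]
        have hri : r i < n := (hK' i).trans_le hn
        exact (hax (Fin.castSucc ⟨r i, hri⟩)).trans
          ((Fin.snoc_castSucc (α := fun _ => M) _ _ _).trans (hb i))

/-- Some place of the enumerations takes all values. -/
theorem exists_place (Φ : RichSeq L) : ∃ p, ∀ M : Theory.ModelType.{u, v, 0} T, Countable M →
    ∀ x : M, ∃ b : Enum Φ M, b.1 p = x := by
  obtain ⟨r, hr⟩ := exists_henkin (T := T) Φ (m := 1) ⊤ fun M _ =>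
    ⟨fun _ => Classical.arbitrary M, Formula.realize_top.2 trivial⟩
  exact ⟨r 0, fun M hM x =>
    let ⟨b, hb⟩ := (hr M hM).2 (fun _ => x) (Formula.realize_top.2 trivial)
    ⟨b, hb 0⟩⟩

end Predicates

/-! ### Arrows and orbits of the groupoid of a theory -/

section Arrows

variable {L : FirstOrder.Language.{u, v}} {T : L.Theory} {Φ : RichSeq L}

namespace ThGroupoid

section

variable {M : Theory.ModelType.{u, v, 0} T}

/-- The arrow `tp(b, c)`. -/
def arr (b c : Enum Φ M) : ThGroupoid T Φ := tp M b.2 c.2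

theorem mem_comp_arr {a b c : Enum Φ M} : arr a c ∈ AlgGroupoid.comp (arr a b) (arr b c) :=
  mem_pcomp.2 (isComp_tp a.2 b.2 c.2)

theorem eq_of_mem_comp_arr {a b : Enum Φ M} {h k : ThGroupoid T Φ}
    (H : k ∈ AlgGroupoid.comp (arr a b) h) : ∃ c : Enum Φ M, h = arr b c ∧ k = arr a c := by
  obtain ⟨c, hc, h1, h2⟩ := isComp_tp_left (mem_pcomp.1 H)
  exact ⟨⟨c, hc⟩, h1, h2⟩

theorem inv_arr (a b : Enum Φ M) : AlgGroupoid.inv (arr a b) = arr b a := pinv_tp a.2 b.2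

theorem tgt_arr (a b : Enum Φ M) : tgt (arr a b) = arr a a := by
  refine Part.get_eq_of_mem ?_ _
  rw [inv_arr]
  exact mem_comp_arr

theorem src_arr (a b : Enum Φ M) : src (arr a b) = arr b b := by
  refine Part.get_eq_of_mem ?_ _
  rw [inv_arr]
  exact mem_comp_arr

theorem arr_mem_base (a : Enum Φ M) : arr a a ∈ base (ThGroupoid T Φ) := mem_comp_arr

theorem arr_left_cancel {a b c : Enum Φ M} (h : arr a b = arr a c) : b = c :=
  Subtype.ext (tp_left_cancel h)

theorem exists_equiv_of_arr_eq {N : Theory.ModelType.{u, v, 0} T} {a b : Enum Φ M}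
    {a' b' : Enum Φ N} (h : arr a b = arr a' b') :
    ∃ e : L.Equiv M N, e ∘ a.1 = a'.1 ∧ e ∘ b.1 = b'.1 :=
  exists_equiv_of_tp_eq h

theorem exists_eq_arr_left {a : Enum Φ M} {g : ThGroupoid T Φ} (h : tgt g = arr a a) :
    ∃ b : Enum Φ M, g = arr a b := by
  obtain ⟨N, c, d, hc, hd, rfl⟩ := exists_tp g
  have h' : arr (M := N) ⟨c, hc⟩ ⟨c, hc⟩ = arr a a := (tgt_arr ⟨c, hc⟩ ⟨d, hd⟩).symm.trans h
  obtain ⟨e, h1, -⟩ := exists_equiv_of_arr_eq h'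
  refine ⟨⟨e ∘ d, enumerates_equiv e hd⟩, (tp_equiv e hc hd).trans ?_⟩
  obtain rfl : a = ⟨e ∘ c, enumerates_equiv e hc⟩ := Subtype.ext h1.symm
  rfl

theorem exists_eq_arr_right {a : Enum Φ M} {g : ThGroupoid T Φ} (h : src g = arr a a) :
    ∃ b : Enum Φ M, g = arr b a := by
  obtain ⟨N, c, d, hc, hd, rfl⟩ := exists_tp g
  have h' : arr (M := N) ⟨d, hd⟩ ⟨d, hd⟩ = arr a a := (src_arr ⟨c, hc⟩ ⟨d, hd⟩).symm.trans h
  obtain ⟨e, h1, -⟩ := exists_equiv_of_arr_eq h'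
  refine ⟨⟨e ∘ c, enumerates_equiv e hc⟩, (tp_equiv e hc hd).trans ?_⟩
  obtain rfl : a = ⟨e ∘ d, enumerates_equiv e hd⟩ := Subtype.ext h1.symm
  rfl

end

theorem exists_arr_of_mem_base {e : ThGroupoid T Φ} (he : e ∈ base (ThGroupoid T Φ)) :
    ∃ (M : Theory.ModelType.{u, v, 0} T) (a : Enum Φ M), e = arr a a := by
  obtain ⟨M, a, b, ha, hb, rfl⟩ := exists_tp e
  obtain ⟨c, h1, h2⟩ := eq_of_mem_comp_arr (a := ⟨a, ha⟩) (b := ⟨b, hb⟩) he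
  obtain rfl : (⟨b, hb⟩ : Enum Φ M) = c := arr_left_cancel (a := ⟨a, ha⟩) h2
  exact ⟨M, ⟨b, hb⟩, h1⟩

theorem exists_basic_subset {U : Set (ThGroupoid T Φ)} (hU : IsOpen U) {g : ThGroupoid T Φ}
    (hg : g ∈ U) : ∃ ψ : L.Formula (ℕ ⊕ ℕ), g ∈ basic ψ ∧ basic ψ ⊆ U := by
  obtain ⟨V, hV, rfl⟩ := isOpen_induced_iff.1 hU
  obtain ⟨_, ⟨φ, rfl⟩, h1, h2⟩ :=
    (CompleteType.isTopologicalBasis_range_typesWith (T := T)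
      (α := ℕ ⊕ ℕ)).exists_subset_of_mem_open
      hg hV
  refine ⟨Formula.equivSentence.symm φ, ?_, fun g' hg' => h2 ?_⟩
  · show Formula.equivSentence (Formula.equivSentence.symm φ) ∈ g.1
    rw [Equiv.apply_symm_apply]
    exact h1
  · have h3 : Formula.equivSentence (Formula.equivSentence.symm φ) ∈ g'.1 := hg'
    rwa [Equiv.apply_symm_apply] at h3

theorem arr_mem_basic {M : Theory.ModelType.{u, v, 0} T} {ψ : L.Formula (ℕ ⊕ ℕ)}
    {a b : Enum Φ M} : arr a b ∈ basic ψ ↔ ψ.Realize (Sum.elim a.1 b.1) := tp_mem_basic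

/-- The arrows `tp(a, a)` and `tp(a, b k)` of a family of enumerations of the same model. -/
def star {κ : Type} {M : Theory.ModelType.{u, v, 0} T} (a : Enum Φ M) (b : κ → Enum Φ M) :
    ThGroupoid T Φ × (κ → ThGroupoid T Φ) := (arr a a, fun k => arr a (b k))

/-- A formula about the `b k` holds on a neighbourhood of `star a b`: the finitely many entries of
the `b k` that matter are entries of `a`. -/
theorem exists_isOpen_of_realize {κ : Type} [Finite κ] {M : Theory.ModelType.{u, v, 0} T}
    {a : Enum Φ M} {b : κ → Enum Φ M} {ψ : L.Formula (κ × ℕ)} (h : ψ.Realize (enumVal b)) :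
    ∃ O : Set (ThGroupoid T Φ × (κ → ThGroupoid T Φ)), IsOpen O ∧ star a b ∈ O ∧
      ∀ (N : Theory.ModelType.{u, v, 0} T) (a' : Enum Φ N) (b' : κ → Enum Φ N),
        star a' b' ∈ O → ψ.Realize (enumVal b') := by
  obtain ⟨m, hm⟩ := exists_bound.{u, v, 0} Prod.snd ψ
  choose σ hσ using fun p : κ × ℕ => a.2.surj (enumVal b p)
  let U : κ × Fin m → Set (ThGroupoid T Φ × (κ → ThGroupoid T Φ)) := fun p => (fun x => x.2 p.1) ⁻¹'
    basic (Term.equal (Term.var (.inl (σ (p.1, p.2)))) (Term.var (.inr (p.2 : ℕ))))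
  refine ⟨Prod.fst ⁻¹' basic (ψ.relabel fun p => .inl (σ p)) ∩ ⋂ p, U p,
    ((isOpen_basic _).preimage continuous_fst).inter (isOpen_iInter_of_finite fun p =>
      (isOpen_basic _).preimage (f := fun x : ThGroupoid T Φ × (κ → ThGroupoid T Φ) => x.2 p.1)
        ((continuous_apply p.1).comp continuous_snd)), ⟨?_, ?_⟩, ?_⟩
  · show arr a a ∈ basic _
    rw [arr_mem_basic, Formula.realize_relabel]
    convert h
    exact funext hσ
  · refine Set.mem_iInter.2 fun p => ?_
    show arr a (b p.1) ∈ basic _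
    rw [arr_mem_basic, Formula.realize_equal]
    exact hσ (p.1, p.2)
  · rintro N a' b' ⟨h1, h2⟩
    have h1' : arr a' a' ∈ basic _ := h1
    rw [arr_mem_basic, Formula.realize_relabel] at h1'
    refine (hm N _ _ fun p hp => ?_).1 h1'
    have h3 : arr a' (b' p.1) ∈ basic _ := Set.mem_iInter.1 h2 (p.1, ⟨p.2, hp⟩)
    rw [arr_mem_basic, Formula.realize_equal] at h3
    exact h3

/-- Open sets of families of arrows `star a b` give open predicates of `b`, by quantifying over
`a`. -/
theorem openPred_of_isOpen {ι : Type*} {mod : ι → Theory.ModelType.{u, v, 0} T}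
    (hmod : IsCover mod) {κ : Type} [Finite κ] {P : ∀ i, (κ → Enum Φ (mod i)) → Prop}
    (h : ∀ i b, P i b → ∃ O : Set (ThGroupoid T Φ × (κ → ThGroupoid T Φ)), IsOpen O ∧
      (∃ a, star a b ∈ O) ∧ ∀ i' (a' : Enum Φ (mod i')) b', star a' b' ∈ O → P i' b') :
    OpenPred P := by
  intro i b hb
  obtain ⟨O, hO, ⟨a, ha⟩, hOP⟩ := h i b hb
  obtain ⟨U, V, hU, hV, haU, hbV, hUV⟩ := isOpen_prod_iff.1 hO _ _ ha
  obtain ⟨W, hW, hWV⟩ := isOpen_pi_iff'.1 hV _ hbV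
  obtain ⟨χ, hχ, hχU⟩ := exists_basic_subset hU haU
  choose ψ hψ hψW using fun k => exists_basic_subset (hW k).1 (hW k).2
  -- The formula about `a` (the index `none`) and the `b k` which implies membership in `O`.
  let ρ : L.Formula (Option κ × ℕ) := χ.relabel (Sum.elim (fun j => (none, j)) fun j => (none, j)) ⊓
    Formula.iInf fun k => (ψ k).relabel (Sum.elim (fun j => (none, j)) fun j => (some k, j))
  have hρ : ∀ {N : Theory.ModelType.{u, v, 0} T} (c : Option κ → Enum Φ N),
      ρ.Realize (enumVal c) ↔ arr (c none) (c none) ∈ basic χ ∧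
        ∀ k, arr (c none) (c (some k)) ∈ basic (ψ k) := by
    intro N c
    simp only [ρ, Formula.realize_inf, Formula.realize_iInf, Formula.realize_relabel, arr_mem_basic]
    refine and_congr (iff_of_eq (congrArg _ ?_)) (forall_congr' fun k =>
      iff_of_eq (congrArg _ ?_)) <;> (funext j; cases j <;> rfl)
  obtain ⟨m, hm⟩ := exists_bound.{u, v, 0} Prod.snd ρ
  obtain ⟨ρ', hρ'⟩ := exists_projection_formula (Φ := Φ) (A := κ × Fin m)
    (fun p => (some p.1, (p.2 : ℕ))) ρ
  have key : ∀ i (b : κ → Enum Φ (mod i)), (ρ'.relabel fun p : κ × Fin m =>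
      ((p.1, (p.2 : ℕ)) : κ × ℕ)).Realize (enumVal b) ↔
      ∃ a, ρ.Realize (enumVal fun o : Option κ => o.elim a b) := by
    intro i b
    have := hmod.countable i
    rw [Formula.realize_relabel, hρ']
    constructor
    · rintro ⟨c, hc, h⟩
      refine ⟨c none, (hm _ _ _ ?_).1 h⟩
      rintro ⟨_ | k, j⟩ hj
      · rfl
      · exact congrFun hc (k, ⟨j, hj⟩)
    · rintro ⟨a, h⟩
      exact ⟨_, rfl, h⟩
  refine ⟨_, (key i b).2 ⟨a, (hρ _).2 ⟨hχ, hψ⟩⟩, fun i' b' h' => ?_⟩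
  obtain ⟨a', ha'⟩ := (key i' b').1 h'
  have h3 := (hρ _).1 ha'
  exact hOP i' a' b' (hUV ⟨hχU h3.1, hWV fun k _ => hψW k (h3.2 k)⟩)

/-- Open predicates are invariant under isomorphisms. -/
theorem OpenPred.congr_star {ι : Type*} {mod : ι → Theory.ModelType.{u, v, 0} T} {κ : Type}
    {P : ∀ i, (κ → Enum Φ (mod i)) → Prop} (hP : OpenPred P) {i i' : ι} {a : Enum Φ (mod i)}
    {b : κ → Enum Φ (mod i)} {a' : Enum Φ (mod i')} {b' : κ → Enum Φ (mod i')}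
    (h : star a b = star a' b') (hb : P i b) : P i' b' := by
  obtain ⟨ψ, h1, h2⟩ := hP i b hb
  refine h2 i' b' ?_
  obtain ⟨e, he, -⟩ := exists_equiv_of_arr_eq (congrArg Prod.fst h)
  have hbb : e ∘ enumVal b = enumVal b' := by
    funext ⟨k, j⟩
    obtain ⟨e', he1, he2⟩ := exists_equiv_of_arr_eq (congrFun (congrArg Prod.snd h) k)
    obtain ⟨l, hl⟩ := a.2.surj ((b k).1 j)
    show e ((b k).1 j) = (b' k).1 j
    rw [← he2, ← hl]
    exact (congrFun he l).trans ((congrFun he1 l).symm.trans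
      (by rw [Function.comp_apply, Function.comp_apply, hl]))
  rw [← hbb]
  exact (StrongHomClass.realize_formula e ψ).2 h1

/-! ### Clopen sets of orbits -/

/-- `star a b`, as a member of the fibred power. -/
def fib {M : Theory.ModelType.{u, v, 0} T} {k : ℕ} (a : Enum Φ M) (b : Fin k → Enum Φ M) :
    FibPow (ThGroupoid T Φ) k :=
  ⟨star a b, arr_mem_base a, fun i => (tgt_arr a (b i)).symm⟩

theorem exists_fib {k : ℕ} (p : FibPow (ThGroupoid T Φ) k) :
    ∃ (M : Theory.ModelType.{u, v, 0} T) (a : Enum Φ M) (b : Fin k → Enum Φ M), p = fib a b := by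
  obtain ⟨⟨e, g⟩, he, hg⟩ := p
  obtain ⟨M, a, rfl⟩ := exists_arr_of_mem_base he
  choose b hb using fun i => exists_eq_arr_left (hg i).symm
  exact ⟨M, a, b, Subtype.ext (Prod.ext rfl (funext hb))⟩

theorem leftAct_fib {M : Theory.ModelType.{u, v, 0} T} {k : ℕ} (a c : Enum Φ M)
    (b : Fin k → Enum Φ M) : LeftAct (arr c a) (fib a b) (fib c b) :=
  ⟨src_arr c a, tgt_arr c a, fun _ => mem_comp_arr⟩

theorem orbit_fib_eq {M : Theory.ModelType.{u, v, 0} T} {k : ℕ} (a c : Enum Φ M)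
    (b : Fin k → Enum Φ M) : orbit (fib a b) = orbit (fib c b) :=
  Quot.sound ⟨_, leftAct_fib a c b⟩

theorem eq_fib_of_leftAct {M : Theory.ModelType.{u, v, 0} T} {k : ℕ} {a : Enum Φ M}
    {b : Fin k → Enum Φ M} {f : ThGroupoid T Φ} {q : FibPow (ThGroupoid T Φ) k}
    (h : LeftAct f (fib a b) q) : ∃ c, q = fib c b := by
  obtain ⟨h1, h2, h3⟩ := h
  obtain ⟨c, rfl⟩ := exists_eq_arr_right h1
  refine ⟨c, Subtype.ext (Prod.ext ?_ (funext fun i => ?_))⟩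
  · rw [← h2, tgt_arr]
    rfl
  · obtain ⟨d, hd, hd'⟩ := eq_of_mem_comp_arr (h3 i)
    rw [hd', ← arr_left_cancel hd]
    rfl

section Orbits

variable {ι : Type*} {mod : ι → Theory.ModelType.{u, v, 0} T} (hmod : IsCover mod) {k : ℕ}
include hmod

/-- The predicate given by a clopen set of orbits is clopen. -/
theorem clopenPred_orbit {X : Set (OrbitPow (ThGroupoid T Φ) k)} (hX : IsClopen X) :
    ClopenPred fun i (b : Fin k → Enum Φ (mod i)) => ∀ a, orbit (fib a b) ∈ X := by
  have hE : ∀ i, Nonempty (Enum Φ (mod i)) := fun i => by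
    have := hmod.countable i
    exact nonempty_enum Φ _
  have key : ∀ {X : Set (OrbitPow (ThGroupoid T Φ) k)}, IsOpen X →
      OpenPred fun i (b : Fin k → Enum Φ (mod i)) => ∀ a, orbit (fib a b) ∈ X := by
    intro X hX
    have h1 : IsOpen ((orbit (G := ThGroupoid T Φ) (k := k)) ⁻¹' X) :=
      hX.preimage continuous_quot_mk
    obtain ⟨O, hO, hOX⟩ := isOpen_induced_iff.1 h1
    have h2 : ∀ p : FibPow (ThGroupoid T Φ) k, p.1 ∈ O ↔ orbit p ∈ X := fun p =>
      (Set.ext_iff.1 hOX p)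
    refine openPred_of_isOpen hmod fun i b hb => ⟨O, hO, ?_, fun i' a' b' h a => ?_⟩
    · obtain ⟨a⟩ := hE i
      exact ⟨a, (h2 (fib a b)).2 (hb a)⟩
    · rw [orbit_fib_eq a a' b']
      exact (h2 (fib a' b')).1 h
  refine ⟨key hX.isOpen, ?_⟩
  convert key hX.compl.isOpen using 3 with i b
  obtain ⟨a⟩ := hE i
  exact ⟨fun h a' ha' => h fun c => orbit_fib_eq a' c b ▸ ha', fun h h' => h a (h' a)⟩

/-- Every clopen predicate is given by a clopen set of orbits. -/
theorem ClopenPred.exists_orbit {P : ∀ i, (Fin k → Enum Φ (mod i)) → Prop} (hP : ClopenPred P) :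
    ∃ X : Set (OrbitPow (ThGroupoid T Φ) k), IsClopen X ∧
      ∀ i (a : Enum Φ (mod i)) b, orbit (fib a b) ∈ X ↔ P i b := by
  let Y : FibPow (ThGroupoid T Φ) k → Prop := fun p =>
    ∃ (i : ι) (a : Enum Φ (mod i)) (b : _), p = fib a b ∧ P i b
  have hY : ∀ i (a : Enum Φ (mod i)) b, Y (fib a b) ↔ P i b := fun i a b =>
    ⟨fun ⟨i', a', b', h, h'⟩ => OpenPred.congr_star hP.isOpen (congrArg Subtype.val h).symm h',
      fun h => ⟨i, a, b, rfl, h⟩⟩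
  have hex : ∀ p : FibPow (ThGroupoid T Φ) k,
      ∃ (i : ι) (a : Enum Φ (mod i)) (b : _), p = fib a b := by
    intro p
    obtain ⟨M, a, b, rfl⟩ := exists_fib p
    obtain ⟨i, rfl⟩ := hmod.exhausts M a.2.countable
    exact ⟨i, a, b, rfl⟩
  have key : ∀ {P : ∀ i, (Fin k → Enum Φ (mod i)) → Prop} {Y : FibPow (ThGroupoid T Φ) k → Prop},
      OpenPred P → (∀ i (a : Enum Φ (mod i)) b, Y (fib a b) ↔ P i b) → IsOpen {p | Y p} := by
    intro P Y hP hY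
    rw [isOpen_iff_forall_mem_open]
    intro p hp
    obtain ⟨i, a, b, rfl⟩ := hex p
    obtain ⟨ψ, h1, h2⟩ := hP i b ((hY i a b).1 hp)
    obtain ⟨O, hO, h3, h4⟩ := exists_isOpen_of_realize (a := a) h1
    refine ⟨Subtype.val ⁻¹' O, fun q hq => ?_, hO.preimage continuous_subtype_val, h3⟩
    obtain ⟨i', a', b', rfl⟩ := hex q
    exact (hY i' a' b').2 (h2 i' b' (h4 _ a' b' hq))
  have hinv : ∀ p q : FibPow (ThGroupoid T Φ) k, (∃ f, LeftAct f p q) → Y p = Y q := by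
    rintro p q ⟨f, hf⟩
    obtain ⟨i, a, b, rfl⟩ := hex p
    obtain ⟨c, rfl⟩ := eq_fib_of_leftAct hf
    rw [eq_iff_iff, hY, hY]
  have hq : Topology.IsQuotientMap (orbit (G := ThGroupoid T Φ) (k := k)) := isQuotientMap_quot_mk
  refine ⟨{z | Quot.lift Y hinv z}, ⟨⟨?_⟩, ?_⟩, fun i a b => hY i a b⟩
  · rw [← hq.isOpen_preimage]
    exact key hP.isOpen_not (Y := fun p => ¬ Y p) fun i a b => not_congr (hY i a b)
  · rw [← hq.isOpen_preimage]
    exact key hP.isOpen hY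

end Orbits

end ThGroupoid

end Arrows

/-! ### Interpretations given by families of quotients of enumerations -/

section EnumScheme

variable {L : FirstOrder.Language.{u, v}} {T : L.Theory} {Φ : RichSeq L}

/-- The interpretable sort of the initial segments of length `n` of the members of `D_Φ`, divided by
the relation that `ε` defines. -/
noncomputable def eqvSort (Φ : RichSeq L) (n : ℕ) (ε : L.Formula (Fin n ⊕ Fin n)) :
    (msLang L).ISort :=
  ⟨n, fun _ => (), ofL (Φ.domForm n), ofL ε⟩

/-- The initial segment of an enumeration, as an element of the domain of `eqvSort`. -/
def initial {n : ℕ} {ε : L.Formula (Fin n ⊕ Fin n)} {M : Type} [L.Structure M] [Nonempty M]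
    (b : Enum Φ M) : (eqvSort Φ n ε).Dom (msStr M) :=
  ⟨fun j => b.1 j.1, (realize_ofL _ _).2 ((Φ.realize_domForm _).2 (b.2.inD.inDFin n))⟩

theorem exists_initial {n : ℕ} {ε : L.Formula (Fin n ⊕ Fin n)} {M : Type} [L.Structure M]
    [Nonempty M] [Countable M] (x : (eqvSort Φ n ε).Dom (msStr M)) :
    ∃ b : Enum Φ M, initial b = x := by
  obtain ⟨b, hb, h⟩ := ((Φ.realize_domForm (fun j => x.1 j)).1
    ((realize_ofL _ _).1 x.2)).exists_enumerates
  exact ⟨⟨b, hb⟩, Subtype.ext (funext h)⟩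

theorem rel_eqvSort {n : ℕ} {ε : L.Formula (Fin n ⊕ Fin n)} {M : Type} [L.Structure M]
    [Nonempty M] (x y : (eqvSort Φ n ε).Dom (msStr M)) : (eqvSort Φ n ε).Rel (msStr M) x y ↔
      ε.Realize (Sum.elim (fun j : Fin n => x.1 j) fun j : Fin n => y.1 j) := by
  refine (realize_ofL (σ := Sum.elim (fun _ => ()) fun _ => ()) ε _).trans ?_
  refine iff_of_eq (congrArg _ (funext fun j => ?_))
  rcases j with j | j <;> rfl

variable {ι : Type*} {mod : ι → Theory.ModelType.{u, v, 0} T} {κ : Type}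

theorem OpenPred.reindex {κ' : Type} {P : ∀ i, (κ' → Enum Φ (mod i)) → Prop} (hP : OpenPred P)
    (f : κ' → κ) : OpenPred fun i (b : κ → Enum Φ (mod i)) => P i (b ∘ f) := by
  intro i b hb
  obtain ⟨ψ, h1, h2⟩ := hP i _ hb
  have key : ∀ i (b : κ → Enum Φ (mod i)), (ψ.relabel fun p => (f p.1, p.2)).Realize (enumVal b) ↔
      ψ.Realize (enumVal (b ∘ f)) := fun i b => Formula.realize_relabel
  exact ⟨_, (key i b).2 h1, fun i' b' h => h2 i' _ ((key i' b').1 h)⟩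

theorem ClopenPred.reindex {κ' : Type} {P : ∀ i, (κ' → Enum Φ (mod i)) → Prop} (hP : ClopenPred P)
    (f : κ' → κ) : ClopenPred fun i (b : κ → Enum Φ (mod i)) => P i (b ∘ f) :=
  ⟨hP.isOpen.reindex f, hP.isOpen_not.reindex f⟩

/-- A clopen predicate that depends only on initial segments of fixed lengths is given by a
formula. -/
theorem ClopenPred.exists_formula_initial [Finite κ] (hmod : IsCover mod)
    {P : ∀ i, (κ → Enum Φ (mod i)) → Prop} (hP : ClopenPred P) (m : κ → ℕ)
    (h : ∀ i b b', (∀ k, ∀ j < m k, (b k).1 j = (b' k).1 j) → P i b → P i b') :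
    ∃ χ : L.Formula (Σ k, Fin (m k)), ∀ i b, P i b ↔ χ.Realize fun p => (b p.1).1 p.2 :=
  hP.exists_formula hmod (fun p : Σ k, Fin (m k) => (p.1, (p.2 : ℕ))) fun i b b' hb =>
    h i b b' fun k j hj => congrFun hb ⟨k, j, hj⟩

/-- It is a clopen condition that the entries with index `p` of some enumerations form a tuple in
the class of a given enumeration. -/
theorem clopenPred_rel_tuple {n : ℕ} (ε : L.Formula (Fin n ⊕ Fin n)) (p : ℕ) :
    ClopenPred fun i (b : Option (Fin n) → Enum Φ (mod i)) =>
      ∃ z : (eqvSort Φ n ε).Dom (msStr (mod i)), (∀ j : Fin n, z.1 j = (b (some j)).1 p) ∧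
        (eqvSort Φ n ε).Rel (msStr (mod i)) (initial (b none)) z := by
  refine clopenPred_of_formula ((Φ.domForm n).relabel (fun j => (some j, p)) ⊓
    ε.relabel (Sum.elim (fun j : Fin n => (none, (j : ℕ))) fun j => (some j, p))) fun i b => ?_
  rw [Formula.realize_inf, Formula.realize_relabel, Formula.realize_relabel,
    RichSeq.realize_domForm]
  have key : ∀ z : (eqvSort Φ n ε).Dom (msStr (mod i)),
      (∀ j : Fin n, z.1 j = (b (some j)).1 p) →
      ((eqvSort Φ n ε).Rel (msStr (mod i)) (initial (b none)) z ↔ ε.Realize (enumVal b ∘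
        Sum.elim (fun j : Fin n => (none, (j : ℕ))) fun j => (some j, p))) := by
    intro z hz
    refine (rel_eqvSort (initial (b none)) z).trans (iff_of_eq (congrArg _ (funext fun j => ?_)))
    rcases j with j | j
    · rfl
    · exact hz j
  constructor
  · rintro ⟨z, hz, h⟩
    refine ⟨?_, (key z hz).1 h⟩
    have := (Φ.realize_domForm (fun j => z.1 j)).1 ((realize_ofL _ _).1 z.2)
    rwa [funext hz] at this
  · rintro ⟨h, h'⟩
    let z : (eqvSort Φ n ε).Dom (msStr (mod i)) :=
      ⟨fun j : Fin n => (b (some j)).1 p, (realize_ofL _ _).2 ((Φ.realize_domForm _).2 h)⟩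
    exact ⟨z, fun j => rfl, (key z fun j => rfl).2 h'⟩

variable {L' : MSLanguage.{us', uf', ur'}}

/-- An interpretation in which all sorts are of the form `eqvSort`. -/
noncomputable def enumScheme (Φ : RichSeq L) (n : L'.Sorts → ℕ)
    (ε : ∀ s, L.Formula (Fin (n s) ⊕ Fin (n s)))
    (fn : ∀ {k : ℕ} {d : Fin k → L'.Sorts} {s : L'.Sorts}, L'.Functions d s →
      L.Formula ((Σ i, Fin (n (d i))) ⊕ Fin (n s)))
    (rl : ∀ {k : ℕ} {d : Fin k → L'.Sorts}, L'.Relations d → L.Formula (Σ i, Fin (n (d i)))) :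
    MSLanguage.Scheme (msLang L) L' where
  sort s := eqvSort Φ (n s) (ε s)
  func F := ofL (fn F)
  rel R := ofL (rl R)

/-- A family of structures whose sorts are quotients of the sets of enumerations, in such a way that
equality, functions and predicates become clopen, is interpreted in the models of the theory. -/
theorem exists_enumScheme (hmod : IsCover mod) {N : ι → MSLanguage.Str.{w} L'}
    (Ψ : ∀ i s, Enum Φ (mod i) → (N i).carrier s) (hΨ : ∀ i s, Function.Surjective (Ψ i s))
    (heq : ∀ s, ClopenPred fun i (p : Bool → Enum Φ (mod i)) => Ψ i s (p false) = Ψ i s (p true))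
    (hfun : ∀ {k : ℕ} {d : Fin k → L'.Sorts} {s : L'.Sorts} (F : L'.Functions d s),
      ClopenPred fun i (b : Option (Fin k) → Enum Φ (mod i)) =>
        (N i).funMap F (fun j => Ψ i _ (b (some j))) = Ψ i s (b none))
    (hrel : ∀ {k : ℕ} {d : Fin k → L'.Sorts} (R : L'.Relations d),
      ClopenPred fun i (b : Fin k → Enum Φ (mod i)) => (N i).relMap R fun j => Ψ i _ (b j)) :
    ∃ (n : L'.Sorts → ℕ) (ε : ∀ s, L.Formula (Fin (n s) ⊕ Fin (n s)))
      (fn : ∀ {k : ℕ} {d : Fin k → L'.Sorts} {s : L'.Sorts}, L'.Functions d s →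
        L.Formula ((Σ i, Fin (n (d i))) ⊕ Fin (n s)))
      (rl : ∀ {k : ℕ} {d : Fin k → L'.Sorts}, L'.Relations d → L.Formula (Σ i, Fin (n (d i))))
      (C : ∀ i, (enumScheme Φ n ε fn rl).Coord (msStr (L := L) (mod i)) (N i)),
      ∀ i s (b : Enum Φ (mod i)), (C i).map s (initial b) = Ψ i s b := by
  have hc := hmod.countable
  choose n ε hε using fun s => (heq s).exists_eqv_formula hmod (E := fun i b c => Ψ i s b = Ψ i s c)
    fun i => ⟨fun _ => rfl, Eq.symm, Eq.trans⟩
  have hagree : ∀ i s (b c : Enum Φ (mod i)), (∀ j < n s, b.1 j = c.1 j) → Ψ i s b = Ψ i s c := by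
    intro i s b c h
    refine (hε s i b c).2 ?_
    have := (hε s i b b).1 rfl
    rwa [show (fun j : Fin (n s) => c.1 j) = fun j : Fin (n s) => b.1 j from
      funext fun j => (h j j.2).symm]
  choose fn hfn using fun (k : ℕ) (d : Fin k → L'.Sorts) (s : L'.Sorts) (F : L'.Functions d s) =>
    (hfun F).exists_formula_initial hmod (fun o => n (o.elim s d)) fun i b b' h h' => by
      rw [← funext fun j => hagree i (d j) _ _ (h (some j)), ← hagree i s _ _ (h none)]
      exact h'
  choose rl hrl using fun (k : ℕ) (d : Fin k → L'.Sorts) (R : L'.Relations d) =>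
    (hrel R).exists_formula_initial hmod (fun j => n (d j)) fun i b b' h h' => by
      rw [← funext fun j => hagree i (d j) _ _ (h j)]
      exact h'
  choose b hb using fun i s (x : (eqvSort Φ (n s) (ε s)).Dom (msStr (mod i))) => exists_initial x
  have hmap : ∀ i s (c : Enum Φ (mod i)), Ψ i s (b i s (initial c)) = Ψ i s c := fun i s c =>
    hagree i s _ _ fun j hj => congrFun (congrArg Subtype.val (hb i s (initial c))) ⟨j, hj⟩
  refine ⟨n, ε, fun F => (fn _ _ _ F).relabel fun
      | ⟨none, j⟩ => .inr j
      | ⟨some l, j⟩ => .inl ⟨l, j⟩, fun R => rl _ _ R, fun i =>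
    ⟨fun s x => Ψ i s (b i s x), fun s y => ?_, fun s x y => ?_, fun {k d s} F x y => ?_,
      fun {k d} R x => ?_⟩, hmap⟩
  · obtain ⟨c, rfl⟩ := hΨ i s y
    exact ⟨initial c, hmap i s c⟩
  · refine (hε s i _ _).trans ((rel_eqvSort (initial _) (initial _)).symm.trans ?_)
    exact iff_of_eq (congrArg₂ ((eqvSort Φ (n s) (ε s)).Rel (msStr (mod i))) (hb i s x) (hb i s y))
  · refine (hfn k d s F i fun o => match o with
      | none => b i s y
      | some j => b i (d j) (x j)).trans ?_
    refine Iff.trans ?_ (Formula.realize_relabel.symm.trans (realize_ofL _ _).symm)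
    refine iff_of_eq (congrArg _ (funext fun p => ?_))
    obtain ⟨_ | l, j⟩ := p
    · exact congrFun (congrArg Subtype.val (hb i s y)) j
    · exact congrFun (congrArg Subtype.val (hb i (d l) (x l))) j
  · refine (hrl k d R i fun j => b i (d j) (x j)).trans (Iff.trans ?_ (realize_ofL _ _).symm)
    exact iff_of_eq (congrArg _ (funext fun p =>
      congrFun (congrArg Subtype.val (hb i (d p.1) (x p.1))) p.2))

end EnumScheme

/-! ### Clopen sub-groupoids, cosets and the predicates of the groupoid language -/

section Cosets

variable {L : FirstOrder.Language.{u, v}} {T : L.Theory} {Φ : RichSeq L}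

namespace ThGroupoid

theorem exists_arr (g : ThGroupoid T Φ) :
    ∃ (M : Theory.ModelType.{u, v, 0} T) (a b : Enum Φ M), g = arr a b := by
  obtain ⟨M, a, b, ha, hb, rfl⟩ := exists_tp g
  exact ⟨M, ⟨a, ha⟩, ⟨b, hb⟩, rfl⟩

theorem isClopen_basic (ψ : L.Formula (ℕ ⊕ ℕ)) : IsClopen (basic ψ : Set (ThGroupoid T Φ)) := by
  refine ⟨⟨?_⟩, isOpen_basic ψ⟩
  convert isOpen_basic (T := T) (Φ := Φ) ψ.not using 1
  ext g
  obtain ⟨M, a, b, ha, hb, rfl⟩ := exists_tp g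
  rw [Set.mem_compl_iff, tp_mem_basic, tp_mem_basic, Formula.realize_not]

/-- A formula that defines an equivalence relation between enumerations gives a clopen
sub-groupoid. -/
noncomputable def eqvSub (ψ : L.Formula (ℕ ⊕ ℕ))
    (h : ∀ M : Theory.ModelType.{u, v, 0} T, Countable M →
    Equivalence fun b c : Enum Φ M => ψ.Realize (Sum.elim b.1 c.1)) :
    ClopenSub (ThGroupoid T Φ) := by
  refine ⟨basic ψ, isClopen_basic ψ, Set.ext fun g => ⟨fun hg => ?_, ?_⟩, fun e he => ?_⟩
  · obtain ⟨M, b, c, rfl⟩ := exists_arr g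
    refine ⟨_, hg, _, ⟨arr c c, arr_mem_basic.2 ((h M b.2.countable).refl _), rfl⟩, ?_⟩
    rw [inv_arr]
    exact mem_comp_arr
  · rintro ⟨f, hf, _, ⟨f', hf', rfl⟩, hg⟩
    obtain ⟨M, b, c, rfl⟩ := exists_arr f
    obtain ⟨d, hd, rfl⟩ := eq_of_mem_comp_arr hg
    obtain ⟨N, x, y, rfl⟩ := exists_arr f'
    rw [inv_arr] at hd
    have hyx : arr x y = arr d c := by rw [← inv_arr, hd, inv_arr]
    rw [hyx] at hf'
    have hE := h M b.2.countable
    exact arr_mem_basic.2 (hE.trans (arr_mem_basic.1 hf) (hE.symm (arr_mem_basic.1 hf')))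
  · obtain ⟨M, a, rfl⟩ := exists_arr_of_mem_base he
    exact arr_mem_basic.2 ((h M a.2.countable).refl a)

/-- A sub-groupoid containing the base gives an equivalence relation between enumerations. -/
theorem equivalence_arr_mem (H : ClopenSub (ThGroupoid T Φ)) (M : Theory.ModelType.{u, v, 0} T) :
    Equivalence fun b c : Enum Φ M => arr b c ∈ H.1 := by
  have hmul : ∀ {b c d : Enum Φ M}, arr b c ∈ H.1 → arr d c ∈ H.1 → arr b d ∈ H.1 := by
    intro b c d h h'
    rw [H.2.2.1]
    exact ⟨_, h, _, ⟨_, h', rfl⟩, by rw [inv_arr]; exact mem_comp_arr⟩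
  have hrefl : ∀ b : Enum Φ M, arr b b ∈ H.1 := fun b => H.2.2.2 (arr_mem_base b)
  exact ⟨hrefl, fun h => hmul (hrefl _) h, fun h h' => hmul h (hmul (hrefl _) h')⟩

theorem coset_arr_eq_iff {H : ClopenSub (ThGroupoid T Φ)} {M : Theory.ModelType.{u, v, 0} T}
    {a b c : Enum Φ M} : coset (arr a b) H.1 = coset (arr a c) H.1 ↔ arr b c ∈ H.1 := by
  have hE := equivalence_arr_mem H M
  have hmem : ∀ (b : Enum Φ M) k, k ∈ coset (arr a b) H.1 ↔ ∃ d, arr b d ∈ H.1 ∧ k = arr a d := by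
    intro b k
    constructor
    · rintro ⟨_, rfl, h, hh, hk⟩
      obtain ⟨d, rfl, rfl⟩ := eq_of_mem_comp_arr hk
      exact ⟨d, hh, rfl⟩
    · rintro ⟨d, hd, rfl⟩
      exact ⟨_, rfl, _, hd, mem_comp_arr⟩
  constructor
  · intro h
    obtain ⟨d, hd, hd'⟩ := (hmem b (arr a c)).1 (h ▸ (hmem c _).2 ⟨c, hE.refl c, rfl⟩)
    rwa [arr_left_cancel hd']
  · intro h
    ext k
    rw [hmem, hmem]
    exact ⟨fun ⟨d, hd, hk⟩ => ⟨d, hE.trans (hE.symm h) hd, hk⟩,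
      fun ⟨d, hd, hk⟩ => ⟨d, hE.trans h hd, hk⟩⟩

/-- Membership of `tp(b, c)` in a clopen set is a clopen predicate. -/
theorem clopenPred_arr_mem {ι : Type*} {mod : ι → Theory.ModelType.{u, v, 0} T}
    {U : Set (ThGroupoid T Φ)} (hU : IsClopen U) :
    ClopenPred fun i (p : Bool → Enum Φ (mod i)) => arr (p false) (p true) ∈ U := by
  have key : ∀ {U : Set (ThGroupoid T Φ)}, IsOpen U →
      OpenPred fun i (p : Bool → Enum Φ (mod i)) => arr (p false) (p true) ∈ U := by
    intro U hU i p hp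
    obtain ⟨ψ, h1, h2⟩ := exists_basic_subset hU hp
    have hψ : ∀ i (p : Bool → Enum Φ (mod i)), (ψ.relabel (Sum.elim (fun j => (false, j))
        fun j => (true, j))).Realize (enumVal p) ↔ arr (p false) (p true) ∈ basic ψ := by
      intro i p
      rw [Formula.realize_relabel, arr_mem_basic]
      refine iff_of_eq (congrArg _ (funext fun j => ?_))
      cases j <;> rfl
    exact ⟨_, (hψ i p).2 h1, fun i' p' h => h2 ((hψ i' p').1 h)⟩
  exact ⟨key hU.isOpen, key hU.compl.isOpen⟩

end ThGroupoid

open ThGroupoid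

variable (T Φ) in
/-- The enumerated countable models of `T`. They represent the neutral elements of the groupoid. -/
abbrev Pointed : Type _ := Σ M : Theory.ModelType.{u, v, 0} T, Enum Φ M

theorem isCover_pointed : IsCover (Sigma.fst : Pointed T Φ → Theory.ModelType.{u, v, 0} T) := by
  refine ⟨fun i => i.2.2.countable, fun M hM => ?_⟩
  obtain ⟨a⟩ := nonempty_enum Φ M
  exact ⟨⟨M, a⟩, rfl⟩

namespace Pointed

/-- The structure `M_e` for `e = tp(a, a)`. -/
noncomputable def str (i : Pointed T Φ) : (gLang (ThGroupoid T Φ)).Str :=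
  gStr (arr i.2 i.2) (arr_mem_base i.2)

/-- The coset `tp(a, b) H`. -/
noncomputable def cosetOf (i : Pointed T Φ) (H : ClopenSub (ThGroupoid T Φ)) (b : Enum Φ i.1) :
    i.str.carrier H :=
  ⟨coset (arr i.2 b) H.1, arr i.2 b, tgt_arr _ _, rfl⟩

variable {i : Pointed T Φ}

theorem cosetOf_eq_iff {H : ClopenSub (ThGroupoid T Φ)} {b c : Enum Φ i.1} :
    i.cosetOf H b = i.cosetOf H c ↔ arr b c ∈ H.1 :=
  Subtype.ext_iff.trans coset_arr_eq_iff

theorem cosetOf_surjective (i : Pointed T Φ) (H : ClopenSub (ThGroupoid T Φ)) :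
    Function.Surjective (i.cosetOf H) := by
  rintro ⟨_, g, hg, rfl⟩
  obtain ⟨b, rfl⟩ := exists_eq_arr_left hg
  exact ⟨b, rfl⟩

/-- The predicate `P_X`, in terms of enumerations. -/
theorem relMap_cosetOf {k : ℕ} {H : Fin k → (gLang (ThGroupoid T Φ)).Sorts}
    (X : (gLang (ThGroupoid T Φ)).Relations H) (b : Fin k → Enum Φ i.1) :
    i.str.relMap X (fun j => i.cosetOf (H j) (b j)) ↔ orbit (fib i.2 b) ∈ X.1 := by
  constructor
  · rintro ⟨p, hp, hc, hX⟩
    choose c hc' using fun j => exists_eq_arr_left ((p.2.2 j).symm.trans hp)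
    obtain rfl : p = fib i.2 c := Subtype.ext (Prod.ext hp (funext hc'))
    rw [X.2.2.2]
    refine ⟨fib i.2 c, fib i.2 b, hX, rfl, rfl, fun j => ⟨arr (c j) (b j), ?_, mem_comp_arr⟩⟩
    exact coset_arr_eq_iff.1 (hc j).symm
  · intro h
    exact ⟨fib i.2 b, rfl, fun j => rfl, h⟩

/-- Every invariant clopen predicate is given by one of the predicate symbols. -/
theorem exists_rel {k : ℕ} (hk : 1 ≤ k) (H : Fin k → (gLang (ThGroupoid T Φ)).Sorts)
    {P : ∀ i : Pointed T Φ, (Fin k → Enum Φ i.1) → Prop} (hP : ClopenPred P)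
    (h : ∀ i (b c : Fin k → Enum Φ i.1), (∀ j, arr (b j) (c j) ∈ (H j).1) → P i b → P i c) :
    ∃ X : (gLang (ThGroupoid T Φ)).Relations H, ∀ (i : Pointed T Φ) b,
      i.str.relMap X (fun j => i.cosetOf (H j) (b j)) ↔ P i b := by
  obtain ⟨X, hX, hXP⟩ := ThGroupoid.ClopenPred.exists_orbit isCover_pointed hP
  refine ⟨⟨X, hk, hX, Set.ext fun z => ⟨fun hz => ?_, ?_⟩⟩, fun i b => (relMap_cosetOf _ b).trans
    (hXP i i.2 b)⟩
  · obtain ⟨p, rfl⟩ := Quot.exists_rep z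
    obtain ⟨M, a, b, rfl⟩ := exists_fib p
    exact ⟨_, fib a b, hz, rfl, rfl, fun j => ⟨arr (b j) (b j), (H j).2.2.2 (arr_mem_base _),
      mem_comp_arr⟩⟩
  · rintro ⟨p, q, hp, rfl, hpq, hq⟩
    obtain ⟨M, a, b, rfl⟩ := exists_fib p
    have : ∀ j, ∃ c, arr (b j) c ∈ (H j).1 ∧ q.1.2 j = arr a c := fun j => by
      obtain ⟨g, hg, hgq⟩ := hq j
      obtain ⟨c, rfl, hc⟩ := eq_of_mem_comp_arr hgq
      exact ⟨c, hg, hc⟩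
    choose c hc hqc using this
    obtain rfl : q = fib a c := Subtype.ext (Prod.ext hpq.symm (funext hqc))
    exact (hXP ⟨M, a⟩ a c).2 (h ⟨M, a⟩ b c hc ((hXP ⟨M, a⟩ a b).1 hp))

/-- Every invariant clopen predicate is given by a formula of the groupoid language. -/
theorem exists_formula (hT : T.IsComplete) {A : Type} [Finite A]
    (σ : A → (gLang (ThGroupoid T Φ)).Sorts)
    {P : ∀ i : Pointed T Φ, (A → Enum Φ i.1) → Prop} (hP : ClopenPred P)
    (h : ∀ i (b c : A → Enum Φ i.1), (∀ x, arr (b x) (c x) ∈ (σ x).1) → P i b → P i c) :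
    ∃ φ : (gLang (ThGroupoid T Φ)).Formula σ, ∀ (i : Pointed T Φ) (v : ∀ x, i.str.carrier (σ x)) b,
      (∀ x, i.cosetOf (σ x) (b x) = v x) → (φ.Realize i.str v ↔ P i b) := by
  rcases isEmpty_or_nonempty A with hA | hA
  · obtain ⟨χ, hχ⟩ := hP.exists_formula isCover_pointed (A := Empty) Empty.elim
      fun i b b' _ hb => by rwa [Subsingleton.elim b' b]
    have hc : ∀ i b, P i b ↔ T ⊨ᵇ χ := fun i b => by
      rw [hχ, ← hT.realize_sentence_iff (φ := χ) i.1, Sentence.Realize,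
        Subsingleton.elim (enumVal b ∘ Empty.elim) default]
    by_cases hχ' : T ⊨ᵇ χ
    · exact ⟨.top, fun i v b _ => iff_of_true id ((hc i b).2 hχ')⟩
    · exact ⟨.falsum, fun i v b _ => iff_of_false id fun hb => hχ' ((hc i b).1 hb)⟩
  · let e := Finite.equivFin A
    obtain ⟨X, hX⟩ := exists_rel (Nat.card_pos (α := A)) (fun j => σ (e.symm j))
      (P := fun i b => P i (b ∘ e)) (hP.reindex e) fun i b c hbc hb => h i _ _ (fun x => by
        have := hbc (e x)
        rwa [e.symm_apply_apply] at this) hb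
    refine ⟨.rel X fun j => .var (e.symm j), fun i v b hv => ?_⟩
    obtain rfl := funext hv
    refine (hX i (b ∘ e.symm)).trans ?_
    rw [Function.comp_assoc, e.symm_comp_self, Function.comp_id]

end Pointed

theorem generic_gTheory : MSLanguage.Generic.{max u v, w} (gTheory (ThGroupoid T Φ))
    (Pointed.str : Pointed T Φ → _) := by
  intro φ h K hK
  refine hK φ fun e he => ?_
  obtain ⟨M, a, rfl⟩ := exists_arr_of_mem_base he
  exact h ⟨M, a⟩

end Cosets

/-! ### The theory interpreted in the theory of its groupoid -/

section EntryScheme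

variable {L : FirstOrder.Language.{u, v}} {T : L.Theory} {Φ : RichSeq L}

open ThGroupoid

/-- A sort of the groupoid language, as an interpretable sort. -/
noncomputable def sortOf (H : (gLang (ThGroupoid T Φ)).Sorts) : (gLang (ThGroupoid T Φ)).ISort :=
  ⟨1, fun _ => H, .top, .equal (s := H) (.var (σ := Sum.elim (fun _ => H) fun _ => H) (.inl 0))
    (.var (σ := Sum.elim (fun _ => H) fun _ => H) (.inr 0))⟩

/-- An interpretation of a single-sorted language in which the universe is the sort `H`. -/
noncomputable def sortScheme (H : (gLang (ThGroupoid T Φ)).Sorts)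
    (fn : ∀ {k : ℕ}, L.Functions k → (gLang (ThGroupoid T Φ)).Formula
      (Sum.elim (MSLanguage.prodCtx fun _ : Fin k => sortOf H) (sortOf H).ctx))
    (rl : ∀ {k : ℕ}, L.Relations k → (gLang (ThGroupoid T Φ)).Formula
      (MSLanguage.prodCtx fun _ : Fin k => sortOf H)) :
    MSLanguage.Scheme (gLang (ThGroupoid T Φ)) (msLang L) where
  sort _ := sortOf H
  func F := fn F
  rel R := rl R

/-- If `H` consists of the types `tp(b, c)` with `b_p = c_p`, where `b_p` may be any element, then
the sort of `H` is the universe of the model. -/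
theorem exists_sortScheme (hT : T.IsComplete) (H : (gLang (ThGroupoid T Φ)).Sorts) {p : ℕ}
    (hH : ∀ (i : Pointed T Φ) (b c : Enum Φ i.1), arr b c ∈ H.1 ↔ b.1 p = c.1 p)
    (hp : ∀ (i : Pointed T Φ) (x : i.1), ∃ b : Enum Φ i.1, b.1 p = x) :
    ∃ (fn : ∀ {k : ℕ}, L.Functions k → (gLang (ThGroupoid T Φ)).Formula
        (Sum.elim (MSLanguage.prodCtx fun _ : Fin k => sortOf H) (sortOf H).ctx))
      (rl : ∀ {k : ℕ}, L.Relations k → (gLang (ThGroupoid T Φ)).Formula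
        (MSLanguage.prodCtx fun _ : Fin k => sortOf H))
      (C : ∀ i : Pointed T Φ, (sortScheme H fn rl).Coord i.str (msStr (L := L) i.1)),
      ∀ i x b, i.cosetOf H b = x.1 (0 : Fin 1) → (C i).map () x = b.1 p := by
  have hsurj : ∀ (i : Pointed T Φ) (C : i.str.carrier H), ∃ b, i.cosetOf H b = C :=
    fun i => i.cosetOf_surjective H
  choose rep hrep using hsurj
  have hval : ∀ (i : Pointed T Φ) (b c : Enum Φ i.1), i.cosetOf H b = i.cosetOf H c ↔
      b.1 p = c.1 p := fun i b c => Pointed.cosetOf_eq_iff.trans (hH i b c)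
  choose fn hfn using fun (k : ℕ) (F : L.Functions k) => Pointed.exists_formula (Φ := Φ) hT
    (Sum.elim (MSLanguage.prodCtx fun _ : Fin k => sortOf H) (sortOf H).ctx)
    (P := fun i b => Structure.funMap F (fun j => (b (.inl ⟨j, (0 : Fin 1)⟩)).1 p) =
      (b (.inr (0 : Fin 1))).1 p)
    (clopenPred_of_formula (Term.equal
      (Term.func F fun j => Term.var ((.inl ⟨j, (0 : Fin 1)⟩, p) :
        ((Σ _ : Fin k, Fin 1) ⊕ Fin 1) × ℕ))
      (Term.var (.inr (0 : Fin 1), p))) fun i b => by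
        rw [Formula.realize_equal]
        rfl)
    fun i b c hbc hb => by
      rw [← (hH i _ _).1 (hbc (.inr (0 : Fin 1))),
        ← funext fun j => (hH i _ _).1 (hbc (.inl ⟨j, (0 : Fin 1)⟩))]
      exact hb
  choose rl hrl using fun (k : ℕ) (R : L.Relations k) => Pointed.exists_formula (Φ := Φ) hT
    (MSLanguage.prodCtx fun _ : Fin k => sortOf H)
    (P := fun i b => Structure.RelMap R fun j => (b ⟨j, (0 : Fin 1)⟩).1 p)
    (clopenPred_of_formula (Relations.formula R fun j =>
      Term.var ((⟨j, (0 : Fin 1)⟩, p) : (Σ _ : Fin k, Fin 1) × ℕ)) fun i b => by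
        rw [Formula.realize_rel]
        rfl)
    fun i b c hbc hb => by
      rw [← funext fun j => (hH i _ _).1 (hbc ⟨j, (0 : Fin 1)⟩)]
      exact hb
  refine ⟨fun F => fn _ F, fun R => rl _ R,
    fun i => ⟨fun _ x => (rep i (x.1 (0 : Fin 1))).1 p, fun _ x => ?_,
    fun _ x y => ?_, fun {k d s} F x y => ?_, fun {k d} R x => ?_⟩, fun i x b h => ?_⟩
  · obtain ⟨b, rfl⟩ := hp i x
    exact ⟨⟨fun _ => i.cosetOf H b, id⟩, (hval i _ _).1 (hrep i _)⟩
  · refine (hval i _ _).symm.trans ?_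
    exact iff_of_eq (congrArg₂ Eq (hrep i _) (hrep i _))
  · refine (hfn k F i _ (fun a => match a with
      | .inl a => rep i ((x a.1).1 (0 : Fin 1))
      | .inr a => rep i (y.1 (0 : Fin 1))) ?_).symm
    rintro (⟨j, l⟩ | l)
    · obtain rfl := Subsingleton.elim (0 : Fin 1) l
      exact hrep i _
    · obtain rfl := Subsingleton.elim (0 : Fin 1) l
      exact hrep i _
  · refine (hrl k R i _ (fun a => rep i ((x a.1).1 (0 : Fin 1))) ?_).symm
    rintro ⟨j, l⟩
    obtain rfl := Subsingleton.elim (0 : Fin 1) l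
    exact hrep i _
  · exact (hval i _ _).1 ((hrep i _).trans h.symm)

end EntryScheme

/-! ### Change of universe -/

section Universe

variable {L : FirstOrder.Language.{u, v}} {T : L.Theory}

/-- Every model in `Type` has a copy in every other universe. -/
theorem exists_models (M : Theory.ModelType.{u, v, 0} T) :
    ∃ K : MSLanguage.Str.{w} (msLang L), K.Models (msTheory T) := by
  let e : M ≃ ULift.{w} M := Equiv.ulift.symm
  let := e.inducedStructure (L := L)
  let e' : L.Equiv M (ULift.{w} M) := e.inducedStructureEquiv
  have hT : ULift.{w} M ⊨ T := StrongHomClass.theory_model e'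
  exact ⟨msStr (L := L) (ULift.{w} M), msStr_models_iff.2 hT⟩

/-- One model of a complete theory is a generic family. -/
theorem generic_of_models (hT : T.IsComplete) {K : MSLanguage.Str.{u'} (msLang L)}
    (hK : K.Models (msTheory T)) :
    MSLanguage.Generic.{u', w} (msTheory T) fun _ : Unit => K :=
  fun φ h _ hK' => (sat_iff_of_isComplete hT hK' hK φ).2 (h ())

end Universe

/-! ### Bi-interpretability with the theory of the groupoid -/

section Pointed

variable {L : FirstOrder.Language.{u, v}} {T : L.Theory} {Φ : RichSeq L}

open ThGroupoid

theorem Pointed.nonempty (hT : T.IsComplete) : Nonempty (Pointed T Φ) :=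
  let ⟨M, b, hb⟩ := exists_enumerated_model Φ hT.1
  ⟨⟨M, b, hb⟩⟩

variable {n : (gLang (ThGroupoid T Φ)).Sorts → ℕ} {ε : ∀ H, L.Formula (Fin (n H) ⊕ Fin (n H))}
  {fn : ∀ {k : ℕ} {d : Fin k → (gLang (ThGroupoid T Φ)).Sorts} {s : (gLang (ThGroupoid T Φ)).Sorts},
    (gLang (ThGroupoid T Φ)).Functions d s → L.Formula ((Σ i, Fin (n (d i))) ⊕ Fin (n s))}
  {rl : ∀ {k : ℕ} {d : Fin k → (gLang (ThGroupoid T Φ)).Sorts},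
    (gLang (ThGroupoid T Φ)).Relations d → L.Formula (Σ i, Fin (n (d i)))}
  {C : ∀ i : Pointed T Φ, (enumScheme (L' := gLang (ThGroupoid T Φ)) Φ n ε fn rl).Coord
    (msStr (L := L) i.1) i.str}
  (hC : ∀ i H b, (C i).map H (initial b) = i.cosetOf H b)
include hC

theorem rel_initial_iff {i : Pointed T Φ} {H : ClopenSub (ThGroupoid T Φ)} {b c : Enum Φ i.1} :
    (eqvSort Φ (n H) (ε H)).Rel (msStr i.1) (initial b) (initial c) ↔ arr b c ∈ H.1 :=
  ((C i).eqv H _ _).symm.trans ((iff_of_eq (congrArg₂ Eq (hC i H b) (hC i H c))).trans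
    Pointed.cosetOf_eq_iff)

/-- The elements of the model are definably identified with the cosets of a sub-groupoid of the
form `b_p = c_p`. -/
theorem exists_link_elements (H : ClopenSub (ThGroupoid T Φ)) {p : ℕ}
    (hH : ∀ (i : Pointed T Φ) (b c : Enum Φ i.1), arr b c ∈ H.1 ↔ b.1 p = c.1 p)
    (hp : ∀ (i : Pointed T Φ) (x : i.1), ∃ b : Enum Φ i.1, b.1 p = x) :
    ∃ χ : L.Formula (Unit ⊕ Σ _ : Fin 1, Fin (n H)), ∀ (i : Pointed T Φ) (x : i.1)
      (y : Fin 1 → (eqvSort Φ (n H) (ε H)).Dom (msStr i.1)) c, i.cosetOf H c = (C i).map H (y 0) →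
        (x = c.1 p ↔ χ.Realize (Sum.elim (fun _ => x) fun q => (y q.1).1 q.2)) := by
  have hval : ∀ (i : Pointed T Φ) (b c : Enum Φ i.1), i.cosetOf H b = i.cosetOf H c ↔
      b.1 p = c.1 p := fun i b c => Pointed.cosetOf_eq_iff.trans (hH i b c)
  obtain ⟨χ, hχ⟩ := (clopenPred_of_formula (mod := (Sigma.fst : Pointed T Φ → _))
    (P := fun i (b : Bool → Enum Φ i.1) => (b false).1 p = (b true).1 p)
    (Term.equal (Term.var (false, p)) (Term.var (true, p))) fun i b => by
      rw [Formula.realize_equal]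
      rfl).exists_formula isCover_pointed
    (Sum.elim (fun _ => (false, p)) fun q => (true, (q.2 : ℕ)) :
      (Unit ⊕ Σ _ : Fin 1, Fin (n H)) → Bool × ℕ) fun i b b' hb h => by
        have h1 : (b false).1 p = (b' false).1 p := congrFun hb (.inl ())
        have h2 : (initial (b true) : (eqvSort Φ (n H) (ε H)).Dom (msStr i.1)) =
            initial (b' true) := Subtype.ext (funext fun j => congrFun hb (.inr ⟨0, j⟩))
        have h3 := (hval i (b true) (b' true)).1 ((hC i H _).symm.trans
          ((congrArg ((C i).map H) h2).trans (hC i H _)))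
        rw [← h1, h, h3]
  refine ⟨χ, fun i x y c hc => ?_⟩
  have := i.2.2.countable
  obtain ⟨b, rfl⟩ := hp i x
  obtain ⟨d, hd⟩ := exists_initial (y 0)
  rw [(hval i c d).1 (hc.trans ((congrArg ((C i).map H) hd.symm).trans (hC i H d)))]
  refine (hχ i fun t => cond t d b).trans (iff_of_eq (congrArg _ (funext fun a => ?_)))
  rcases a with a | ⟨a, j⟩
  · rfl
  · obtain rfl := Subsingleton.elim 0 a
    exact congrFun (congrArg Subtype.val hd) j

/-- The cosets of a sub-groupoid are definably identified with the classes of tuples of elements of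
the model, if these are viewed as cosets. -/
theorem exists_link_cosets (hT : T.IsComplete) (H₀ H : ClopenSub (ThGroupoid T Φ)) {p : ℕ}
    (hH : ∀ (i : Pointed T Φ) (b c : Enum Φ i.1), arr b c ∈ H₀.1 ↔ b.1 p = c.1 p) :
    ∃ φ : (gLang (ThGroupoid T Φ)).Formula (Sum.elim (fun _ : Unit => H)
        (MSLanguage.prodCtx fun _ : Fin (n H) => sortOf H₀)),
      ∀ (i : Pointed T Φ) (x : i.str.carrier H) (y : Fin (n H) → (sortOf H₀).Dom i.str)
        (c : Fin (n H) → Enum Φ i.1) (z : (eqvSort Φ (n H) (ε H)).Dom (msStr i.1)),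
        (∀ j, i.cosetOf H₀ (c j) = (y j).1 (0 : Fin 1)) → (∀ j : Fin (n H), z.1 j = (c j).1 p) →
        (x = (C i).map H z ↔
          φ.Realize i.str (MSLanguage.sumVal i.str (fun _ => x) (MSLanguage.prodVal i.str y))) := by
  have hrel : ∀ {i : Pointed T Φ} (b : Enum Φ i.1) (z : (eqvSort Φ (n H) (ε H)).Dom (msStr i.1)),
      (eqvSort Φ (n H) (ε H)).Rel (msStr i.1) (initial b) z ↔ i.cosetOf H b = (C i).map H z :=
    fun {i} b z => ((C i).eqv H _ _).symm.trans (iff_of_eq (congrArg (· = _) (hC i H b)))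
  let f : Option (Fin (n H)) → Unit ⊕ Σ _ : Fin (n H), Fin 1
    | none => .inl ()
    | some j => .inr ⟨j, 0⟩
  obtain ⟨φ, hφ⟩ := Pointed.exists_formula hT (Sum.elim (fun _ : Unit => H)
    (MSLanguage.prodCtx fun _ : Fin (n H) => sortOf H₀))
    ((clopenPred_rel_tuple (ε H) p).reindex f) (by
      rintro i b c hbc ⟨z, hz, h⟩
      exact ⟨z, fun j => (hz j).trans ((hH i _ _).1 (hbc (.inr ⟨j, (0 : Fin 1)⟩))),
        (hrel _ z).2 ((Pointed.cosetOf_eq_iff.2 (hbc (.inl ()))).symm.trans ((hrel _ z).1 h))⟩)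
  refine ⟨φ, fun i x y c z hc hz => ?_⟩
  obtain ⟨b, rfl⟩ := i.cosetOf_surjective H x
  refine Iff.trans ?_ (hφ i _ (Sum.elim (fun _ => b) fun q => c q.1) ?_).symm
  · refine ⟨fun h => ⟨z, hz, (hrel b z).2 h⟩, ?_⟩
    rintro ⟨z', hz', h⟩
    obtain rfl : z' = z := Subtype.ext (funext fun j => (hz' j).trans (hz j).symm)
    exact (hrel b _).1 h
  · rintro (_ | ⟨j, l⟩)
    · rfl
    · obtain rfl := Subsingleton.elim (0 : Fin 1) l
      exact hc j

end Pointed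

section Reconstruct

variable {L : FirstOrder.Language.{u, v}} {T : L.Theory} {Φ : RichSeq L}

open ThGroupoid

variable {n : (gLang (ThGroupoid T Φ)).Sorts → ℕ} {ε : ∀ H, L.Formula (Fin (n H) ⊕ Fin (n H))}
  {fn : ∀ {k : ℕ} {d : Fin k → (gLang (ThGroupoid T Φ)).Sorts} {s : (gLang (ThGroupoid T Φ)).Sorts},
    (gLang (ThGroupoid T Φ)).Functions d s → L.Formula ((Σ i, Fin (n (d i))) ⊕ Fin (n s))}
  {rl : ∀ {k : ℕ} {d : Fin k → (gLang (ThGroupoid T Φ)).Sorts},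
    (gLang (ThGroupoid T Φ)).Relations d → L.Formula (Σ i, Fin (n (d i)))}
  {C : ∀ i : Pointed T Φ, (enumScheme (L' := gLang (ThGroupoid T Φ)) Φ n ε fn rl).Coord
    (msStr (L := L) i.1) i.str}
  (hC : ∀ i H b, (C i).map H (initial b) = i.cosetOf H b)
include hC

/-- The interpretation of the theory of the groupoid is part of a bi-interpretation. -/
theorem exists_isBiInterpretation (hT : T.IsComplete) :
    ∃ J : MSLanguage.Scheme (gLang (ThGroupoid T Φ)) (msLang L),
      MSLanguage.IsBiInterpretation.{w} (msTheory T) (gTheory (ThGroupoid T Φ))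
        (enumScheme Φ n ε fn rl) J := by
  have := Pointed.nonempty (Φ := Φ) hT
  obtain ⟨p, hplace⟩ := exists_place (T := T) Φ
  have hp := fun i : Pointed T Φ => hplace i.1 i.2.2.countable
  let ψ : L.Formula (ℕ ⊕ ℕ) := Term.equal (Term.var (.inl (p))) (Term.var (.inr (p)))
  have hψ : ∀ (M : Theory.ModelType.{u, v, 0} T) (b c : Enum Φ M),
      ψ.Realize (Sum.elim b.1 c.1) ↔ b.1 (p) = c.1 (p) := fun M b c => Formula.realize_equal
  let H : ClopenSub (ThGroupoid T Φ) := eqvSub ψ fun M _ =>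
    ⟨fun b => (hψ _ _ _).2 rfl, fun h => (hψ _ _ _).2 ((hψ _ _ _).1 h).symm,
      fun h h' => (hψ _ _ _).2 (((hψ _ _ _).1 h).trans ((hψ _ _ _).1 h'))⟩
  have hH : ∀ (i : Pointed T Φ) (b c : Enum Φ i.1), arr b c ∈ H.1 ↔ b.1 (p) = c.1 (p) :=
    fun i b c => arr_mem_basic.trans (hψ _ b c)
  obtain ⟨fn', rl', D, hD⟩ := exists_sortScheme hT H hH hp
  refine ⟨sortScheme H fn' rl', MSLanguage.Scheme.isBiInterpretation_of_generic
    (generic_of_isComplete hT Sigma.fst) generic_gTheory (fun i => msStr_models i.1)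
    (fun i φ hφ => hφ _ _) C D (fun _ => ?_) fun K => ?_⟩
  · obtain ⟨χ, hχ⟩ := exists_link_elements hC H hH hp
    refine ⟨ofL χ, fun i x y hy => ?_⟩
    obtain ⟨c, hc⟩ := Pointed.cosetOf_surjective i H ((C i).map H (y (0 : Fin 1)))
    refine (iff_of_eq (congrArg (Eq x) (hD i _ c hc))).trans ((hχ i x y c hc).trans ?_)
    refine ((realize_ofL χ _).symm.trans (iff_of_eq (congrArg _ (funext fun a => ?_))))
    rcases a with a | a <;> rfl
  · obtain ⟨φ, hφ⟩ := exists_link_cosets hC hT H K hH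
    refine ⟨φ, fun i x y hy => ?_⟩
    choose c hc using fun j : Fin (n K) => Pointed.cosetOf_surjective i H ((y j).1 (0 : Fin 1))
    exact hφ i x y c _ hc fun j => hD i _ _ (hc j)

/-- Every interpretable sort is in definable bijection with one of the sorts of the groupoid. -/
theorem exists_defBij (hT : T.IsComplete) {S : (msLang L).ISort}
    (hS : S.IsSortOf.{w} (msTheory T)) :
    ∃ H : ClopenSub (ThGroupoid T Φ), MSLanguage.ISort.DefBij.{w} (msTheory T) S
      ((enumScheme (L' := gLang (ThGroupoid T Φ)) Φ n ε fn rl).sort H) := by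
  have := Pointed.nonempty (Φ := Φ) hT
  obtain ⟨i₀⟩ := this
  obtain ⟨K, hK⟩ := exists_models.{u, v, w} i₀.1
  have hne : ∀ M : Theory.ModelType.{u, v, 0} T, Nonempty (S.Dom (msStr M)) := fun M =>
    (generic_of_models hT hK).nonempty_dom (fun _ => (hS K hK).1) (msStr_models M)
  have heq : ∀ M : Theory.ModelType.{u, v, 0} T, Equivalence (S.Rel (msStr M)) := fun M =>
    (generic_of_models hT hK).equivalence_rel (fun _ => (hS K hK).2) (msStr_models M)
  obtain ⟨r, hr⟩ := exists_henkin (T := T) Φ (toL S.dom) fun M _ =>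
    let ⟨x⟩ := hne M
    ⟨x.1, (realize_toL _ _).2 x.2⟩
  -- Representatives of all classes can be read off at the places `r`.
  let at' : ∀ {M : Theory.ModelType.{u, v, 0} T}, Enum Φ M → S.Dom (msStr M) := fun {M} b =>
    ⟨fun j => b.1 (r j), (realize_toL _ _).1 ((hr M b.2.countable).1 b)⟩
  have hat : ∀ {M : Theory.ModelType.{u, v, 0} T} [Countable M] (x : S.Dom (msStr M)),
      ∃ b : Enum Φ M, at' b = x := fun {M} hM x =>
    let ⟨b, hb⟩ := (hr M hM).2 x.1 ((realize_toL _ _).2 x.2)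
    ⟨b, Subtype.ext (funext hb)⟩
  let ψ : L.Formula (ℕ ⊕ ℕ) := (toL S.eqv).relabel (Sum.map r r)
  have hψ : ∀ {M : Theory.ModelType.{u, v, 0} T} (b c : Enum Φ M),
      ψ.Realize (Sum.elim b.1 c.1) ↔ S.Rel (msStr M) (at' b) (at' c) := fun {M} b c => by
    refine Formula.realize_relabel.trans ((realize_toL (M := M) _ _).trans ?_)
    refine iff_of_eq (congrArg _ (funext fun j => ?_))
    rcases j with j | j <;> rfl
  let H : ClopenSub (ThGroupoid T Φ) := eqvSub ψ fun M _ =>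
    ⟨fun b => (hψ _ _).2 ((heq M).refl _), fun h => (hψ _ _).2 ((heq M).symm ((hψ _ _).1 h)),
      fun h h' => (hψ _ _).2 ((heq M).trans ((hψ _ _).1 h) ((hψ _ _).1 h'))⟩
  have hH : ∀ {M : Theory.ModelType.{u, v, 0} T} (b c : Enum Φ M), arr b c ∈ H.1 ↔
      S.Rel (msStr M) (at' b) (at' c) := fun b c => arr_mem_basic.trans (hψ b c)
  have hrel : ∀ {i : Pointed T Φ} (b c : Enum Φ i.1),
      (eqvSort Φ (n H) (ε H)).Rel (msStr i.1) (initial b) (initial c) ↔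
        S.Rel (msStr i.1) (at' b) (at' c) := fun b c => (rel_initial_iff hC).trans (hH b c)
  have heq' : ∀ i : Pointed T Φ, Equivalence ((eqvSort Φ (n H) (ε H)).Rel (msStr i.1)) := fun i =>
    (C i).equivalence H
  obtain ⟨χ, hχ⟩ := (clopenPred_arr_mem (mod := (Sigma.fst : Pointed T Φ → _)) H.2.1).exists_formula
    isCover_pointed (Sum.elim (fun j => (false, r j)) fun j => (true, (j : ℕ)) :
      Fin S.arity ⊕ Fin (n H) → Bool × ℕ) fun i b b' hb h => by
        have h1 : at' (b false) = at' (b' false) :=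
          Subtype.ext (funext fun j => congrFun hb (.inl j))
        have h2 : (initial (b true) : (eqvSort Φ (n H) (ε H)).Dom (msStr i.1)) =
            initial (b' true) := Subtype.ext (funext fun j => congrFun hb (.inr j))
        have h3 : (eqvSort Φ (n H) (ε H)).Rel (msStr i.1) (initial (b true)) (initial (b' true)) :=
          h2 ▸ (heq' i).refl _
        refine (hH _ _).2 ((heq i.1).trans ?_ ((hrel _ _).1 h3))
        rw [← h1]
        exact (hH _ _).1 h
  have hβ : ∀ {i : Pointed T Φ} (b c : Enum Φ i.1),
      (ofL (σ := Sum.elim S.ctx (eqvSort Φ (n H) (ε H)).ctx) χ).Realize (msStr i.1)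
        (MSLanguage.sumVal (msStr i.1) (at' b).1
          (initial c : (eqvSort Φ (n H) (ε H)).Dom (msStr i.1)).1) ↔
        S.Rel (msStr i.1) (at' b) (at' c) := fun {i} b c => by
    refine (realize_ofL χ _).trans (Iff.trans ?_ ((hχ i fun t => cond t c b).symm.trans (hH b c)))
    refine iff_of_eq (congrArg _ (funext fun j => ?_))
    rcases j with j | j <;> rfl
  have hcount : ∀ i : Pointed T Φ, Countable i.1 := fun i => i.2.2.countable
  have : Nonempty (Pointed T Φ) := ⟨i₀⟩
  refine ⟨H, (generic_of_isComplete hT (Sigma.fst : Pointed T Φ → _)).defBij (ofL χ)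
    (fun i => heq i.1) heq' (fun i x => ?_) (fun i y => ?_) fun i x x' y y' => ?_⟩
  · obtain ⟨b, rfl⟩ := hat x
    exact ⟨initial b, (hβ b b).2 ((heq i.1).refl _)⟩
  · obtain ⟨b, rfl⟩ := exists_initial y
    exact ⟨at' b, (hβ b b).2 ((heq i.1).refl _)⟩
  · obtain ⟨b, rfl⟩ := hat x
    obtain ⟨b', rfl⟩ := hat x'
    obtain ⟨c, rfl⟩ := exists_initial y
    obtain ⟨c', rfl⟩ := exists_initial y'
    have hE := heq i.1
    intro h
    have h := (hβ b c).1 h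
    refine ⟨fun h' => ?_, fun h1 h2 => ?_⟩
    · have h' := (hβ b' c').1 h'
      exact Iff.trans ⟨fun h1 => hE.trans (hE.symm h) (hE.trans h1 h'),
        fun h1 => hE.trans h (hE.trans h1 (hE.symm h'))⟩ (hrel c c').symm
    · exact (hβ b' c').2 (hE.trans (hE.symm h1) (hE.trans h ((hrel c c').1 h2)))

/-- Every formula about the sorts of the groupoid is, modulo the theory, one of the predicates, in a
unique way. -/
theorem existsUnique_rel (hT : T.IsComplete) {k : ℕ} (hk : 1 ≤ k)
    (H : Fin k → (gLang (ThGroupoid T Φ)).Sorts)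
    (ψ : (msLang L).Formula (MSLanguage.prodCtx fun i =>
      (enumScheme (L' := gLang (ThGroupoid T Φ)) Φ n ε fn rl).sort (H i)))
    (hψ : MSLanguage.InvariantFormula.{w} (msTheory T) (fun i =>
      (enumScheme (L' := gLang (ThGroupoid T Φ)) Φ n ε fn rl).sort (H i)) ψ) :
    ∃! X : (gLang (ThGroupoid T Φ)).Relations H, ∀ K : MSLanguage.Str.{w} (msLang L),
      K.Models (msTheory T) → ∀ x : ∀ i,
        ((enumScheme (L' := gLang (ThGroupoid T Φ)) Φ n ε fn rl).sort (H i)).Dom K,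
        (ψ.Realize K (MSLanguage.prodVal K x) ↔
          ((enumScheme (L' := gLang (ThGroupoid T Φ)) Φ n ε fn rl).rel X).Realize K
            (MSLanguage.prodVal K x)) := by
  let I := enumScheme (L' := gLang (ThGroupoid T Φ)) Φ n ε fn rl
  obtain ⟨i₀⟩ := Pointed.nonempty (Φ := Φ) hT
  have : Nonempty (Pointed T Φ) := ⟨i₀⟩
  obtain ⟨K, hK⟩ := exists_models.{u, v, w} i₀.1
  have hcount : ∀ i : Pointed T Φ, Countable i.1 := fun i => i.2.2.countable
  have hinv : MSLanguage.InvariantFormula.{0} (msTheory T) (fun i => I.sort (H i)) ψ :=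
    (generic_of_models hT hK).invariant fun _ => hψ K hK
  let z : ∀ (i : Pointed T Φ), (Fin k → Enum Φ i.1) → ∀ j, (I.sort (H j)).Dom (msStr i.1) :=
    fun i b j => initial (b j)
  have hz : ∀ (i : Pointed T Φ) (x : ∀ j, (I.sort (H j)).Dom (msStr i.1)), ∃ b, z i b = x :=
    fun i x => by
      choose b hb using fun j => exists_initial (x j)
      exact ⟨b, funext hb⟩
  have hrel : ∀ (X : (gLang (ThGroupoid T Φ)).Relations H) (i : Pointed T Φ) b,
      (I.rel X).Realize (msStr i.1) (MSLanguage.prodVal (msStr i.1) (z i b)) ↔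
        i.str.relMap X fun j => i.cosetOf (H j) (b j) := fun X i b =>
    ((C i).rel X (z i b)).symm.trans
      (iff_of_eq (congrArg (i.str.relMap X) (funext fun j => hC i (H j) (b j))))
  obtain ⟨X, hX⟩ := Pointed.exists_rel hk H
    (P := fun i b => ψ.Realize (msStr i.1) (MSLanguage.prodVal (msStr i.1) (z i b)))
    (clopenPred_of_formula ((toL ψ).relabel fun p => (p.1, (p.2 : ℕ))) fun i b => by
      rw [Formula.realize_relabel]
      exact (realize_toL ψ _).symm)
    fun i b c h => (hinv _ (msStr_models i.1) _ _ fun j => (rel_initial_iff hC).2 (h j)).1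
  refine ⟨X, fun K' hK' x => ?_, fun X' hX' => ?_⟩
  · have h := (generic_of_isComplete.{u, v, w} hT (Sigma.fst : Pointed T Φ → _)).transferDom
      (S := fun j => I.sort (H j)) (φ := ψ.iff (I.rel X)) (fun i x => by
        obtain ⟨b, rfl⟩ := hz i x
        exact (MSLanguage.Formula.realize_iff_of Iff.rfl Iff.rfl).2
          ((hX i b).symm.trans (hrel X i b).symm)) hK' x
    exact (MSLanguage.Formula.realize_iff_of Iff.rfl Iff.rfl).1 h
  · have h : ∀ i b, i.str.relMap X' (fun j => i.cosetOf (H j) (b j)) ↔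
        ψ.Realize (msStr i.1) (MSLanguage.prodVal (msStr i.1) (z i b)) := fun i b => by
      have h := (generic_of_models.{u, v, w, 0} hT hK).transferDom
        (S := fun j => I.sort (H j)) (φ := ψ.iff (I.rel X')) (fun _ x =>
          (MSLanguage.Formula.realize_iff_of Iff.rfl Iff.rfl).2 (hX' K hK x))
        (msStr_models i.1) (z i b)
      exact (hrel X' i b).symm.trans
        ((MSLanguage.Formula.realize_iff_of Iff.rfl Iff.rfl).1 h).symm
    refine Subtype.ext (Set.ext fun o => ?_)
    obtain ⟨q, rfl⟩ := Quot.exists_rep o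
    obtain ⟨M, a, b, rfl⟩ := exists_fib q
    exact (Pointed.relMap_cosetOf (i := ⟨M, a⟩) X' b).symm.trans ((h ⟨M, a⟩ b).trans
      ((hX ⟨M, a⟩ b).symm.trans (Pointed.relMap_cosetOf (i := ⟨M, a⟩) X b)))

end Reconstruct

/-- The models of a complete theory interpret the structures of its groupoid. -/
theorem exists_enumScheme_gLang {L : FirstOrder.Language.{u, v}} {T : L.Theory} (Φ : RichSeq L) :
    ∃ (n : (gLang (ThGroupoid T Φ)).Sorts → ℕ) (ε : ∀ H, L.Formula (Fin (n H) ⊕ Fin (n H)))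
      (fn : ∀ {k : ℕ} {d : Fin k → (gLang (ThGroupoid T Φ)).Sorts}
        {s : (gLang (ThGroupoid T Φ)).Sorts},
        (gLang (ThGroupoid T Φ)).Functions d s → L.Formula ((Σ i, Fin (n (d i))) ⊕ Fin (n s)))
      (rl : ∀ {k : ℕ} {d : Fin k → (gLang (ThGroupoid T Φ)).Sorts},
        (gLang (ThGroupoid T Φ)).Relations d → L.Formula (Σ i, Fin (n (d i))))
      (C : ∀ i : Pointed T Φ, (enumScheme (L' := gLang (ThGroupoid T Φ)) Φ n ε fn rl).Coord
        (msStr (L := L) i.1) i.str),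
      ∀ i H b, (C i).map H (initial b) = i.cosetOf H b := by
  refine exists_enumScheme isCover_pointed (N := Pointed.str) (fun i H b => Pointed.cosetOf i H b)
    (fun i H => Pointed.cosetOf_surjective i H) (fun H => ?_) (fun F => F.elim) fun {k d} X => ?_
  · convert ThGroupoid.clopenPred_arr_mem (mod := (Sigma.fst : Pointed T Φ → _)) H.2.1 using 3
    exact Pointed.cosetOf_eq_iff
  · convert ThGroupoid.clopenPred_orbit isCover_pointed X.2.2.1 using 3 with i b
    refine (Pointed.relMap_cosetOf X b).trans ⟨fun h a => ?_, fun h => h _⟩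
    exact ThGroupoid.orbit_fib_eq i.2 a b ▸ h

/-! ### Theories with isomorphic groupoids -/

section Correspondence

namespace GroupoidIso

variable {G : Type u} {G' : Type u'} [TopologicalSpace G] [AlgGroupoid G] [TopologicalSpace G']
  [AlgGroupoid G'] (F : GroupoidIso G G')

/-- The inverse isomorphism. -/
def symm : GroupoidIso G' G where
  toHomeomorph := F.toHomeomorph.symm
  map_comp f g := by
    have h := F.map_comp (F.toEquiv.symm f) (F.toEquiv.symm g)
    rw [Equiv.apply_symm_apply, Equiv.apply_symm_apply] at h
    rw [← h, Part.map_map]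
    exact (congrArg (Part.map · _) (funext F.toEquiv.symm_apply_apply)).trans
      (Part.map_id' (fun _ => rfl) _)

theorem mem_comp {f g k : G} (h : k ∈ AlgGroupoid.comp f g) :
    F.toEquiv k ∈ AlgGroupoid.comp (F.toEquiv f) (F.toEquiv g) := by
  rw [← F.map_comp]
  exact Part.mem_map _ h

end GroupoidIso

open ThGroupoid

variable {L : FirstOrder.Language.{u, v}} {T : L.Theory} {Φ : RichSeq L}
  {L' : FirstOrder.Language.{u', v'}} {T' : L'.Theory} {Φ' : RichSeq L'}

theorem exists_map_arr (F : GroupoidIso (ThGroupoid T Φ) (ThGroupoid T' Φ'))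
    {M : Theory.ModelType.{u, v, 0} T} {M' : Theory.ModelType.{u', v', 0} T'} {a : Enum Φ M}
    {a' : Enum Φ' M'} (h : F.toEquiv (arr a a) = arr a' a') (b : Enum Φ M) :
    ∃ b', F.toEquiv (arr a b) = arr a' b' := by
  have h1 := F.mem_comp (mem_comp_arr (a := a) (b := a) (c := b))
  rw [h] at h1
  obtain ⟨c, hc, -⟩ := eq_of_mem_comp_arr h1
  exact ⟨c, hc⟩

theorem exists_map_base (F : GroupoidIso (ThGroupoid T Φ) (ThGroupoid T' Φ'))
    {M : Theory.ModelType.{u, v, 0} T} (a : Enum Φ M) :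
    ∃ (M' : Theory.ModelType.{u', v', 0} T') (a' : Enum Φ' M'), F.toEquiv (arr a a) = arr a' a' :=
  exists_arr_of_mem_base (F.mem_comp (mem_comp_arr (a := a) (b := a) (c := a)))

/-- Families of models of the two theories that correspond to each other by an isomorphism of the
groupoids: their enumerations are matched in such a way that the isomorphism maps `tp(b, c)` to the
type of the pair corresponding to `b, c`. -/
structure Correspondence (F : GroupoidIso (ThGroupoid T Φ) (ThGroupoid T' Φ')) {ι : Type*}
    (mod : ι → Theory.ModelType.{u, v, 0} T) (mod' : ι → Theory.ModelType.{u', v', 0} T') where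
  cover : IsCover mod
  cover' : IsCover mod'
  eqv : ∀ i, Enum Φ (mod i) ≃ Enum Φ' (mod' i)
  map_arr : ∀ i b c, F.toEquiv (arr b c) = arr (eqv i b) (eqv i c)

/-- The pairs of neutral elements that correspond to each other by an isomorphism. -/
abbrev LinkedPair (F : GroupoidIso (ThGroupoid T Φ) (ThGroupoid T' Φ')) : Type _ :=
  {q : Pointed T Φ × Pointed T' Φ' // F.toEquiv (arr q.1.2 q.1.2) = arr q.2.2 q.2.2}

theorem nonempty_correspondence (F : GroupoidIso (ThGroupoid T Φ) (ThGroupoid T' Φ')) :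
    Nonempty (Correspondence F (fun q : LinkedPair F => q.1.1.1) fun q => q.1.2.1) := by
  have hsymm : ∀ q : LinkedPair F, F.symm.toEquiv (arr q.1.2.2 q.1.2.2) = arr q.1.1.2 q.1.1.2 :=
    fun q => F.toEquiv.symm_apply_eq.2 q.2.symm
  choose f hf using fun (q : LinkedPair F) => exists_map_arr F q.2
  choose g hg using fun (q : LinkedPair F) => exists_map_arr F.symm (hsymm q)
  refine ⟨⟨⟨fun q => q.1.1.2.2.countable, fun M hM => ?_⟩,
    ⟨fun q => q.1.2.2.2.countable, fun M' hM' => ?_⟩, fun q => ⟨f q, g q, fun b => ?_, fun b => ?_⟩,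
    fun q b c => ?_⟩⟩
  · obtain ⟨i, rfl⟩ := isCover_pointed (Φ := Φ).exhausts M hM
    obtain ⟨M', a', h⟩ := exists_map_base F i.2
    exact ⟨⟨(i, ⟨M', a'⟩), h⟩, rfl⟩
  · obtain ⟨i, rfl⟩ := isCover_pointed (Φ := Φ').exhausts M' hM'
    obtain ⟨M, a, h⟩ := exists_map_base F.symm i.2
    exact ⟨⟨(⟨M, a⟩, i), (F.toEquiv.symm_apply_eq.1 h).symm⟩, rfl⟩
  · have h := hg q (f q b)
    rw [← hf] at h
    exact (arr_left_cancel ((F.toEquiv.symm_apply_apply _).symm.trans h)).symm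
  · have h := hf q (g q b)
    rw [← hg] at h
    exact (arr_left_cancel ((F.toEquiv.apply_symm_apply _).symm.trans h)).symm
  · have h := F.mem_comp (mem_comp_arr (a := q.1.1.2) (b := b) (c := c))
    rw [hf, hf] at h
    obtain ⟨d, hd, hd'⟩ := eq_of_mem_comp_arr h
    rw [hd]
    exact congrArg _ (arr_left_cancel hd').symm

namespace Correspondence

variable {F : GroupoidIso (ThGroupoid T Φ) (ThGroupoid T' Φ')} {ι : Type*}
  {mod : ι → Theory.ModelType.{u, v, 0} T} {mod' : ι → Theory.ModelType.{u', v', 0} T'}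

/-- The inverse correspondence. -/
def symm (c : Correspondence F mod mod') : Correspondence F.symm mod' mod where
  cover := c.cover'
  cover' := c.cover
  eqv i := (c.eqv i).symm
  map_arr i b d := by
    refine F.toEquiv.symm_apply_eq.2 ?_
    rw [c.map_arr, Equiv.apply_symm_apply, Equiv.apply_symm_apply]

variable (c : Correspondence F mod mod')
include c

/-- Clopen predicates of enumerations of the models of `T'` are clopen predicates of the
corresponding enumerations of the models of `T`. -/
theorem clopenPred {κ : Type} [Finite κ] {P : ∀ i, (κ → Enum Φ' (mod' i)) → Prop}
    (hP : ClopenPred P) : ClopenPred fun i (b : κ → Enum Φ (mod i)) => P i (c.eqv i ∘ b) := by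
  have key : ∀ {P : ∀ i, (κ → Enum Φ' (mod' i)) → Prop}, OpenPred P →
      OpenPred fun i (b : κ → Enum Φ (mod i)) => P i (c.eqv i ∘ b) := by
    intro P hP
    refine openPred_of_isOpen c.cover fun i b hb => ?_
    have := c.cover.countable i
    obtain ⟨a⟩ := nonempty_enum Φ (mod i)
    obtain ⟨ψ, h1, h2⟩ := hP i _ hb
    obtain ⟨O, hO, hO1, hO2⟩ := exists_isOpen_of_realize (a := c.eqv i a) h1
    have hF : Continuous F.toEquiv := F.toHomeomorph.continuous
    have hstar : ∀ i (a : Enum Φ (mod i)) (b : κ → Enum Φ (mod i)),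
        (F.toEquiv (star a b).1, fun k => F.toEquiv ((star a b).2 k)) =
          star (c.eqv i a) (c.eqv i ∘ b) := fun i a b =>
      Prod.ext (c.map_arr i a a) (funext fun k => c.map_arr i a (b k))
    refine ⟨(fun x => (F.toEquiv x.1, fun k => F.toEquiv (x.2 k))) ⁻¹' O, hO.preimage ?_, ⟨a, ?_⟩,
      fun i' a' b' h => h2 i' _ (hO2 _ (c.eqv i' a') _ ?_)⟩
    · exact (hF.comp continuous_fst).prodMk
        (continuous_pi fun k => hF.comp ((continuous_apply k).comp continuous_snd))
    · rw [Set.mem_preimage, hstar]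
      exact hO1
    · rw [← hstar]
      exact h
  exact ⟨key hP.isOpen, key hP.isOpen_not⟩

/-- If the entries with index `p` of enumerations of models of `T'` are arbitrary, then the models
of `T` interpret the corresponding models of `T'`. -/
theorem exists_scheme {p : ℕ} (hp : ∀ i (x : mod' i), ∃ b : Enum Φ' (mod' i), b.1 p = x) :
    ∃ (n : (msLang L').Sorts → ℕ) (ε : ∀ s, L.Formula (Fin (n s) ⊕ Fin (n s)))
      (fn : ∀ {k : ℕ} {d : Fin k → (msLang L').Sorts} {s : (msLang L').Sorts},
        (msLang L').Functions d s → L.Formula ((Σ i, Fin (n (d i))) ⊕ Fin (n s)))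
      (rl : ∀ {k : ℕ} {d : Fin k → (msLang L').Sorts},
        (msLang L').Relations d → L.Formula (Σ i, Fin (n (d i))))
      (C : ∀ i, (enumScheme (L' := msLang L') Φ n ε fn rl).Coord (msStr (L := L) (mod i))
        (msStr (L := L') (mod' i))),
      ∀ i s b, (C i).map s (initial b) = (c.eqv i b).1 p := by
  refine exists_enumScheme c.cover (N := fun i => msStr (L := L') (mod' i))
    (fun i _ b => (c.eqv i b).1 p) (fun i s x => ?_) (fun s => ?_) (fun {k d s} f => ?_)
    fun {k d} R => ?_
  · obtain ⟨b, hb⟩ := hp i x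
    exact ⟨(c.eqv i).symm b, (congrArg (fun b : Enum Φ' (mod' i) => b.1 p)
      (Equiv.apply_symm_apply _ _)).trans hb⟩
  · exact c.clopenPred (P := fun i b => (b false).1 p = (b true).1 p) (clopenPred_of_formula
      (Term.equal (Term.var (false, p)) (Term.var (true, p))) fun i b => by
        rw [Formula.realize_equal]
        rfl)
  · exact c.clopenPred (P := fun i b => Structure.funMap (L := L') f (fun j => (b (some j)).1 p) =
      (b none).1 p) (clopenPred_of_formula (Term.equal
        (Term.func (L := L') f fun j => Term.var (some j, p)) (Term.var (none, p))) fun i b => by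
        rw [Formula.realize_equal]
        rfl)
  · have key : ∀ R : L'.Relations k, ClopenPred fun i (b : Fin k → Enum Φ' (mod' i)) =>
        Structure.RelMap R fun j => (b j).1 p := fun R =>
      clopenPred_of_formula (Relations.formula R fun j => Term.var (j, p)) fun i b => by
        rw [Formula.realize_rel]
        rfl
    exact c.clopenPred (key R)

/-- The elements of the models of `T` are definably identified with those of their twice
interpreted copies. -/
theorem exists_link {n : (msLang L').Sorts → ℕ} {ε : ∀ s, L.Formula (Fin (n s) ⊕ Fin (n s))}
    {fn : ∀ {k : ℕ} {d : Fin k → (msLang L').Sorts} {s : (msLang L').Sorts},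
      (msLang L').Functions d s → L.Formula ((Σ i, Fin (n (d i))) ⊕ Fin (n s))}
    {rl : ∀ {k : ℕ} {d : Fin k → (msLang L').Sorts},
      (msLang L').Relations d → L.Formula (Σ i, Fin (n (d i)))}
    {C : ∀ i, (enumScheme (L' := msLang L') Φ n ε fn rl).Coord (msStr (L := L) (mod i))
      (msStr (L := L') (mod' i))} {p' : ℕ}
    (hC : ∀ i s b, (C i).map s (initial b) = (c.eqv i b).1 p')
    {n' : (msLang L).Sorts → ℕ} {ε' : ∀ s, L'.Formula (Fin (n' s) ⊕ Fin (n' s))}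
    {fn' : ∀ {k : ℕ} {d : Fin k → (msLang L).Sorts} {s : (msLang L).Sorts},
      (msLang L).Functions d s → L'.Formula ((Σ i, Fin (n' (d i))) ⊕ Fin (n' s))}
    {rl' : ∀ {k : ℕ} {d : Fin k → (msLang L).Sorts},
      (msLang L).Relations d → L'.Formula (Σ i, Fin (n' (d i)))}
    {D : ∀ i, (enumScheme (L' := msLang L) Φ' n' ε' fn' rl').Coord (msStr (L := L') (mod' i))
      (msStr (L := L) (mod i))} {p : ℕ}
    (hD : ∀ i s b, (D i).map s (initial b) = ((c.eqv i).symm b).1 p)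
    (hp : ∀ i (x : mod i), ∃ b : Enum Φ (mod i), b.1 p = x) (s : (msLang L).Sorts) :
    ∃ θ : MSLanguage.Scheme.TwiceFormula (enumScheme (L' := msLang L') Φ n ε fn rl)
        (enumScheme (L' := msLang L) Φ' n' ε' fn' rl') s,
      ∀ i x (y : ∀ _, (eqvSort Φ (n ()) (ε ())).Dom (msStr (mod i)))
        (hy : ((enumScheme (L' := msLang L) Φ' n' ε' fn' rl').sort s).dom.Realize
          (msStr (L := L') (mod' i)) fun j => (C i).map _ (y j)),
        x = (D i).map s ⟨fun j => (C i).map _ (y j), hy⟩ ↔ θ.Realize (msStr (L := L) (mod i))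
          (MSLanguage.sumVal (msStr (L := L) (mod i)) (fun _ => x)
            (MSLanguage.prodVal (msStr (L := L) (mod i)) y)) := by
  have hc := c.cover.countable
  have hP := c.clopenPred (clopenPred_rel_tuple (mod := mod') (Φ := Φ') (ε' s) p')
  have hPiff : ∀ i (b : Option (Fin (n' s)) → Enum Φ (mod i)),
      (∃ z : (eqvSort Φ' (n' s) (ε' s)).Dom (msStr (mod' i)),
        (∀ j : Fin (n' s), z.1 j = ((c.eqv i ∘ b) (some j)).1 p') ∧
        (eqvSort Φ' (n' s) (ε' s)).Rel (msStr (mod' i)) (initial ((c.eqv i ∘ b) none)) z) ↔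
      ∃ z : (eqvSort Φ' (n' s) (ε' s)).Dom (msStr (mod' i)),
        (∀ j : Fin (n' s), z.1 j = (C i).map () (initial (b (some j)))) ∧
        (b none).1 p = (D i).map s z := by
    intro i b
    refine exists_congr fun z => and_congr (forall_congr' fun j =>
      iff_of_eq (congrArg (z.1 j = ·) (hC i () _).symm)) ?_
    refine ((D i).eqv s _ _).symm.trans (iff_of_eq (congrArg (· = _) ((hD i s _).trans ?_)))
    rw [Function.comp_apply, Equiv.symm_apply_apply]
  obtain ⟨χ, hχ⟩ := hP.exists_formula c.cover (Sum.elim (fun _ => (none, p))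
    fun q => (some q.1, (q.2 : ℕ)) : (Unit ⊕ Σ _ : Fin (n' s), Fin (n ())) → _)
      fun i b b' hb h => by
      obtain ⟨z, hz, hzb⟩ := (hPiff i b).1 h
      refine (hPiff i b').2 ⟨z, fun j => (hz j).trans (congrArg ((C i).map ()) ?_), ?_⟩
      · exact Subtype.ext (funext fun l => congrFun hb (.inr ⟨j, l⟩))
      · exact (congrFun hb (.inl ())).symm.trans hzb
  refine ⟨ofL χ, fun i x y hy => ?_⟩
  obtain ⟨b, rfl⟩ := hp i x
  choose d hd using fun j => exists_initial (y j)
  obtain rfl : (fun j => initial (d j)) = y := funext hd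
  refine Iff.trans ?_ (((hPiff i fun o => o.elim b d).symm.trans (hχ i _)).trans ?_)
  · refine ⟨fun h => ⟨⟨_, hy⟩, fun j => rfl, h⟩, ?_⟩
    rintro ⟨z, hz, h⟩
    obtain rfl : z = ⟨_, hy⟩ := Subtype.ext (funext hz)
    exact h
  · refine Iff.trans (iff_of_eq (congrArg _ (funext fun a => ?_))) (realize_ofL χ _).symm
    rcases a with a | a <;> rfl

end Correspondence

/-- Theories with isomorphic groupoids are bi-interpretable. -/
theorem biInterpretable_of_groupoidIso (hT : T.IsComplete) (hT' : T'.IsComplete)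
    (F : GroupoidIso (ThGroupoid T Φ) (ThGroupoid T' Φ')) :
    MSLanguage.BiInterpretable.{w} (msTheory T) (msTheory T') := by
  obtain ⟨c⟩ := nonempty_correspondence F
  have hne : Nonempty (LinkedPair F) :=
    let ⟨i⟩ := Pointed.nonempty (Φ := Φ) hT
    let ⟨M', a', h⟩ := exists_map_base F i.2
    ⟨⟨(i, ⟨M', a'⟩), h⟩⟩
  obtain ⟨p, hp⟩ := exists_place (T := T) Φ
  obtain ⟨p', hp'⟩ := exists_place (T := T') Φ'
  have hp := fun i => hp _ (c.cover.countable i)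
  have hp' := fun i => hp' _ (c.cover'.countable i)
  obtain ⟨n, ε, fn, rl, C, hC⟩ := c.exists_scheme hp'
  obtain ⟨n', ε', fn', rl', D, hD⟩ := c.symm.exists_scheme hp
  exact ⟨_, _, MSLanguage.Scheme.isBiInterpretation_of_generic (generic_of_isComplete hT _)
    (generic_of_isComplete hT' _) (fun i => msStr_models _) (fun i => msStr_models _) C D
    (fun s => c.exists_link hC hD hp s) fun s => c.symm.exists_link hD hC hp' s⟩

end Correspondence

end Reconstruction

theorem mainTheorem1 (L : FirstOrder.Language.{u, v}) [Countable L.Symbols] (T : L.Theory)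
    (hT : T.IsComplete) (Φ : Reconstruction.RichSeq L) :
    -- `T(G)` is bi-interpretable with `T`
    (∃ (I : Reconstruction.MSLanguage.Scheme (Reconstruction.msLang L)
          (Reconstruction.gLang (Reconstruction.ThGroupoid T Φ)))
        (J : Reconstruction.MSLanguage.Scheme
          (Reconstruction.gLang (Reconstruction.ThGroupoid T Φ)) (Reconstruction.msLang L)),
      Reconstruction.MSLanguage.IsBiInterpretation.{w} (Reconstruction.msTheory T)
        (Reconstruction.gTheory (Reconstruction.ThGroupoid T Φ)) I J ∧
      -- the sorts of `T(G)` are, up to definable bijection, all the interpretable sorts of `T`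
      (∀ S : (Reconstruction.msLang L).ISort,
        S.IsSortOf.{w} (Reconstruction.msTheory T) →
          ∃ H : Reconstruction.ClopenSub (Reconstruction.ThGroupoid T Φ),
            Reconstruction.MSLanguage.ISort.DefBij.{w} (Reconstruction.msTheory T) S (I.sort H)) ∧
      -- the predicates of `T(G)` are, uniquely, all the `T`-formulas in these sorts
      (∀ (k : ℕ), 1 ≤ k →
        ∀ (H : Fin k → Reconstruction.ClopenSub (Reconstruction.ThGroupoid T Φ))
          (ψ : (Reconstruction.msLang L).Formula
            (Reconstruction.MSLanguage.prodCtx fun i => I.sort (H i))),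
          Reconstruction.MSLanguage.InvariantFormula.{w} (Reconstruction.msTheory T)
            (fun i => I.sort (H i)) ψ →
          ∃! X : (Reconstruction.gLang (Reconstruction.ThGroupoid T Φ)).Relations H,
            ∀ M : Reconstruction.MSLanguage.Str.{w} (Reconstruction.msLang L),
              M.Models (Reconstruction.msTheory T) → ∀ x : ∀ i, (I.sort (H i)).Dom M,
                (ψ.Realize M (Reconstruction.MSLanguage.prodVal M x) ↔
                  (I.rel X).Realize M (Reconstruction.MSLanguage.prodVal M x)))) ∧
    -- isomorphic groupoids come from bi-interpretable theories
    (∀ (L' : FirstOrder.Language.{u', v'}) [Countable L'.Symbols] (T' : L'.Theory),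
      T'.IsComplete → ∀ Φ' : Reconstruction.RichSeq L',
        Nonempty (Reconstruction.GroupoidIso (Reconstruction.ThGroupoid T Φ)
          (Reconstruction.ThGroupoid T' Φ')) →
        Reconstruction.MSLanguage.BiInterpretable.{w} (Reconstruction.msTheory T)
          (Reconstruction.msTheory T')) := by
  obtain ⟨n, ε, fn, rl, C, hC⟩ := Reconstruction.exists_enumScheme_gLang (T := T) Φ
  obtain ⟨J, hJ⟩ := Reconstruction.exists_isBiInterpretation hC hT
  exact ⟨⟨_, J, hJ, fun S hS => Reconstruction.exists_defBij hC hT hS,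
    fun k hk H ψ hψ => Reconstruction.existsUnique_rel hC hT hk H ψ hψ⟩,
    fun L' _ T' hT' Φ' ⟨F⟩ => Reconstruction.biInterpretable_of_groupoidIso hT hT' F⟩
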